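/- **Conventions.** Let $(M,g)$ be a smooth ($C^\infty$) Riemannian manifold of dimension $n\ge 4$ (Hausdorff, second countable, without boundary), with Levi-Civita connection $\nabla$, curvature tensor $R(X,Y,Z,T)=g(\nabla_X\nabla_YZ-\nabla_Y\nabla_XZ-\nabla_{[X,Y]}Z,\,T)$, Ricci tensor $\mathrm{Ric}(X,Y)=\mathrm{trace}\{V\mapsto R_{V,X}Y\}$, scalar curvature $S$ and traceless Ricci tensor $\mathrm{Ric}^\circ=\mathrm{Ric}-\frac Sn g$. The Weyl tensor is $W=R-g\odot\mathfrak k$, where $\mathfrak k=\frac1{n-2}\bigl(\mathrm{Ric}-\frac{S}{2(n-1)}g\bigr)$ and $(g\odot h)(X,Y,Z,T)=g(X,T)h(Y,Z)+g(Y,Z)h(X,T)-g(X,Z)h(Y,T)-g(Y,T)h(X,Z)$. Write $X^*=g(X,\cdot)$ and $X^*\wedge Y^*=X^*\otimes Y^*-Y^*\otimes X^*$. * $\mathcal W$ is the linear operator on $(0,2)$ tensors with $\mathcal W(X^*\otimes Y^*)(Z,T)=W(Y,Z,T,X)$. * $\delta W(X,Y,Z)=\sum_i(\nabla_{e_i}W)(X,Y,Z,e_i)$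 for an orthonormal frame $(e_i)$, and $\delta W_Z$ is the two-form $\delta W_Z(X,Y)=\delta W(X,Y,Z)$. * $\mathcal E_p=\{v\in T_pM : W(v,\cdot,\cdot,\cdot)=0\}$, $\mathrm{rank}(\mathcal E)$ is the function $p\mapsto\dim\mathcal E_p$, and $M_{\mathcal E}$ is the (open and dense) set of points of $M$ near which $\mathrm{rank}(\mathcal E)$ is constant. * $\mathfrak w:T_p^*M\to T_p^*M$, $\mathfrak w(\theta)=\sum_i f_i\lrcorner\,\mathcal W^2(\eta_i\wedge\theta)$ for a basis $(f_i)$ of $T_pM$ with dual basis $(\eta_i)$; $\mathfrak w^\#$ is its Moore–Penrose inverse with respect to $g$, i.e. $\mathfrak w\mathfrak w^\#\mathfrak w=\mathfrak w$, $\mathfrak w^\#\mathfrak w\mathfrak w^\#=\mathfrak w^\#$, and $\mathfrak w\mathfrak w^\#$, $\mathfrak w^\#\mathfrak w$ are $g$-symmetric. * The canonical vector field $\mathbb T$, which is smooth on $M_{\mathcal E}$, is given by $g(\mathbb T,\cdot)=\frac1{n-3}\,\mathfrak w^\#\Bigl(\sum_i e_i\lrcorner\,\mathcal W(\delta W_{e_i})\Bigr)$.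 * The conformal Ricci tensor with respect to a vector field $V$ is $E_V=\mathrm{Ric}^\circ+(n-2)\Bigl(\nabla V^*+V^*\otimes V^*-\frac1n\bigl(\mathrm{div}\,V+g(V,V)\bigr)g\Bigr)$. A metric is Einstein if its traceless Ricci tensor vanishes. **Theorem.** Let $(M,g)$ be a simply connected smooth Riemannian manifold of dimension $n\ge4$ such that $\mathrm{rank}(\mathcal E)=0$ on $M_{\mathcal E}$. Then there is a smooth function $\psi:M\to(0,\infty)$ such that $\psi^{-2}g$ is an Einstein metric on $M$ if and only if $E_{\mathbb T}=0$ on $M_{\mathcal E}$ and there is a $C^2$ vector field on $M$ that coincides with $\mathbb T$ on $M_{\mathcal E}$. -/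

import Mathlib

open scoped Manifold ContDiff Topology

noncomputable section

namespace ConformalEinstein

/-! ### Tensor calculus in a coordinate domain

`G : Coord n → Matrix (Fin n) (Fin n) ℝ` denotes the component matrix `(g_{ij})` of a Riemannian
metric as a function of the coordinates. Tensors are given by their components in the coordinate
frame `∂_0, …, ∂_{n-1}`. -/

/-- The coordinate space `ℝⁿ`. -/
abbrev Coord (n : ℕ) : Type := EuclideanSpace ℝ (Fin n)

variable {n : ℕ}

/-- The partial derivative `∂_k f` at `x`. -/
def pd (k : Fin n) (f : Coord n → ℝ) (x : Coord n) : ℝ :=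
  fderiv ℝ f x (EuclideanSpace.single k (1 : ℝ))

/-- The inverse metric `(g^{ij})`, i.e. the components of the inner product on covectors. -/
def ginv (G : Coord n → Matrix (Fin n) (Fin n) ℝ) (x : Coord n) : Matrix (Fin n) (Fin n) ℝ :=
  (G x)⁻¹

/-- `christoffel G x k i j` is the Christoffel symbol `Γ^k_{ij}` of the Levi-Civita connection,
`∇_{∂_i} ∂_j = ∑ k, Γ^k_{ij} ∂_k`. -/
def christoffel (G : Coord n → Matrix (Fin n) (Fin n) ℝ) (x : Coord n) (k i j : Fin n) : ℝ :=
  (1 / 2) * ∑ l, ginv G x k l *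
    (pd i (fun y => G y j l) x + pd j (fun y => G y i l) x - pd l (fun y => G y i j) x)

/-- `riemannUp G x i j k l` is the `∂_l`-component of `R_{∂_i, ∂_j} ∂_k`, where
`R_{X,Y} Z = ∇_X ∇_Y Z - ∇_Y ∇_X Z - ∇_{[X,Y]} Z`. -/
def riemannUp (G : Coord n → Matrix (Fin n) (Fin n) ℝ) (x : Coord n) (i j k l : Fin n) : ℝ :=
  pd i (fun y => christoffel G y l j k) x - pd j (fun y => christoffel G y l i k) x
    + ∑ m, (christoffel G x l i m * christoffel G x m j k
        - christoffel G x l j m * christoffel G x m i k)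

/-- The `(0,4)` curvature tensor `R(X,Y,Z,T) = g(R_{X,Y} Z, T)`. -/
def riemann (G : Coord n → Matrix (Fin n) (Fin n) ℝ) (x : Coord n) (i j k l : Fin n) : ℝ :=
  ∑ m, riemannUp G x i j k m * G x m l

/-- The Ricci tensor `Ric(X,Y) = trace (V ↦ R_{V,X} Y)`. -/
def ricci (G : Coord n → Matrix (Fin n) (Fin n) ℝ) (x : Coord n) (j k : Fin n) : ℝ :=
  ∑ i, riemannUp G x i j k i

/-- The scalar curvature `S`. -/
def scalar (G : Coord n → Matrix (Fin n) (Fin n) ℝ) (x : Coord n) : ℝ :=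
  ∑ j, ∑ k, ginv G x j k * ricci G x j k

/-- The traceless Ricci tensor `Ric - (S / n) g`. -/
def tracelessRicci (G : Coord n → Matrix (Fin n) (Fin n) ℝ) (x : Coord n) (i j : Fin n) : ℝ :=
  ricci G x i j - scalar G x / (n : ℝ) * G x i j

/-- The Schouten tensor `(1 / (n - 2)) (Ric - S / (2 (n - 1)) g)`. -/
def schouten (G : Coord n → Matrix (Fin n) (Fin n) ℝ) (x : Coord n) (i j : Fin n) : ℝ :=
  1 / ((n : ℝ) - 2) * (ricci G x i j - 1 / (2 * ((n : ℝ) - 1)) * scalar G x * G x i j)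

/-- The Kulkarni-Nomizu product of two symmetric `(0,2)` tensors:
`(g ⊙ h)(X,Y,Z,T) = g(X,T) h(Y,Z) + g(Y,Z) h(X,T) - g(X,Z) h(Y,T) - g(Y,T) h(X,Z)`. -/
def kulkarniNomizu (g h : Fin n → Fin n → ℝ) (i j k l : Fin n) : ℝ :=
  g i l * h j k + g j k * h i l - g i k * h j l - g j l * h i k

/-- The Weyl tensor `W = R - g ⊙ (Schouten)` as a `(0,4)` tensor. -/
def weyl (G : Coord n → Matrix (Fin n) (Fin n) ℝ) (x : Coord n) (i j k l : Fin n) : ℝ :=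
  riemann G x i j k l - kulkarniNomizu (fun a b => G x a b) (schouten G x) i j k l

/-- The space of all vectors `v` with `W(v, ·, ·, ·) = 0` at `x`. -/
def localWeylKernel (G : Coord n → Matrix (Fin n) (Fin n) ℝ) (x : Coord n) :
    Submodule ℝ (Coord n) where
  carrier := {v | ∀ j k l : Fin n, ∑ i, v i * weyl G x i j k l = 0}
  add_mem' := by
    intro v w hv hw j k l
    simp [add_mul, Finset.sum_add_distrib, hv j k l, hw j k l]
  zero_mem' := by
    intro j k l
    simp
  smul_mem' := by
    intro c v hv j k l
    simp [mul_assoc, ← Finset.mul_sum, hv j k l]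

/-- The components `(∇_{∂_m} W)(∂_i, ∂_j, ∂_k, ∂_l)`. -/
def nablaWeyl (G : Coord n → Matrix (Fin n) (Fin n) ℝ) (x : Coord n) (m i j k l : Fin n) : ℝ :=
  pd m (fun y => weyl G y i j k l) x
    - ∑ a, (christoffel G x a m i * weyl G x a j k l + christoffel G x a m j * weyl G x i a k l
        + christoffel G x a m k * weyl G x i j a l + christoffel G x a m l * weyl G x i j k a)

/-- The divergence in the fourth slot: `δW(X,Y,Z) = ∑ (∇_{e_s} W)(X,Y,Z,e_s)` for an orthonormal
frame `e_s`. -/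
def divWeyl (G : Coord n → Matrix (Fin n) (Fin n) ℝ) (x : Coord n) (i j k : Fin n) : ℝ :=
  ∑ m, ∑ l, ginv G x m l * nablaWeyl G x m i j k l

/-- The action `𝒲` of the Weyl tensor on `(0,2)` tensors, i.e. the linear map with
`𝒲(X* ⊗ Y*)(Z,T) = W(Y,Z,T,X)`, where `X* = g(X, ·)`. -/
def weylOp (G : Coord n → Matrix (Fin n) (Fin n) ℝ) (x : Coord n) (b : Fin n → Fin n → ℝ)
    (k l : Fin n) : ℝ :=
  ∑ i, ∑ j, (∑ a, ∑ c, ginv G x i a * ginv G x j c * b a c) * weyl G x j k l i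

/-- The components of the two-form `dx^i ∧ dx^j = dx^i ⊗ dx^j - dx^j ⊗ dx^i`. -/
def wedge (i j : Fin n) (a b : Fin n) : ℝ :=
  (if a = i then 1 else 0) * (if b = j then 1 else 0)
    - (if a = j then 1 else 0) * (if b = i then 1 else 0)

/-- The matrix, in the frame `dx^0, …, dx^{n-1}`, of the endomorphism `𝔴` of the cotangent space,
the negative Ricci contraction of `𝒲² = 𝒲 ∘ 𝒲`: `𝔴(θ) = ∑ i, ∂_i ⌟ 𝒲²(dx^i ∧ θ)`. -/
def weylSq (G : Coord n → Matrix (Fin n) (Fin n) ℝ) (x : Coord n) : Matrix (Fin n) (Fin n) ℝ :=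
  Matrix.of fun k j => ∑ i, weylOp G x (weylOp G x (wedge i j)) i k

/-- `B` is a Moore-Penrose inverse of the endomorphism `A` with respect to the inner product with
Gram matrix `h`: `A B A = A`, `B A B = B`, and `A B`, `B A` are symmetric with respect to `h`. -/
structure IsMoorePenrose (h A B : Matrix (Fin n) (Fin n) ℝ) : Prop where
  mul_mul_left : A * B * A = A
  mul_mul_right : B * A * B = B
  symm_left : (h * (A * B)).IsSymm
  symm_right : (h * (B * A)).IsSymm

open Classical in
/-- The Moore-Penrose inverse of `A` with respect to the inner product with Gram matrix `h`
(it always exists and is unique when `h` is positive definite). -/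
def moorePenrose (h A : Matrix (Fin n) (Fin n) ℝ) : Matrix (Fin n) (Fin n) ℝ :=
  if H : ∃ B, IsMoorePenrose h A B then H.choose else 0

/-- The covector `∑ s, e_s ⌟ 𝒲(δW_{e_s})` for an orthonormal frame `e_s`, where `δW_Z` is the
two-form `δW_Z(X,Y) = δW(X,Y,Z)`. -/
def weylDivCovector (G : Coord n → Matrix (Fin n) (Fin n) ℝ) (x : Coord n) (k : Fin n) : ℝ :=
  ∑ a, ∑ b, ginv G x a b * weylOp G x (fun i j => divWeyl G x i j b) a k

/-- The covector `𝕋* = (1 / (n - 3)) 𝔴^# (∑ s, e_s ⌟ 𝒲(δW_{e_s}))`. -/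
def canonicalCovector (G : Coord n → Matrix (Fin n) (Fin n) ℝ) (x : Coord n) (k : Fin n) : ℝ :=
  1 / ((n : ℝ) - 3) *
    (moorePenrose (ginv G x) (weylSq G x)).mulVec (weylDivCovector G x) k

/-- The components `(∇_{∂_i} V)^k` of the covariant derivative of a vector field `V`. -/
def nablaVec (G : Coord n → Matrix (Fin n) (Fin n) ℝ) (V : Coord n → Coord n) (x : Coord n)
    (i k : Fin n) : ℝ :=
  pd i (fun y => V y k) x + ∑ l, christoffel G x k i l * V x l

/-- The components `V*_j = g(V, ∂_j)`. -/
def flat (G : Coord n → Matrix (Fin n) (Fin n) ℝ) (V : Coord n → Coord n) (x : Coord n)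
    (j : Fin n) : ℝ :=
  ∑ k, V x k * G x k j

/-- The divergence `div V = ∑ i, (∇_{∂_i} V)^i`. -/
def divVec (G : Coord n → Matrix (Fin n) (Fin n) ℝ) (V : Coord n → Coord n) (x : Coord n) : ℝ :=
  ∑ i, nablaVec G V x i i

/-- `g(V, V)`. -/
def normSqVec (G : Coord n → Matrix (Fin n) (Fin n) ℝ) (V : Coord n → Coord n) (x : Coord n) :
    ℝ :=
  ∑ i, ∑ j, G x i j * V x i * V x j

/-- The conformal Ricci tensor with respect to the vector field `V`,
`E_V = Ric° + (n - 2) (∇V* + V* ⊗ V* - (1 / n) (div V + g(V,V)) g)`,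
where `(∇V*)(X,Y) = g(∇_X V, Y)`. -/
def localConformalRicci (G : Coord n → Matrix (Fin n) (Fin n) ℝ) (V : Coord n → Coord n)
    (x : Coord n) (i j : Fin n) : ℝ :=
  tracelessRicci G x i j + ((n : ℝ) - 2) *
    ((∑ k, nablaVec G V x i k * G x k j) + flat G V x i * flat G V x j
      - 1 / (n : ℝ) * (divVec G V x + normSqVec G V x) * G x i j)

/-! ### Riemannian manifolds -/

variable {M : Type*} [TopologicalSpace M] [ChartedSpace (EuclideanSpace ℝ (Fin n)) M]

/-- Smooth Riemannian metrics on the smooth `n`-manifold `M`. -/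
abbrev Metric (n : ℕ) (M : Type*) [TopologicalSpace M]
    [ChartedSpace (EuclideanSpace ℝ (Fin n)) M] [IsManifold (𝓡 n) ∞ M] :=
  Bundle.ContMDiffRiemannianMetric (𝓡 n) ∞ (EuclideanSpace ℝ (Fin n))
    (fun p : M => TangentSpace (𝓡 n) p)

/-- The coordinates of `p` in the preferred chart at `p`. -/
def center (p : M) : Coord n := extChartAt (𝓡 n) p p

/-- The `i`-th coordinate vector field of the preferred chart at `p`, at the point with coordinates
`y`. In Mathlib, `TangentSpace (𝓡 n) p` is `ℝⁿ` by means of the preferred chart at `p`, so that at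
`y = center p` this is the `i`-th standard basis vector. -/
def coordVec (p : M) (y : Coord n) (i : Fin n) :
    TangentSpace (𝓡 n) ((extChartAt (𝓡 n) p).symm y) :=
  mfderiv 𝓘(ℝ, EuclideanSpace ℝ (Fin n)) (𝓡 n) (extChartAt (𝓡 n) p).symm y
    (EuclideanSpace.single i (1 : ℝ) : EuclideanSpace ℝ (Fin n))

/-- The components of a vector field `V` in the preferred chart at `p`. -/
def vecInChart (V : (q : M) → TangentSpace (𝓡 n) q) (p : M) (y : Coord n) : Coord n :=
  mfderiv (𝓡 n) 𝓘(ℝ, EuclideanSpace ℝ (Fin n)) (extChartAt (𝓡 n) p)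
    ((extChartAt (𝓡 n) p).symm y) (V ((extChartAt (𝓡 n) p).symm y))

variable [IsManifold (𝓡 n) ∞ M]

/-- The component matrix of the metric in the preferred chart at `p`. -/
def metricInChart (g : Metric n M) (p : M) (y : Coord n) : Matrix (Fin n) (Fin n) ℝ :=
  Matrix.of fun i j =>
    g.inner ((extChartAt (𝓡 n) p).symm y) (coordVec p y i) (coordVec p y j)

/-- `ℰ_p = {v ∈ T_p M | W(v, ·, ·, ·) = 0}`. -/
def weylKernel (g : Metric n M) (p : M) : Submodule ℝ (TangentSpace (𝓡 n) p) :=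
  localWeylKernel (metricInChart g p) (center p)

/-- `M_ℰ`: the set of points at which the rank of `ℰ` is locally constant. -/
def regularSet (g : Metric n M) : Set M :=
  {p | ∀ᶠ q in 𝓝 p, Module.finrank ℝ (weylKernel g q) = Module.finrank ℝ (weylKernel g p)}

/-- The canonical vector field `𝕋`, the `g`-dual of `𝕋*`. -/
def canonicalField (g : Metric n M) (p : M) : TangentSpace (𝓡 n) p :=
  (WithLp.toLp 2 fun k => ∑ j, ginv (metricInChart g p) (center p) k j *
    canonicalCovector (metricInChart g p) (center p) j : EuclideanSpace ℝ (Fin n))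

/-- The components at `p` of the conformal Ricci tensor `E_V` of a vector field `V` on `M`. -/
def conformalRicci (g : Metric n M) (V : (q : M) → TangentSpace (𝓡 n) q) (p : M)
    (i j : Fin n) : ℝ :=
  localConformalRicci (metricInChart g p) (vecInChart V p) (center p) i j

/-- `g` is an Einstein metric: its traceless Ricci tensor vanishes. -/
def IsEinstein (g : Metric n M) : Prop :=
  ∀ (p : M) (i j : Fin n), tracelessRicci (metricInChart g p) (center p) i j = 0

/-- `h = ψ⁻² g` for some smooth positive function `ψ` on all of `M`. -/
def IsGloballyConformal (g h : Metric n M) : Prop :=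
  ∃ ψ : M → ℝ, ContMDiff (𝓡 n) 𝓘(ℝ, ℝ) ∞ ψ ∧ (∀ p, 0 < ψ p) ∧
    ∀ (p : M) (v w : TangentSpace (𝓡 n) p), h.inner p v w = (ψ p ^ 2)⁻¹ * g.inner p v w

end ConformalEinstein

end

/-! Write ψ = e^f. The traceless Ricci tensor of ψ⁻²g is E_V for V the gradient of f
(`IsMetricOn.tracelessRicci_conformal`), so Einstein metrics of the form ψ⁻²g correspond to gradient
fields V with E_V = 0. The theorem therefore has two halves: such a V must be 𝕋 wherever ℰ vanishes,
and a C² field V solving E_V = 0 is automatically smooth and a gradient.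

Uniqueness. E_V = 0 says that ∇V* + V* ⊗ V* + P is a multiple of g, with P the Schouten tensor.
Antisymmetrising a further covariant derivative and using the Ricci identity gives Cotton =
W(·,·,·,V); since δW = (n - 3) Cotton by the second Bianchi identity, δW = (n - 3) W(·,·,·,V)
(`FormalMetric.div₄_W_eq`). Applying 𝒲 and contracting turns this into ∑ e_i ⌟ 𝒲(δW_{e_i}) = (n - 3)
𝔴(V*). A covector killed by 𝔴 is dual to a vector of ℰ
(`IsMetricOn.mem_localWeylKernel_of_weylSq_mulVec`), so where ℰ = 0 the endomorphism 𝔴 is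
invertible, its Moore-Penrose inverse is its inverse, and V = 𝕋 (`IsMetricOn.canonicalCovector_eq`).

Converse. The rank of ℰ is upper semicontinuous, so M_ℰ is dense (`dense_regularSet`) and E_V = 0
extends from M_ℰ to M by continuity. Every term of E_V other than ∇V* is symmetric, so V* is closed,
hence exact on a simply connected manifold (`exists_potential`). The equation is an overdetermined
first order system whose only free function is the trace μ; equality of mixed partials determines
dμ, and a bootstrap makes V smooth (`contDiffOn_infty_of_overdetermined`). Then e^{-2f} g is
Einstein.

Method. The tensor identities are algebra over a commutative ring with commuting derivations
(`FormalMetric`). They are applied to the ring of germs of smooth functions at a point, where an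
equation means an identity of functions near that point. Objects on M are defined at each point in
that point's own preferred chart; the transformation laws of `IsPullbackOn` compare them with the
expressions in one fixed chart. -/

noncomputable section

namespace ConformalEinstein

open Matrix

/-! ### Tensor calculus in a commutative ring with commuting derivations -/

section Derivations

variable {n : ℕ} {A : Type*} [CommRing A] [Algebra ℝ A]

/-- Entrywise application of a derivation to a matrix. -/
def dMat (d : Derivation ℝ A A) (X : Matrix (Fin n) (Fin n) A) : Matrix (Fin n) (Fin n) A :=
  X.map d

@[simp] lemma dMat_apply (d : Derivation ℝ A A) (X : Matrix (Fin n) (Fin n) A) (i j : Fin n) :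
    dMat d X i j = d (X i j) := rfl

lemma dMat_add (d : Derivation ℝ A A) (X Y : Matrix (Fin n) (Fin n) A) :
    dMat d (X + Y) = dMat d X + dMat d Y := by
  ext i j; simp

lemma dMat_sub (d : Derivation ℝ A A) (X Y : Matrix (Fin n) (Fin n) A) :
    dMat d (X - Y) = dMat d X - dMat d Y := by
  ext i j; simp

lemma dMat_mul (d : Derivation ℝ A A) (X Y : Matrix (Fin n) (Fin n) A) :
    dMat d (X * Y) = dMat d X * Y + X * dMat d Y := by
  ext i j
  simp only [dMat_apply, mul_apply, map_sum, Derivation.leibniz, Matrix.add_apply, smul_eq_mul,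
    Finset.sum_add_distrib]
  rw [add_comm]
  congr 1
  exact Finset.sum_congr rfl fun _ _ => mul_comm _ _

lemma dMat_transpose (d : Derivation ℝ A A) (X : Matrix (Fin n) (Fin n) A) :
    dMat d Xᵀ = (dMat d X)ᵀ := rfl

lemma dMat_one (d : Derivation ℝ A A) : dMat d (1 : Matrix (Fin n) (Fin n) A) = 0 := by
  ext i j
  by_cases h : i = j <;> simp [one_apply, h]

lemma dMat_sum {ι : Type*} (s : Finset ι) (d : Derivation ℝ A A)
    (X : ι → Matrix (Fin n) (Fin n) A) : dMat d (∑ a ∈ s, X a) = ∑ a ∈ s, dMat d (X a) := by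
  ext i j
  simp [Matrix.sum_apply]

lemma dMat_smul (d : Derivation ℝ A A) (c : A) (X : Matrix (Fin n) (Fin n) A) :
    dMat d (c • X) = d c • X + c • dMat d X := by
  ext i j
  simp
  ring

lemma dMat_comm {d e : Derivation ℝ A A} (h : ∀ a, d (e a) = e (d a))
    (X : Matrix (Fin n) (Fin n) A) : dMat d (dMat e X) = dMat e (dMat d X) := by
  ext i j; simp [h]

/-- A ring of germs is not a domain, so the only cancellations available are by nonzero real
constants. -/
lemma eq_zero_of_algebraMap_mul {c : ℝ} (hc : c ≠ 0) {a : A} (h : algebraMap ℝ A c * a = 0) :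
    a = 0 := by
  have := congrArg (algebraMap ℝ A c⁻¹ * ·) h
  simpa [← mul_assoc, ← map_mul, hc] using this

lemma eq_zero_of_two_mul {a : A} (h : 2 * a = 0) : a = 0 :=
  eq_zero_of_algebraMap_mul (c := 2) two_ne_zero (by rwa [map_ofNat])

end Derivations

/-- A metric `G` with inverse `Gi` and its Levi-Civita connection `Γ i l k = Γ^l_{ik}` over a
commutative ring with commuting derivations. -/
structure FormalMetric (n : ℕ) (A : Type*) [CommRing A] [Algebra ℝ A] where
  /-- the coordinate derivations -/
  D : Fin n → Derivation ℝ A A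
  /-- the metric -/
  G : Matrix (Fin n) (Fin n) A
  /-- the inverse metric -/
  Gi : Matrix (Fin n) (Fin n) A
  /-- the connection matrices -/
  Γ : Fin n → Matrix (Fin n) (Fin n) A
  D_comm : ∀ i j a, D i (D j a) = D j (D i a)
  G_symm : Gᵀ = G
  G_mul_Gi : G * Gi = 1
  torsion_free : ∀ i l k, Γ i l k = Γ k l i
  compat : ∀ i, dMat (D i) G = (Γ i)ᵀ * G + G * Γ i

namespace FormalMetric

variable {n : ℕ} {A : Type*} [CommRing A] [Algebra ℝ A] (S : FormalMetric n A)

lemma Gi_mul_G : S.Gi * S.G = 1 := mul_eq_one_comm.mp S.G_mul_Gi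

lemma Gi_symm : S.Giᵀ = S.Gi := by
  have h : S.Giᵀ * S.G = 1 := by
    have := congrArg transpose S.G_mul_Gi
    rwa [transpose_mul, S.G_symm, transpose_one] at this
  calc S.Giᵀ = S.Giᵀ * (S.G * S.Gi) := by rw [S.G_mul_Gi, mul_one]
    _ = S.Gi := by rw [← mul_assoc, h, one_mul]

lemma G_comm (i j : Fin n) : S.G i j = S.G j i := congrFun (congrFun S.G_symm j) i

lemma Gi_comm (i j : Fin n) : S.Gi i j = S.Gi j i := congrFun (congrFun S.Gi_symm j) i

lemma D_G (m i j : Fin n) :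
    S.D m (S.G i j) = ∑ a, (S.Γ m a i * S.G a j + S.Γ m a j * S.G i a) := by
  have := congrFun (congrFun (S.compat m) i) j
  simp only [dMat_apply, Matrix.add_apply, mul_apply, transpose_apply] at this
  rw [this, Finset.sum_add_distrib]
  simp only [mul_comm]

/-- Differentiate `G * Gi = 1`, insert compatibility and multiply by `Gi` on the left; this is
parallelism of the inverse metric. -/
lemma D_Gi (m : Fin n) : dMat (S.D m) S.Gi = -(S.Gi * (S.Γ m)ᵀ + S.Γ m * S.Gi) := by
  have h := congrArg (dMat (S.D m)) S.G_mul_Gi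
  rw [dMat_mul, dMat_one, S.compat] at h
  have h2 := congrArg (S.Gi * ·) h
  simp only [mul_add, mul_zero, ← mul_assoc, S.Gi_mul_G, one_mul] at h2
  have h3 : S.Gi * (S.Γ m)ᵀ * S.G * S.Gi = S.Gi * (S.Γ m)ᵀ := by
    rw [mul_assoc _ S.G, S.G_mul_Gi, mul_one]
  rw [add_mul, h3] at h2
  exact eq_neg_of_add_eq_zero_right h2

/-- Contraction with the inverse metric inverts contraction with the metric. -/
lemma sum_Gi_G (T : Fin n → A) (m : Fin n) :
    ∑ l, S.Gi m l * ∑ s, T s * S.G s l = T m := by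
  have h : ∀ s, ∑ l, S.Gi m l * S.G l s = (1 : Matrix (Fin n) (Fin n) A) m s := fun s => by
    rw [← S.Gi_mul_G, mul_apply]
  calc ∑ l, S.Gi m l * ∑ s, T s * S.G s l = ∑ s, (∑ l, S.Gi m l * S.G l s) * T s := by
        simp only [Finset.mul_sum, Finset.sum_mul]
        rw [Finset.sum_comm]
        refine Finset.sum_congr rfl fun s _ => Finset.sum_congr rfl fun l _ => ?_
        rw [S.G_comm s l]; ring
    _ = T m := by simp [h, one_apply]

lemma sum_Gi_mul_G (T : Fin n → A) (i : Fin n) :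
    ∑ m, ∑ l, S.Gi m l * (S.G i l * T m) = T i := by
  have h : ∀ m, ∑ l, S.Gi m l * S.G l i = (1 : Matrix (Fin n) (Fin n) A) m i := fun s => by
    rw [← S.Gi_mul_G, mul_apply]
  calc _ = ∑ m, (∑ l, S.Gi m l * S.G l i) * T m := by
        refine Finset.sum_congr rfl fun m _ => ?_
        rw [Finset.sum_mul]
        refine Finset.sum_congr rfl fun l _ => ?_
        rw [S.G_comm i l]; ring
    _ = T i := by simp [h, one_apply]

lemma sum_Gi_mul_G' (T : Fin n → A) (i : Fin n) :
    ∑ m, ∑ l, S.Gi m l * (S.G i m * T l) = T i := by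
  rw [Finset.sum_comm, ← S.sum_Gi_mul_G T i]
  refine Finset.sum_congr rfl fun m _ => Finset.sum_congr rfl fun l _ => ?_
  rw [S.Gi_comm]

lemma sum_Gi_G_trace : ∑ j, ∑ k, S.Gi j k * S.G j k = (n : A) := by
  have h : ∀ j, ∑ k, S.Gi j k * S.G j k = 1 := fun j => by
    have := congrFun (congrFun S.Gi_mul_G j) j
    rw [mul_apply, one_apply_eq] at this
    rw [← this]
    exact Finset.sum_congr rfl fun k _ => by rw [S.G_comm]
  simp [h]

/-! #### Curvature -/

/-- The curvature endomorphisms, `R i j l k` is the `∂_l`-component of `R_{∂_i,∂_j} ∂_k`. -/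
def R (i j : Fin n) : Matrix (Fin n) (Fin n) A :=
  dMat (S.D i) (S.Γ j) - dMat (S.D j) (S.Γ i) + (S.Γ i * S.Γ j - S.Γ j * S.Γ i)

lemma R_antisymm (i j : Fin n) : S.R j i = -S.R i j := by
  simp only [R]; abel

/-- Expand both sides of D_i D_j G = D_j D_i G by applying compatibility twice; what survives is the
curvature acting on the metric. -/
lemma R_skew (i j : Fin n) : (S.R i j)ᵀ * S.G + S.G * S.R i j = 0 := by
  have h := dMat_comm (S.D_comm i j) S.G
  simp only [S.compat, dMat_add, dMat_mul, dMat_transpose] at h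
  simp only [R, transpose_add, transpose_sub, transpose_mul]
  rw [← sub_eq_zero] at h
  refine Eq.trans ?_ h
  noncomm_ring

/-- After torsion-freeness is used to exchange the lower indices of Γ, the derivative terms and the
quadratic terms cancel in pairs. -/
lemma bianchi_one (i j k l : Fin n) : S.R i j l k + S.R j k l i + S.R k i l j = 0 := by
  simp only [R, Matrix.add_apply, Matrix.sub_apply, dMat_apply, mul_apply]
  rw [S.torsion_free j l k, S.torsion_free i l k, S.torsion_free i l j]
  have e : ∀ i j k, ∑ x, S.Γ i l x * S.Γ j x k = ∑ x, S.Γ i l x * S.Γ k x j := fun i j k =>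
    Finset.sum_congr rfl fun x _ => by rw [S.torsion_free j x k]
  rw [e i j k, e j i k, e k i j]
  ring

/-- This is the Jacobi identity for the commuting derivations twisted by Γ. It holds for any
connection: neither the metric nor torsion-freeness enters. -/
lemma bianchi_two (m i j : Fin n) :
    (dMat (S.D m) (S.R i j) + S.Γ m * S.R i j - S.R i j * S.Γ m) +
    (dMat (S.D i) (S.R j m) + S.Γ i * S.R j m - S.R j m * S.Γ i) +
    (dMat (S.D j) (S.R m i) + S.Γ j * S.R m i - S.R m i * S.Γ j) = 0 := by
  simp only [R, dMat_add, dMat_sub, dMat_mul]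
  rw [dMat_comm (S.D_comm m i), dMat_comm (S.D_comm m j), dMat_comm (S.D_comm i j)]
  noncomm_ring

/-- The `(0,4)` curvature tensor. -/
def Rl (i j k l : Fin n) : A := ∑ m, S.R i j m k * S.G m l

/-- The Ricci tensor. -/
def Ric (j k : Fin n) : A := ∑ i, S.R i j i k

/-- The scalar curvature. -/
def Scal : A := ∑ j, ∑ k, S.Gi j k * S.Ric j k

lemma Rl_eq (i j k l : Fin n) : S.Rl i j k l = ((S.R i j)ᵀ * S.G) k l := by
  simp [Rl, mul_apply]

lemma Rl_antisymm_left (i j k l : Fin n) : S.Rl j i k l = -S.Rl i j k l := by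
  simp [Rl, S.R_antisymm i j]

lemma Rl_antisymm_right (i j k l : Fin n) : S.Rl i j l k = -S.Rl i j k l := by
  have h := congrFun (congrFun (S.R_skew i j) l) k
  rw [Matrix.add_apply, ← S.Rl_eq, mul_apply, Matrix.zero_apply] at h
  rw [eq_neg_of_add_eq_zero_left h, Rl]
  congr 1
  exact Finset.sum_congr rfl fun m _ => by rw [S.G_comm, mul_comm]

lemma Rl_bianchi (i j k l : Fin n) : S.Rl i j k l + S.Rl j k i l + S.Rl k i j l = 0 := by
  simp only [Rl, ← Finset.sum_add_distrib, ← add_mul, S.bianchi_one, zero_mul,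
    Finset.sum_const_zero]

/-- The octahedron argument: the cyclic identities for the four rotations of i, j, k, l and the two
skew symmetries combine to twice the claim. -/
lemma Rl_pair_symm (i j k l : Fin n) : S.Rl i j k l = S.Rl k l i j := by
  have h1 := S.Rl_bianchi i j k l
  have h2 := S.Rl_bianchi j k l i
  have h3 := S.Rl_bianchi k l i j
  have h4 := S.Rl_bianchi l i j k
  have a1 := S.Rl_antisymm_left
  have a2 := S.Rl_antisymm_right
  rw [← sub_eq_zero]
  apply eq_zero_of_two_mul
  grind

lemma sum_Gi_Rl (j k i : Fin n) : ∑ l, S.Gi i l * S.Rl i j k l = S.R i j i k :=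
  S.sum_Gi_G (fun m => S.R i j m k) i

lemma Ric_eq (j k : Fin n) : S.Ric j k = ∑ i, ∑ l, S.Gi i l * S.Rl i j k l := by
  simp only [Ric, sum_Gi_Rl]

lemma Ric_symm (j k : Fin n) : S.Ric j k = S.Ric k j := by
  rw [Ric_eq, Ric_eq, Finset.sum_comm]
  refine Finset.sum_congr rfl fun l _ => Finset.sum_congr rfl fun i _ => ?_
  rw [S.Gi_comm, S.Rl_pair_symm i j k l, S.Rl_antisymm_left, S.Rl_antisymm_right, neg_neg]

end FormalMetric

end ConformalEinstein

namespace ConformalEinstein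

open Matrix

lemma sum_comm₂₂ {ι κ B : Type*} [Fintype ι] [Fintype κ] [AddCommMonoid B]
    (f : ι → ι → κ → κ → B) :
    ∑ j, ∑ k, ∑ m, ∑ l, f j k m l = ∑ m, ∑ l, ∑ j, ∑ k, f j k m l := by
  simp only [← Fintype.sum_prod_type' (f := fun m l => f _ _ m l)]
  rw [← Fintype.sum_prod_type' (f := fun j k => ∑ x : κ × κ, f j k x.1 x.2), Finset.sum_comm,
    ← Fintype.sum_prod_type' (f := fun m l => ∑ j, ∑ k, f j k m l)]
  exact Finset.sum_congr rfl fun _ _ =>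
    Fintype.sum_prod_type' (f := fun j k => f j k _ _)

namespace FormalMetric

variable {n : ℕ} {A : Type*} [CommRing A] [Algebra ℝ A] (S : FormalMetric n A)

/-! #### Covariant derivatives -/

/-- Covariant derivative of a covector. -/
def nabla₁ (v : Fin n → A) (i j : Fin n) : A := S.D i (v j) - ∑ a, S.Γ i a j * v a

/-- Covariant derivative of a `(0,2)` tensor. -/
def nabla₂ (T : Fin n → Fin n → A) (m i j : Fin n) : A :=
  S.D m (T i j) - ∑ a, (S.Γ m a i * T a j + S.Γ m a j * T i a)

/-- Covariant derivative of a `(0,4)` tensor. -/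
def nabla₄ (T : Fin n → Fin n → Fin n → Fin n → A) (m i j k l : Fin n) : A :=
  S.D m (T i j k l) - ∑ a, (S.Γ m a i * T a j k l + S.Γ m a j * T i a k l
    + S.Γ m a k * T i j a l + S.Γ m a l * T i j k a)

/-- Divergence of a `(0,4)` tensor in the last slot. -/
def div₄ (T : Fin n → Fin n → Fin n → Fin n → A) (i j k : Fin n) : A :=
  ∑ m, ∑ l, S.Gi m l * S.nabla₄ T m i j k l

/-- Covariant derivative of the curvature endomorphism. -/
def nablaR (m i j : Fin n) : Matrix (Fin n) (Fin n) A :=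
  dMat (S.D m) (S.R i j) + S.Γ m * S.R i j - S.R i j * S.Γ m
    - ∑ a, (S.Γ m a i • S.R a j + S.Γ m a j • S.R i a)

lemma nablaR_antisymm (m i j : Fin n) : S.nablaR m j i = -S.nablaR m i j := by
  have e : ∑ a, (S.Γ m a j • S.R a i + S.Γ m a i • S.R j a)
      = -∑ a, (S.Γ m a i • S.R a j + S.Γ m a j • S.R i a) := by
    rw [← Finset.sum_neg_distrib]
    refine Finset.sum_congr rfl fun a _ => ?_
    rw [S.R_antisymm i a, S.R_antisymm a j]
    simp only [smul_neg]
    abel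
  have e' : dMat (S.D m) (-S.R i j) = -dMat (S.D m) (S.R i j) := by ext; simp
  rw [nablaR, nablaR, e, S.R_antisymm i j, e']
  noncomm_ring

/-- `bianchi_two` differentiates only the endomorphism part. The remaining corrections, for the two
form indices, cancel in the cyclic sum because Γ is torsion-free and R is skew. -/
lemma nablaR_bianchi (m i j : Fin n) :
    S.nablaR m i j + S.nablaR i j m + S.nablaR j m i = 0 := by
  have h := S.bianchi_two m i j
  have e : ∑ a, (S.Γ m a i • S.R a j + S.Γ m a j • S.R i a)
      + ∑ a, (S.Γ i a j • S.R a m + S.Γ i a m • S.R j a)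
      + ∑ a, (S.Γ j a m • S.R a i + S.Γ j a i • S.R m a) = 0 := by
    rw [← Finset.sum_add_distrib, ← Finset.sum_add_distrib]
    refine Finset.sum_eq_zero fun a _ => ?_
    rw [S.torsion_free i a m, S.torsion_free j a m, S.torsion_free j a i, S.R_antisymm a i,
      S.R_antisymm a j, S.R_antisymm a m]
    simp only [smul_neg]
    abel
  simp only [nablaR]
  have h' := congrArg₂ (· - ·) h e
  rw [sub_zero] at h'
  rw [← h']
  abel

/-- The metric is parallel, so lowering an index commutes with covariant differentiation. Each sum
is packaged as an entry of a matrix product to make this a matrix identity. -/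
lemma nabla₄_Rl (m i j k l : Fin n) :
    S.nabla₄ S.Rl m i j k l = ∑ s, S.nablaR m i j s k * S.G s l := by
  have e1 : S.D m (S.Rl i j k l) =
      dMat (S.D m) ((S.R i j)ᵀ * S.G) k l := by rw [dMat_apply, Rl_eq]
  have e2 : ∑ a, S.Γ m a k * S.Rl i j a l = ((S.Γ m)ᵀ * ((S.R i j)ᵀ * S.G)) k l := by
    simp only [Rl_eq, mul_apply (M := (S.Γ m)ᵀ), transpose_apply]
  have e3 : ∑ a, S.Γ m a l * S.Rl i j k a = (((S.R i j)ᵀ * S.G) * S.Γ m) k l := by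
    simp only [Rl_eq, mul_apply (N := S.Γ m), mul_comm]
  have e4 : ∑ a, (S.Γ m a i * S.Rl a j k l + S.Γ m a j * S.Rl i a k l) =
      ((∑ a, (S.Γ m a i • S.R a j + S.Γ m a j • S.R i a))ᵀ * S.G) k l := by
    simp only [transpose_sum, transpose_add, transpose_smul, Finset.sum_mul, Matrix.sum_apply,
      add_mul, smul_mul, Matrix.add_apply, Matrix.smul_apply, smul_eq_mul, Rl_eq]
  have e5 : ∑ s, S.nablaR m i j s k * S.G s l = ((S.nablaR m i j)ᵀ * S.G) k l := by
    simp [mul_apply]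
  have e6 : S.nabla₄ S.Rl m i j k l = S.D m (S.Rl i j k l)
      - ∑ a, (S.Γ m a i * S.Rl a j k l + S.Γ m a j * S.Rl i a k l)
      - ∑ a, S.Γ m a k * S.Rl i j a l - ∑ a, S.Γ m a l * S.Rl i j k a := by
    simp only [nabla₄, Finset.sum_add_distrib]
    ring
  rw [e6, e1, e2, e3, e4, e5, ← Matrix.sub_apply, ← Matrix.sub_apply, ← Matrix.sub_apply]
  refine congrFun (congrFun (?_ : (_ : Matrix (Fin n) (Fin n) A) = _) k) l
  rw [dMat_mul, dMat_transpose, S.compat, nablaR]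
  generalize (∑ a, (S.Γ m a i • S.R a j + S.Γ m a j • S.R i a)) = X
  simp only [transpose_sub, transpose_add, transpose_mul, add_mul, sub_mul, mul_add, mul_assoc]
  abel

/-- An upper index is contracted with a lower one, so the Christoffel corrections of these two slots
cancel and no inverse metric is involved. -/
lemma sum_nablaR_diag (j i k : Fin n) : ∑ m, S.nablaR j m i m k = S.nabla₂ S.Ric j i k := by
  simp only [nablaR, nabla₂, Ric, Matrix.sub_apply, Matrix.add_apply, dMat_apply,
    Matrix.sum_apply, Matrix.smul_apply, smul_eq_mul, mul_apply, Finset.sum_add_distrib,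
    Finset.sum_sub_distrib, map_sum, Finset.mul_sum]
  have h1 : ∑ m, ∑ a, S.Γ j a m * S.R a i m k = ∑ m, ∑ a, S.Γ j m a * S.R m i a k :=
    Finset.sum_comm
  have h2 : ∑ m, ∑ a, S.Γ j a i * S.R m a m k = ∑ a, ∑ m, S.Γ j a i * S.R m a m k :=
    Finset.sum_comm
  have h3 : ∑ m, ∑ a, S.R m i m a * S.Γ j a k = ∑ a, ∑ m, S.Γ j a k * S.R m i m a := by
    rw [Finset.sum_comm]; simp only [mul_comm]
  rw [h1, h2, h3]
  ring

lemma div₄_Rl_eq_sum (i j k : Fin n) : S.div₄ S.Rl i j k = ∑ m, S.nablaR m i j m k := by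
  simp only [div₄, nabla₄_Rl]
  exact Finset.sum_congr rfl fun m _ => S.sum_Gi_G (fun s => S.nablaR m i j s k) m

/-- One trace of the second Bianchi identity: the three cyclic terms become the divergence of the
curvature and two derivatives of Ric. -/
lemma div₄_Rl (i j k : Fin n) :
    S.div₄ S.Rl i j k = S.nabla₂ S.Ric i j k - S.nabla₂ S.Ric j i k := by
  have h : ∑ m, (S.nablaR m i j + S.nablaR i j m + S.nablaR j m i) m k = 0 := by
    simp only [S.nablaR_bianchi, Matrix.zero_apply, Finset.sum_const_zero]
  simp only [Matrix.add_apply, Finset.sum_add_distrib, S.nablaR_antisymm i _ j,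
    Matrix.neg_apply, Finset.sum_neg_distrib, sum_nablaR_diag] at h
  rw [div₄_Rl_eq_sum]
  linear_combination h

/-- The trace commutes with the covariant derivative. -/
lemma sum_Gi_nabla₂ (T : Fin n → Fin n → A) (i : Fin n) :
    ∑ j, ∑ k, S.Gi j k * S.nabla₂ T i j k = S.D i (∑ j, ∑ k, S.Gi j k * T j k) := by
  have hD : ∀ j k, S.D i (S.Gi j k)
      = -(∑ a, (S.Gi j a * S.Γ i k a) + ∑ a, S.Γ i j a * S.Gi a k) := fun j k => by
    have := congrFun (congrFun (S.D_Gi i) j) k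
    simpa [mul_apply] using this
  simp only [nabla₂, map_sum, Derivation.leibniz, smul_eq_mul, hD, mul_sub, Finset.mul_sum,
    Finset.sum_add_distrib, Finset.sum_sub_distrib, mul_add, mul_neg, Finset.sum_neg_distrib]
  have h1 : ∑ j, ∑ k, ∑ a, S.Gi j k * (S.Γ i a j * T a k)
      = ∑ j, ∑ k, ∑ a, T j k * (S.Γ i j a * S.Gi a k) := by
    rw [Finset.sum_comm]
    rw [Finset.sum_comm (γ := Fin n) (f := fun j k => ∑ a, T j k * (S.Γ i j a * S.Gi a k))]
    refine Finset.sum_congr rfl fun k _ => ?_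
    rw [Finset.sum_comm]
    refine Finset.sum_congr rfl fun j _ => Finset.sum_congr rfl fun a _ => ?_
    ring
  have h2 : ∑ j, ∑ k, ∑ a, S.Gi j k * (S.Γ i a k * T j a)
      = ∑ j, ∑ k, ∑ a, T j k * (S.Gi j a * S.Γ i k a) := by
    refine Finset.sum_congr rfl fun j _ => ?_
    rw [Finset.sum_comm]
    refine Finset.sum_congr rfl fun k _ => Finset.sum_congr rfl fun a _ => ?_
    ring
  rw [h1, h2]
  ring

lemma nabla₄_Rl_swap (m i j k l : Fin n) :
    S.nabla₄ S.Rl m j i l k = S.nabla₄ S.Rl m i j k l := by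
  have h : ∀ i j k l, S.Rl j i l k = S.Rl i j k l := fun i j k l => by
    rw [S.Rl_antisymm_left, S.Rl_antisymm_right, neg_neg]
  simp only [nabla₄]
  congr 1
  · rw [h]
  · refine Finset.sum_congr rfl fun a _ => ?_
    rw [h i a k l, h a j k l, h i j k a, h i j a l]
    ring

/-- The contracted second Bianchi identity. -/
lemma bianchi_contracted (i : Fin n) :
    2 * ∑ m, ∑ l, S.Gi m l * S.nabla₂ S.Ric m i l = S.D i S.Scal := by
  -- The same double contraction of ∇Rl evaluated two ways: taking the trace over j, k first gives
  -- the divergence of Ric, while `div₄_Rl` gives D Scal minus that divergence.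
  have h1 : ∑ j, ∑ k, S.Gi j k * S.div₄ S.Rl i j k
      = ∑ m, ∑ l, S.Gi m l * S.nabla₂ S.Ric m i l := by
    simp only [div₄, Finset.mul_sum]
    have e : ∀ m l, S.nabla₂ S.Ric m i l = ∑ j, ∑ k, S.Gi j k * S.nabla₄ S.Rl m j i l k := by
      intro m l
      rw [← sum_nablaR_diag]
      simp only [nabla₄_Rl]
      exact Finset.sum_congr rfl fun j _ => (S.sum_Gi_G (fun s => S.nablaR m j i s l) j).symm
    simp only [e, nabla₄_Rl_swap, Finset.mul_sum]
    rw [sum_comm₂₂]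
    exact Finset.sum_congr rfl fun _ _ => Finset.sum_congr rfl fun _ _ => Finset.sum_congr rfl
      fun _ _ => Finset.sum_congr rfl fun _ _ => by ring
  simp only [div₄_Rl, mul_sub, Finset.sum_sub_distrib] at h1
  rw [S.sum_Gi_nabla₂] at h1
  have h2 : ∑ j, ∑ k, S.Gi j k * S.nabla₂ S.Ric j i k
    = ∑ m, ∑ l, S.Gi m l * S.nabla₂ S.Ric m i l := rfl
  rw [h2] at h1
  rw [Scal]
  linear_combination -h1

end FormalMetric

end ConformalEinstein

namespace ConformalEinstein

open Matrix

namespace FormalMetric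

variable {n : ℕ} {A : Type*} [CommRing A] [Algebra ℝ A] (S : FormalMetric n A)

/-! #### The Schouten, Weyl and Cotton tensors -/

/-- The trace of the Schouten tensor. -/
def τ : A := algebraMap ℝ A (1 / (2 * ((n : ℝ) - 1))) * S.Scal

/-- The Schouten tensor. -/
def P (i j : Fin n) : A := algebraMap ℝ A (1 / ((n : ℝ) - 2)) * (S.Ric i j - S.τ * S.G i j)

/-- The Weyl tensor. -/
def W (i j k l : Fin n) : A :=
  S.Rl i j k l - (S.G i l * S.P j k + S.G j k * S.P i l - S.G i k * S.P j l - S.G j l * S.P i k)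

/-- The Cotton tensor. -/
def cotton (i j k : Fin n) : A := S.nabla₂ S.P i j k - S.nabla₂ S.P j i k

lemma P_symm (i j : Fin n) : S.P i j = S.P j i := by
  rw [P, P, S.Ric_symm, S.G_comm]

lemma W_antisymm_left (i j k l : Fin n) : S.W j i k l = -S.W i j k l := by
  rw [W, W, S.Rl_antisymm_left]; ring

lemma W_antisymm_right (i j k l : Fin n) : S.W i j l k = -S.W i j k l := by
  rw [W, W, S.Rl_antisymm_right]; ring

lemma W_bianchi (i j k l : Fin n) : S.W i j k l + S.W j k i l + S.W k i j l = 0 := by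
  have h := S.Rl_bianchi i j k l
  simp only [W]
  rw [S.P_symm k j, S.P_symm k i, S.P_symm j i, S.G_comm k j, S.G_comm j i, S.G_comm k i]
  linear_combination h

lemma W_pair_symm (i j k l : Fin n) : S.W i j k l = S.W k l i j := by
  rw [W, W, S.Rl_pair_symm, S.P_symm k j, S.P_symm l i, S.P_symm k i, S.P_symm l j,
    S.G_comm k j, S.G_comm l i, S.G_comm k i, S.G_comm l j]
  ring

section

variable (hn : 4 ≤ n)
include hn

lemma two_mul_τ : 2 * ((n : A) - 1) * S.τ = S.Scal := by
  have h : (2 : A) * ((n : A) - 1) = algebraMap ℝ A (2 * ((n : ℝ) - 1)) := by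
    simp [map_mul, map_sub, map_ofNat, map_natCast]
  have hn' : (4 : ℝ) ≤ n := by exact_mod_cast hn
  rw [τ, h, ← mul_assoc, ← map_mul, mul_one_div_cancel, map_one, one_mul]
  have : (0 : ℝ) < 2 * ((n : ℝ) - 1) := by linarith
  exact this.ne'

lemma sub_two_mul_P (i j : Fin n) : ((n : A) - 2) * S.P i j = S.Ric i j - S.τ * S.G i j := by
  have h : (n : A) - 2 = algebraMap ℝ A ((n : ℝ) - 2) := by
    simp [map_sub, map_ofNat, map_natCast]
  have hn' : (4 : ℝ) ≤ n := by exact_mod_cast hn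
  rw [P, h, ← mul_assoc, ← map_mul, mul_one_div_cancel, map_one, one_mul]
  have : (0 : ℝ) < (n : ℝ) - 2 := by linarith
  exact this.ne'

/-- For k < 4 ≤ n the number n - k is a nonzero real, hence cancellable. The cases needed are k = 2,
for the Schouten tensor, and k = 1, for the trace argument in `cotton_eq`. -/
lemma eq_zero_of_sub_mul {k : ℕ} (hk : k < 4) {a : A} (h : ((n : A) - k) * a = 0) : a = 0 := by
  have hn' : (k : ℝ) < n := by exact_mod_cast hk.trans_le hn
  refine eq_zero_of_algebraMap_mul (c := (n : ℝ) - k) (sub_pos.mpr hn').ne' ?_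
  simpa [map_sub, map_natCast] using h

lemma sum_Gi_P : ∑ j, ∑ k, S.Gi j k * S.P j k = S.τ := by
  have h : ((n : A) - 2) * ∑ j, ∑ k, S.Gi j k * S.P j k = S.Scal
      - S.τ * ∑ j, ∑ k, S.Gi j k * S.G j k := by
    rw [Scal]
    simp only [Finset.mul_sum, ← Finset.sum_sub_distrib]
    refine Finset.sum_congr rfl fun j _ => Finset.sum_congr rfl fun k _ => ?_
    linear_combination S.Gi j k * S.sub_two_mul_P hn j k
  rw [sum_Gi_G_trace] at h
  rw [← sub_eq_zero]
  apply eq_zero_of_sub_mul hn (k := 2) (by norm_num)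
  have := S.two_mul_τ hn
  push_cast
  linear_combination h - this

omit hn in
lemma sum_Gi_kn (T : Fin n → Fin n → A) (j k : Fin n) :
    ∑ i, ∑ l, S.Gi i l * (S.G i l * T j k + S.G j k * T i l - S.G i k * T j l - S.G j l * T i k)
      = (n : A) * T j k + S.G j k * (∑ i, ∑ l, S.Gi i l * T i l) - T j k - T j k := by
  have h1 := S.sum_Gi_mul_G' (fun l => T j l) k
  have h2 := S.sum_Gi_mul_G (fun i => T i k) j
  have h3 : ∑ i, ∑ l, S.Gi i l * (S.G i l * T j k) = (n : A) * T j k := by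
    rw [← S.sum_Gi_G_trace]
    simp only [Finset.sum_mul, mul_assoc]
  have h4 : ∑ i, ∑ l, S.Gi i l * (S.G j k * T i l) = S.G j k * ∑ i, ∑ l, S.Gi i l * T i l := by
    simp only [Finset.mul_sum, mul_left_comm]
  have h5 : ∑ i, ∑ l, S.Gi i l * (S.G i k * T j l) = T j k := by
    rw [← h1]
    exact Finset.sum_congr rfl fun i _ => Finset.sum_congr rfl fun l _ => by rw [S.G_comm i k]
  simp only [mul_add, mul_sub, Finset.sum_add_distrib, Finset.sum_sub_distrib]
  rw [h3, h4, h5, h2]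

/-- The trace of g ⊙ P is (n - 2) P + τ g, and the constants in P are chosen so that this equals
Ric. -/
lemma W_trace (j k : Fin n) : ∑ i, ∑ l, S.Gi i l * S.W i j k l = 0 := by
  simp only [W, mul_sub (S.Gi _ _) (S.Rl _ _ _ _), Finset.sum_sub_distrib, ← S.Ric_eq,
    S.sum_Gi_kn, S.sum_Gi_P hn]
  linear_combination -S.sub_two_mul_P hn j k

lemma W_trace' (i l : Fin n) : ∑ j, ∑ k, S.Gi j k * S.W i j k l = 0 := by
  rw [← S.W_trace hn i l]
  refine Finset.sum_congr rfl fun j _ => Finset.sum_congr rfl fun k _ => ?_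
  rw [S.W_antisymm_left, S.W_antisymm_right, neg_neg]

end

lemma nabla₂_G (m i j : Fin n) : S.nabla₂ (fun i j => S.G i j) m i j = 0 := by
  rw [nabla₂, S.D_G, sub_self]

lemma nabla₂_mul_G (t : A) (m i j : Fin n) :
    S.nabla₂ (fun i j => t * S.G i j) m i j = S.D m t * S.G i j := by
  have h := S.nabla₂_G m i j
  simp only [nabla₂] at h ⊢
  rw [Derivation.leibniz, smul_eq_mul, smul_eq_mul]
  have e : ∑ a, (S.Γ m a i * (t * S.G a j) + S.Γ m a j * (t * S.G i a))
      = t * ∑ a, (S.Γ m a i * S.G a j + S.Γ m a j * S.G i a) := by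
    rw [Finset.mul_sum]; exact Finset.sum_congr rfl fun _ _ => by ring
  rw [e]
  linear_combination t * h

lemma nabla₂_sub (T U : Fin n → Fin n → A) (m i j : Fin n) :
    S.nabla₂ (fun i j => T i j - U i j) m i j = S.nabla₂ T m i j - S.nabla₂ U m i j := by
  simp only [nabla₂, map_sub, mul_sub, Finset.sum_add_distrib, Finset.sum_sub_distrib]
  ring

lemma nabla₂_mul (T U : Fin n → A) (m i j : Fin n) :
    S.nabla₂ (fun i j => T i * U j) m i j = S.nabla₁ T m i * U j + T i * S.nabla₁ U m j := by
  simp only [nabla₂, nabla₁, Derivation.leibniz, smul_eq_mul, Finset.sum_add_distrib, mul_sub,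
    Finset.mul_sum, mul_assoc, mul_left_comm, mul_comm]
  ring

/-- The Kulkarni-Nomizu product with the metric commutes with covariant differentiation. -/
lemma nabla₄_kn (T : Fin n → Fin n → A) (m i j k l : Fin n) :
    S.nabla₄ (fun i j k l => S.G i l * T j k + S.G j k * T i l - S.G i k * T j l - S.G j l * T i k)
      m i j k l
      = S.G i l * S.nabla₂ T m j k + S.G j k * S.nabla₂ T m i l - S.G i k * S.nabla₂ T m j l
        - S.G j l * S.nabla₂ T m i k := by
  simp only [nabla₄, nabla₂, map_sub, map_add, Derivation.leibniz, smul_eq_mul, S.D_G,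
    Finset.sum_add_distrib, mul_sub, mul_add, Finset.mul_sum, Finset.sum_sub_distrib]
  simp only [mul_left_comm, mul_comm, mul_assoc]
  ring

lemma nabla₄_sub (T U : Fin n → Fin n → Fin n → Fin n → A) (m i j k l : Fin n) :
    S.nabla₄ (fun i j k l => T i j k l - U i j k l) m i j k l
      = S.nabla₄ T m i j k l - S.nabla₄ U m i j k l := by
  simp only [nabla₄, map_sub, mul_sub, Finset.sum_add_distrib, Finset.sum_sub_distrib]
  ring

section

variable (hn : 4 ≤ n)
include hn

lemma nabla₂_Ric (m i j : Fin n) :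
    S.nabla₂ S.Ric m i j = ((n : A) - 2) * S.nabla₂ S.P m i j + S.D m S.τ * S.G i j := by
  have h : S.Ric = fun i j => ((n : A) - 2) * S.P i j + S.τ * S.G i j := by
    funext i j
    linear_combination -S.sub_two_mul_P hn i j
  have h2 := S.nabla₂_mul_G S.τ m i j
  rw [h]
  simp only [nabla₂, map_add, Derivation.leibniz, map_sub, Derivation.map_natCast,
    mul_add, Finset.sum_add_distrib, smul_eq_mul] at h2 ⊢
  have h3 : S.D m (2 : A) = 0 := by
    exact_mod_cast Derivation.map_natCast (S.D m) 2
  have e : ∀ T : Fin n → A, ∀ c : Fin n → A, ∑ a, c a * (((n : A) - 2) * T a)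
      = ((n : A) - 2) * ∑ a, c a * T a := fun T c => by
    rw [Finset.mul_sum]; exact Finset.sum_congr rfl fun _ _ => by ring
  simp only [e, h3]
  linear_combination h2

/-- The contracted second Bianchi identity for the Schouten tensor. -/
lemma div_P (i : Fin n) : ∑ m, ∑ l, S.Gi m l * S.nabla₂ S.P m i l = S.D i S.τ := by
  have h := S.bianchi_contracted i
  have h1 : S.D i S.Scal = 2 * ((n : A) - 1) * S.D i S.τ := by
    have h3 : S.D i (2 : A) = 0 := by exact_mod_cast Derivation.map_natCast (S.D i) 2
    rw [← S.two_mul_τ hn]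
    simp only [Derivation.leibniz, map_sub, Derivation.map_natCast, h3, smul_eq_mul,
      Derivation.map_one_eq_zero]
    ring
  have h2 : ∑ m, ∑ l, S.Gi m l * S.nabla₂ S.Ric m i l
      = ((n : A) - 2) * (∑ m, ∑ l, S.Gi m l * S.nabla₂ S.P m i l) + S.D i S.τ := by
    have := S.sum_Gi_mul_G (fun m => S.D m S.τ) i
    rw [← this]
    simp only [Finset.mul_sum, ← Finset.sum_add_distrib]
    refine Finset.sum_congr rfl fun j _ => Finset.sum_congr rfl fun k _ => ?_
    rw [S.nabla₂_Ric hn]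
    ring
  rw [h1, h2] at h
  rw [← sub_eq_zero]
  apply eq_zero_of_sub_mul hn (k := 2) (by norm_num)
  apply eq_zero_of_two_mul
  push_cast
  linear_combination h

/-- The two terms contribute dτ and the divergence of P, which agree by the contracted Bianchi
identity `div_P`. -/
lemma cotton_trace (i : Fin n) : ∑ j, ∑ k, S.Gi j k * S.cotton i j k = 0 := by
  simp only [cotton, mul_sub, Finset.sum_sub_distrib]
  rw [S.sum_Gi_nabla₂, S.div_P hn, S.sum_Gi_P hn, sub_self]

/-- The divergence of the Weyl tensor is `n - 3` times the Cotton tensor. -/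
theorem div₄_W (i j k : Fin n) : S.div₄ S.W i j k = ((n : A) - 3) * S.cotton i j k := by
  have e : ∀ m l, S.nabla₄ S.W m i j k l = S.nabla₄ S.Rl m i j k l
      - (S.G i l * S.nabla₂ S.P m j k + S.G j k * S.nabla₂ S.P m i l
        - S.G i k * S.nabla₂ S.P m j l - S.G j l * S.nabla₂ S.P m i k) := fun m l => by
    rw [← S.nabla₄_kn, ← S.nabla₄_sub]; rfl
  have h1 := S.sum_Gi_mul_G (fun m => S.nabla₂ S.P m j k) i
  have h2 := S.sum_Gi_mul_G (fun m => S.nabla₂ S.P m i k) j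
  have h3 := S.div_P hn i
  have h4 := S.div_P hn j
  have h5 := S.div₄_Rl i j k
  have : S.div₄ S.W i j k = S.div₄ S.Rl i j k
      - (S.nabla₂ S.P i j k + S.G j k * S.D i S.τ - S.G i k * S.D j S.τ
        - S.nabla₂ S.P j i k) := by
    rw [← h1, ← h2, ← h3, ← h4]
    simp only [div₄, e, Finset.mul_sum, ← Finset.sum_add_distrib, ← Finset.sum_sub_distrib]
    exact Finset.sum_congr rfl fun j _ => Finset.sum_congr rfl fun k _ => by ring
  rw [this, h5, S.nabla₂_Ric hn, S.nabla₂_Ric hn, cotton]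
  ring

end

/-! #### Solutions of the conformal Einstein equation -/

/-- The Ricci identity for covectors. -/
lemma ricci_identity (v : Fin n → A) (i j k : Fin n) :
    S.nabla₂ (S.nabla₁ v) i j k - S.nabla₂ (S.nabla₁ v) j i k = -∑ l, S.R i j l k * v l := by
  have e1 : ∀ i j k, S.D i (S.nabla₁ v j k) = S.D i (S.D j (v k))
      - ∑ a, (S.D i (S.Γ j a k) * v a + S.Γ j a k * S.D i (v a)) := by
    intro i j k
    simp only [nabla₁, map_sub, map_sum, Derivation.leibniz, smul_eq_mul]
    congr 1
    exact Finset.sum_congr rfl fun a _ => by ring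
  have e2 : ∀ i j k, ∑ a, S.Γ i a k * S.nabla₁ v j a = ∑ a, S.Γ i a k * S.D j (v a)
      - ∑ l, (S.Γ j * S.Γ i) l k * v l := by
    intro i j k
    simp only [nabla₁, mul_sub, Finset.sum_sub_distrib, mul_apply, Finset.sum_mul, Finset.mul_sum]
    congr 1
    rw [Finset.sum_comm]
    exact Finset.sum_congr rfl fun a _ => Finset.sum_congr rfl fun b _ => by ring
  have e3 : ∑ a, S.Γ i a j * S.nabla₁ v a k = ∑ a, S.Γ j a i * S.nabla₁ v a k :=
    Finset.sum_congr rfl fun a _ => by rw [S.torsion_free]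
  simp only [nabla₂, e1, Finset.sum_add_distrib, e2, e3, S.D_comm i j, R, Matrix.add_apply,
    Matrix.sub_apply, dMat_apply, add_mul, sub_mul, Finset.sum_sub_distrib]
  ring

/-- If `∇v + v ⊗ v + P` is a multiple of the metric then the Cotton tensor is the contraction of
the Weyl tensor with `v`. -/
theorem cotton_eq (hn : 4 ≤ n) (V v : Fin n → A) (hv : ∀ l, v l = ∑ m, V m * S.G m l) (lam : A)
    (h : ∀ i j, S.nabla₁ v i j + v i * v j + S.P i j = lam * S.G i j) (i j k : Fin n) :
    S.cotton i j k = ∑ l, S.W i j k l * V l := by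
  have hP : S.P = fun i j => lam * S.G i j - S.nabla₁ v i j - v i * v j := by
    funext i j; linear_combination h i j
  have hV : ∀ i, ∑ l, S.G i l * V l = v i := fun i => by
    rw [hv]; exact Finset.sum_congr rfl fun m _ => by rw [S.G_comm, mul_comm]
  have hR : ∀ i j k, ∑ l, S.R i j l k * v l = ∑ l, S.Rl i j k l * V l := by
    intro i j k
    simp only [Rl, ← hV, Finset.mul_sum, Finset.sum_mul]
    rw [Finset.sum_comm]
    exact Finset.sum_congr rfl fun l _ => Finset.sum_congr rfl fun m _ => by ring
  -- Every other term of `h` is symmetric, so v is closed.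
  have hN : ∀ i j, S.nabla₁ v i j = S.nabla₁ v j i := fun i j => by
    linear_combination h i j - h j i - S.P_symm i j + lam * S.G_comm i j
  have hnab : ∀ m i j, S.nabla₂ S.P m i j = S.D m lam * S.G i j
      - S.nabla₂ (S.nabla₁ v) m i j - (S.nabla₁ v m i * v j + v i * S.nabla₁ v m j) := by
    intro m i j
    rw [← S.nabla₂_mul_G, ← S.nabla₂_mul, ← S.nabla₂_sub, ← S.nabla₂_sub, ← hP]
  -- Collects everything that multiplies the metric once P is replaced by lam g - ∇v - v ⊗ v and the
  -- Ricci identity is applied. Cotton then differs from W(·,·,·,V) only by α antisymmetrised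
  -- against g.
  set α : Fin n → A := fun i => S.D i lam + lam * v i + ∑ l, S.P i l * V l with hα
  have key : ∀ i j k, S.cotton i j k
      = ∑ l, S.W i j k l * V l + α i * S.G j k - α j * S.G i k := by
    intro i j k
    have hW : ∑ l, S.W i j k l * V l = ∑ l, S.Rl i j k l * V l - (v i * S.P j k
        + S.G j k * ∑ l, S.P i l * V l - S.G i k * ∑ l, S.P j l * V l - v j * S.P i k) := by
      rw [← hV i, ← hV j]
      simp only [W, Finset.mul_sum, Finset.sum_mul, ← Finset.sum_add_distrib,
        ← Finset.sum_sub_distrib]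
      exact Finset.sum_congr rfl fun l _ => by ring
    have hr := S.ricci_identity v i j k
    rw [hR] at hr
    rw [cotton, hnab, hnab, hW, hα]
    linear_combination -hr - v k * hN i j - v j * h i k + v i * h j k
  -- Cotton and Weyl are both trace-free, while the trace of the α terms is (n - 1) α.
  have hαz : ∀ i, α i = 0 := by
    intro i
    apply eq_zero_of_sub_mul hn (k := 1) (by norm_num)
    have h1 := S.cotton_trace hn i
    have h2 : ∑ j, ∑ k, S.Gi j k * ∑ l, S.W i j k l * V l = 0 := by
      calc _ = ∑ l, (∑ j, ∑ k, S.Gi j k * S.W i j k l) * V l := by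
            simp only [Finset.mul_sum, Finset.sum_mul]
            rw [Finset.sum_comm (γ := Fin n) (f := fun l j => ∑ k, S.Gi j k * S.W i j k l * V l)]
            refine Finset.sum_congr rfl fun j _ => ?_
            rw [Finset.sum_comm]
            exact Finset.sum_congr rfl fun l _ => Finset.sum_congr rfl fun m _ => by ring
        _ = 0 := by simp only [S.W_trace' hn, zero_mul, Finset.sum_const_zero]
    have h3 := S.sum_Gi_mul_G α i
    have h4 := S.sum_Gi_G_trace
    simp only [key, mul_add, mul_sub, Finset.sum_add_distrib, Finset.sum_sub_distrib, h2] at h1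
    have e1 : ∑ j, ∑ k, S.Gi j k * (α i * S.G j k) = α i * n := by
      rw [← h4]
      simp only [Finset.mul_sum]
      exact Finset.sum_congr rfl fun l _ => Finset.sum_congr rfl fun m _ => by ring
    have e2 : ∑ j, ∑ k, S.Gi j k * (α j * S.G i k) = α i := by
      rw [← h3]
      exact Finset.sum_congr rfl fun l _ => Finset.sum_congr rfl fun m _ => by ring
    rw [e1, e2] at h1
    push_cast
    linear_combination h1
  rw [key, hαz, hαz]
  ring

/-- If `∇v + v ⊗ v + P` is a multiple of the metric then the divergence of the Weyl tensor is
`n - 3` times its contraction with `v`. -/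
theorem div₄_W_eq (hn : 4 ≤ n) (V v : Fin n → A) (hv : ∀ l, v l = ∑ m, V m * S.G m l) (lam : A)
    (h : ∀ i j, S.nabla₁ v i j + v i * v j + S.P i j = lam * S.G i j) (i j k : Fin n) :
    S.div₄ S.W i j k = ((n : A) - 3) * ∑ l, S.W i j k l * V l := by
  rw [S.div₄_W hn, S.cotton_eq hn V v hv lam h]

end FormalMetric

end ConformalEinstein

namespace ConformalEinstein

open Matrix

namespace FormalMetric

variable {n : ℕ} {A : Type*} [CommRing A] [Algebra ℝ A] (S : FormalMetric n A)

/-! #### Existence and uniqueness of the Levi-Civita connection -/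

/-- The Christoffel symbols of the first kind. -/
lemma two_mul_sum_Γ_G (i j l : Fin n) :
    2 * ∑ k, S.Γ i k j * S.G k l
      = S.D i (S.G j l) + S.D j (S.G i l) - S.D l (S.G i j) := by
  rw [S.D_G, S.D_G, S.D_G, ← Finset.sum_add_distrib, ← Finset.sum_sub_distrib, Finset.mul_sum]
  refine Finset.sum_congr rfl fun a _ => ?_
  rw [S.torsion_free j a i, S.torsion_free l a i, S.torsion_free l a j, S.G_comm a j]
  ring

lemma two_mul_Γ (i k j : Fin n) :
    2 * S.Γ i k j
      = ∑ l, S.Gi k l * (S.D i (S.G j l) + S.D j (S.G i l) - S.D l (S.G i j)) := by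
  simp only [← two_mul_sum_Γ_G, mul_left_comm _ (2 : A)]
  rw [← Finset.mul_sum, S.sum_Gi_G (fun k => S.Γ i k j)]

/-- The Koszul formula `two_mul_Γ` expresses 2Γ through the metric alone; it applies equally to the
structure in which Γ is replaced by Γ'. -/
lemma Γ_unique (Γ' : Fin n → Matrix (Fin n) (Fin n) A) (ht : ∀ i l k, Γ' i l k = Γ' k l i)
    (hc : ∀ i, dMat (S.D i) S.G = (Γ' i)ᵀ * S.G + S.G * Γ' i) : S.Γ = Γ' := by
  funext i
  ext k j
  have h1 := S.two_mul_Γ i k j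
  have h2 := two_mul_Γ { S with Γ := Γ', torsion_free := ht, compat := hc } i k j
  rw [← sub_eq_zero]
  apply eq_zero_of_two_mul
  linear_combination h1 - h2

/-- Allows a connection to be guessed, as for a conformal metric, and then identified with the one
built from the metric coefficients. -/
lemma ext_of_G {S S' : FormalMetric n A} (hD : S.D = S'.D) (hG : S.G = S'.G) : S = S' := by
  have hGi : S.Gi = S'.Gi := by
    rw [← mul_one S.Gi, ← S'.G_mul_Gi, ← hG, ← mul_assoc, S.Gi_mul_G, one_mul]
  have hΓ : S.Γ = S'.Γ := S.Γ_unique S'.Γ S'.torsion_free (by rw [hD, hG]; exact S'.compat)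
  cases S
  cases S'
  simp only at hD hG hGi hΓ
  subst hD hG hGi hΓ
  rfl

/-- The Levi-Civita connection of a metric. -/
def ofMetric (D : Fin n → Derivation ℝ A A) (G Gi : Matrix (Fin n) (Fin n) A)
    (hD : ∀ i j a, D i (D j a) = D j (D i a)) (hG : Gᵀ = G) (hGi : G * Gi = 1) :
    FormalMetric n A where
  D := D
  G := G
  Gi := Gi
  Γ i := Matrix.of fun k j => algebraMap ℝ A (1 / 2) *
    ∑ l, Gi k l * (D i (G j l) + D j (G i l) - D l (G i j))
  D_comm := hD
  G_symm := hG
  G_mul_Gi := hGi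
  torsion_free i k j := by
    have hs : ∀ i j, G i j = G j i := fun i j => congrFun (congrFun hG j) i
    simp only [Matrix.of_apply]
    congr 1
    refine Finset.sum_congr rfl fun l _ => ?_
    rw [hs i j]; ring
  compat m := by
    have hs : ∀ i j, G i j = G j i := fun i j => congrFun (congrFun hG j) i
    have key : ∀ i j, ∑ k, (algebraMap ℝ A (1 / 2) *
        ∑ l, Gi k l * (D m (G i l) + D i (G m l) - D l (G m i))) * G k j
        = algebraMap ℝ A (1 / 2) * (D m (G i j) + D i (G m j) - D j (G m i)) := by
      intro i j
      have h : ∀ l, ∑ k, G j k * Gi k l = (1 : Matrix (Fin n) (Fin n) A) j l := fun l => by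
        rw [← hGi, mul_apply]
      calc _ = algebraMap ℝ A (1 / 2) * ∑ l, (∑ k, G j k * Gi k l) *
            (D m (G i l) + D i (G m l) - D l (G m i)) := by
            simp only [Finset.mul_sum, Finset.sum_mul]
            rw [Finset.sum_comm]
            refine Finset.sum_congr rfl fun l _ => Finset.sum_congr rfl fun k _ => ?_
            rw [hs k j]; ring
        _ = _ := by simp [h, one_apply]
    have h2 : algebraMap ℝ A (1 / 2) * 2 = 1 := by
      rw [← map_ofNat (algebraMap ℝ A) 2, ← map_mul]
      norm_num
    ext i j
    simp only [dMat_apply, Matrix.add_apply, mul_apply, transpose_apply, Matrix.of_apply]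
    rw [key i j]
    have e : ∀ k, G i k * (algebraMap ℝ A (1 / 2) *
        ∑ l, Gi k l * (D m (G j l) + D j (G m l) - D l (G m j)))
        = (algebraMap ℝ A (1 / 2) *
        ∑ l, Gi k l * (D m (G j l) + D j (G m l) - D l (G m j))) * G k i := fun k => by
      rw [hs i k, mul_comm]
    simp only [e]
    rw [key j i, hs j i]
    linear_combination -(D m (G i j)) * h2

/-! #### Conformal change -/

/-- The difference of the Levi-Civita connections of `e^{-2f} g` and `g`. -/
def conformalDiff (f V : Fin n → A) (i l k : Fin n) : A :=
  -((if l = i then 1 else 0) * f k) - (if l = k then 1 else 0) * f i + S.G i k * V l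

lemma sum_mul_conformalDiff (f V h : Fin n → A) (j k : Fin n) :
    ∑ m, h m * S.conformalDiff f V j m k
      = -(h j * f k) - h k * f j + S.G j k * ∑ m, h m * V m := by
  simp only [conformalDiff, mul_add, mul_sub, mul_neg, Finset.sum_add_distrib,
    Finset.sum_sub_distrib, Finset.sum_neg_distrib, ite_mul, one_mul, zero_mul, mul_ite, mul_zero,
    Finset.sum_ite_eq', Finset.mem_univ, if_true, Finset.mul_sum]
  congr 1
  exact Finset.sum_congr rfl fun _ _ => by ring

lemma sum_conformalDiff_mul (f V h : Fin n → A) (j i : Fin n) :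
    ∑ m, S.conformalDiff f V j i m * h m
      = -((if i = j then 1 else 0) * ∑ m, f m * h m) - f j * h i
        + V i * ∑ m, S.G j m * h m := by
  simp only [conformalDiff, add_mul, sub_mul, neg_mul, Finset.sum_add_distrib,
    Finset.sum_sub_distrib, Finset.sum_neg_distrib, Finset.mul_sum, mul_assoc]
  have e1 : ∑ x, (if i = x then (1 : A) else 0) * (f j * h x) = f j * h i := by simp
  rw [e1]
  congr 1
  exact Finset.sum_congr rfl fun _ _ => by ring

lemma conformalDiff_symm (f V : Fin n → A) (i l k : Fin n) :
    S.conformalDiff f V i l k = S.conformalDiff f V k l i := by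
  rw [conformalDiff, conformalDiff, S.G_comm]; ring

/-- The metric `c g` where `c` is a unit with `dc = -2 c f`. -/
def conformal (c ci : A) (hc : c * ci = 1) (f V : Fin n → A)
    (hV : ∀ l, f l = ∑ m, S.G l m * V m) (hf : ∀ i, S.D i c = -2 * c * f i) :
    FormalMetric n A where
  D := S.D
  G := c • S.G
  Gi := ci • S.Gi
  Γ i := S.Γ i + Matrix.of (S.conformalDiff f V i)
  D_comm := S.D_comm
  G_symm := by rw [transpose_smul, S.G_symm]
  G_mul_Gi := by rw [smul_mul_smul_comm, hc, one_smul, S.G_mul_Gi]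
  torsion_free i l k := by
    simp only [Matrix.add_apply, Matrix.of_apply]
    rw [S.torsion_free, S.conformalDiff_symm]
  compat m := by
    have e : ∀ i j, ∑ a, S.G j a * S.conformalDiff f V m a i
        = -(S.G j m * f i) - S.G j i * f m + S.G m i * f j := fun i j => by
      rw [S.sum_mul_conformalDiff, ← hV j]
    have h : (Matrix.of (S.conformalDiff f V m))ᵀ * S.G + S.G * Matrix.of (S.conformalDiff f V m)
        = (-2 * f m) • S.G := by
      ext i j
      simp only [Matrix.add_apply, mul_apply, transpose_apply, Matrix.of_apply, Matrix.smul_apply,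
        smul_eq_mul]
      have e' : ∀ a, S.conformalDiff f V m a i * S.G a j
          = S.G j a * S.conformalDiff f V m a i := fun a => by rw [S.G_comm a j, mul_comm]
      simp only [e', e]
      rw [S.G_comm j i, S.G_comm j m, S.G_comm i m]
      ring
    rw [dMat_smul, S.compat, hf, transpose_add, add_mul, mul_add, Matrix.mul_smul,
      Matrix.mul_smul, Matrix.smul_mul, Matrix.smul_mul]
    have : (-2 * c * f m) • S.G = c • ((-2 * f m) • S.G) := by rw [smul_smul]; congr 1; ring
    rw [this, ← h]
    simp only [smul_add]
    abel

/-- Isolates the traces Γ^i_{im}, because a conformal change alters them in a simple way: they drop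
by n times the covector f. -/
lemma Ric_expand (j k : Fin n) :
    S.Ric j k = ∑ i, S.D i (S.Γ j i k) - S.D j (∑ i, S.Γ i i k)
      + ∑ m, (∑ i, S.Γ i i m) * S.Γ j m k - ∑ i, ∑ m, S.Γ j i m * S.Γ i m k := by
  simp only [Ric, R, Matrix.add_apply, Matrix.sub_apply, dMat_apply, mul_apply,
    Finset.sum_add_distrib, Finset.sum_sub_distrib, map_sum, Finset.sum_mul]
  rw [Finset.sum_comm (f := fun m i => S.Γ i i m * S.Γ j m k)]
  ring

/-- The conformal transformation law of the Ricci tensor. -/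
theorem conformal_Ric (c ci : A) (hc : c * ci = 1) (f V : Fin n → A)
    (hV : ∀ l, f l = ∑ m, S.G l m * V m) (hf : ∀ i, S.D i c = -2 * c * f i)
    (hsymm : ∀ i j, S.D i (f j) = S.D j (f i)) (j k : Fin n) :
    (S.conformal c ci hc f V hV hf).Ric j k
      = S.Ric j k + ((n : A) - 2) * (S.nabla₁ f j k + f j * f k)
        + (∑ i, S.D i (V i) + ∑ m, (∑ i, S.Γ i i m) * V m
          - ((n : A) - 2) * ∑ m, f m * V m) * S.G j k := by
  have hΓ : ∀ i l k, (S.conformal c ci hc f V hV hf).Γ i l k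
      = S.Γ i l k + S.conformalDiff f V i l k := fun _ _ _ => rfl
  have hD : (S.conformal c ci hc f V hV hf).D = S.D := rfl
  rw [Ric_expand, Ric_expand]
  simp only [hΓ, hD]
  have tr : ∀ m, ∑ i, (S.Γ i i m + S.conformalDiff f V i i m) = ∑ i, S.Γ i i m - n * f m := by
    intro m
    have : ∑ i, S.conformalDiff f V i i m = -(n * f m) := by
      simp only [conformalDiff, if_true, Finset.sum_add_distrib, Finset.sum_sub_distrib,
        Finset.sum_neg_distrib, Finset.sum_const, Finset.card_univ, Fintype.card_fin,
        nsmul_eq_mul, one_mul, ite_mul, zero_mul, Finset.sum_ite_eq', Finset.mem_univ]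
      have : ∑ i, S.G i m * V i = f m := by
        rw [hV]; exact Finset.sum_congr rfl fun _ _ => by rw [S.G_comm]
      rw [this]; ring
    rw [Finset.sum_add_distrib, this]; ring
  simp only [tr]
  have hd : ∑ i, S.D i (S.conformalDiff f V j i k)
      = -S.D j (f k) - S.D k (f j) + S.G j k * ∑ i, S.D i (V i)
        + ∑ i, V i * S.D i (S.G j k) := by
    have hone : ∀ i (p : Prop) [Decidable p], S.D i (if p then (1 : A) else 0) = 0 := by
      intro i p _; split_ifs <;> simp
    simp only [conformalDiff, map_add, map_sub, map_neg, Derivation.leibniz, smul_eq_mul, hone,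
      mul_zero, add_zero, Finset.sum_add_distrib, Finset.sum_sub_distrib, Finset.sum_neg_distrib,
      Finset.mul_sum]
    simp only [ite_mul, one_mul, zero_mul, Finset.sum_ite_eq', Finset.mem_univ, if_true]
    ring
  -- Compatibility turns the derivative of the metric into precisely the two mixed sums that
  -- reappear in `q2` and `q3` and cancel there.
  have hdG : ∑ i, V i * S.D i (S.G j k)
      = ∑ i, ∑ m, S.Γ j i m * (S.G i k * V m) + ∑ i, ∑ m, V i * (S.G j m * S.Γ i m k) := by
    rw [Finset.sum_comm, ← Finset.sum_add_distrib]
    refine Finset.sum_congr rfl fun i _ => ?_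
    rw [S.D_G, Finset.mul_sum, ← Finset.sum_add_distrib]
    refine Finset.sum_congr rfl fun a _ => ?_
    rw [S.torsion_free j a i]; ring
  have q1 : ∑ m, (∑ i, S.Γ i i m - n * f m) * (S.Γ j m k + S.conformalDiff f V j m k)
      = ∑ m, (∑ i, S.Γ i i m) * S.Γ j m k - n * ∑ m, S.Γ j m k * f m
        - (∑ i, S.Γ i i j) * f k - (∑ i, S.Γ i i k) * f j
        + S.G j k * ∑ m, (∑ i, S.Γ i i m) * V m
        + 2 * n * (f j * f k) - n * (S.G j k * ∑ m, f m * V m) := by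
    have := S.sum_mul_conformalDiff f V (fun m => ∑ i, S.Γ i i m) j k
    have h2 := S.sum_mul_conformalDiff f V f j k
    have e : ∑ m, (∑ i, S.Γ i i m - n * f m) * (S.Γ j m k + S.conformalDiff f V j m k)
        = ∑ m, (∑ i, S.Γ i i m) * S.Γ j m k - n * ∑ m, S.Γ j m k * f m
          + ∑ m, (∑ i, S.Γ i i m) * S.conformalDiff f V j m k
          - n * ∑ m, f m * S.conformalDiff f V j m k := by
      rw [Finset.mul_sum, Finset.mul_sum, ← Finset.sum_sub_distrib, ← Finset.sum_add_distrib,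
        ← Finset.sum_sub_distrib]
      exact Finset.sum_congr rfl fun _ _ => by ring
    rw [e, this, h2]
    ring
  have tr' : ∑ i, S.Γ j i i = ∑ i, S.Γ i i j :=
    Finset.sum_congr rfl fun i _ => S.torsion_free _ _ _
  have q2 : ∑ i, ∑ m, S.Γ j i m * S.conformalDiff f V i m k
      = -((∑ i, S.Γ i i j) * f k) - ∑ m, S.Γ j m k * f m
        + ∑ i, ∑ m, S.Γ j i m * (S.G i k * V m) := by
    simp only [S.sum_mul_conformalDiff, Finset.sum_add_distrib, Finset.sum_sub_distrib,
      Finset.sum_neg_distrib, ← Finset.sum_mul, tr']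
    congr 1
    refine Finset.sum_congr rfl fun i _ => ?_
    rw [Finset.mul_sum]
    exact Finset.sum_congr rfl fun m _ => by ring
  have q3 : ∑ i, ∑ m, S.conformalDiff f V j i m * S.Γ i m k
      = -∑ m, S.Γ j m k * f m - (∑ i, S.Γ i i k) * f j
        + ∑ i, ∑ m, V i * (S.G j m * S.Γ i m k) := by
    simp only [S.sum_conformalDiff_mul f V (fun m => S.Γ _ m k), Finset.sum_add_distrib,
      Finset.sum_sub_distrib, Finset.sum_neg_distrib, ite_mul, one_mul, zero_mul,
      Finset.sum_ite_eq', Finset.mem_univ, if_true, ← Finset.mul_sum]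
    simp only [mul_comm]
  -- Subtracting this from the quadratic terms 2n f_j f_k and -n |f|² g of `q1` leaves the
  -- coefficients n - 2 and -(n - 2) of the transformation law.
  have q4 : ∑ i, ∑ m, S.conformalDiff f V j i m * S.conformalDiff f V i m k
      = ((n : A) + 2) * (f j * f k) - 2 * (S.G j k * ∑ m, f m * V m) := by
    have e : ∀ i, ∑ m, S.conformalDiff f V j i m * S.conformalDiff f V i m k
        = -(S.conformalDiff f V j i i * f k) - S.conformalDiff f V j i k * f i
          + S.G i k * (-((if i = j then 1 else 0) * ∑ m, f m * V m) - f j * V i + V i * f j) := by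
      intro i
      rw [S.sum_mul_conformalDiff f V (fun m => S.conformalDiff f V j i m),
        S.sum_conformalDiff_mul f V V, ← hV]
    have e1 : ∑ i, S.conformalDiff f V j i i = -(n * f j) := by
      simp only [conformalDiff, if_true, Finset.sum_add_distrib, Finset.sum_sub_distrib,
        Finset.sum_neg_distrib, Finset.sum_const, Finset.card_univ, Fintype.card_fin,
        nsmul_eq_mul, one_mul, ite_mul, zero_mul, Finset.sum_ite_eq', Finset.mem_univ, ← hV]
      ring
    have e2 : ∑ i, S.conformalDiff f V j i k * f i
        = -(f j * f k) - f k * f j + S.G j k * ∑ m, f m * V m := by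
      rw [← S.sum_mul_conformalDiff]; simp only [mul_comm]
    have e3 : ∑ i, S.G i k * (-((if i = j then 1 else 0) * ∑ m, f m * V m) - f j * V i + V i * f j)
        = -(S.G j k * ∑ m, f m * V m) := by
      have : ∀ i, S.G i k * (-((if i = j then 1 else 0) * ∑ m, f m * V m) - f j * V i + V i * f j)
          = if i = j then -(S.G i k * ∑ m, f m * V m) else 0 := by
        intro i; split_ifs <;> ring
      simp only [this, Finset.sum_ite_eq', Finset.mem_univ, if_true]
    simp only [e, Finset.sum_add_distrib, Finset.sum_sub_distrib, Finset.sum_neg_distrib,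
      ← Finset.sum_mul, e1]
    rw [e2, e3]
    ring
  have q : ∑ i, ∑ m, (S.Γ j i m + S.conformalDiff f V j i m) *
        (S.Γ i m k + S.conformalDiff f V i m k)
      = ∑ i, ∑ m, S.Γ j i m * S.Γ i m k + ∑ i, ∑ m, S.Γ j i m * S.conformalDiff f V i m k
        + ∑ i, ∑ m, S.conformalDiff f V j i m * S.Γ i m k
        + ∑ i, ∑ m, S.conformalDiff f V j i m * S.conformalDiff f V i m k := by
    simp only [← Finset.sum_add_distrib]
    exact Finset.sum_congr rfl fun i _ => Finset.sum_congr rfl fun m _ => by ring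
  rw [q, q1, q2, q3, q4]
  simp only [map_add, map_sub, Finset.sum_add_distrib, Derivation.leibniz, smul_eq_mul,
    Derivation.map_natCast, hd, hdG, nabla₁]
  linear_combination -hsymm k j

/-- The conformal transformation law of the traceless Ricci tensor. -/
theorem conformal_traceless (c ci : A) (hc : c * ci = 1) (f V : Fin n → A)
    (hV : ∀ l, f l = ∑ m, S.G l m * V m) (hf : ∀ i, S.D i c = -2 * c * f i)
    (hsymm : ∀ i j, S.D i (f j) = S.D j (f i)) (j k : Fin n) :
    n * (S.conformal c ci hc f V hV hf).Ric j k
        - (S.conformal c ci hc f V hV hf).Scal * (c * S.G j k)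
      = n * S.Ric j k - S.Scal * S.G j k + ((n : A) - 2) *
        (n * (S.nabla₁ f j k + f j * f k)
          - (∑ i, ∑ l, S.Gi i l * (S.nabla₁ f i l + f i * f l)) * S.G j k) := by
  have h := S.conformal_Ric c ci hc f V hV hf hsymm
  -- The multiple of g in the Ricci law is never simplified: it adds n μ to the trace of Ric with
  -- respect to g and drops out of the traceless part.
  set μ := (∑ i, S.D i (V i) + ∑ m, (∑ i, S.Γ i i m) * V m - ((n : A) - 2) * ∑ m, f m * V m)
  have h2 : (S.conformal c ci hc f V hV hf).Scal = ci * (S.Scal + ((n : A) - 2) *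
      (∑ i, ∑ l, S.Gi i l * (S.nabla₁ f i l + f i * f l)) + n * μ) := by
    rw [← S.sum_Gi_G_trace]
    have hGi : ∀ i j, (S.conformal c ci hc f V hV hf).Gi i j = ci * S.Gi i j := fun _ _ => rfl
    simp only [Scal, h, hGi]
    simp only [sum_Gi_G_trace, Finset.mul_sum, mul_add, Finset.sum_add_distrib]
    have : (∑ x, ∑ i, ci * S.Gi x i * (μ * S.G x i)) = ci * (n * μ) := by
      rw [← S.sum_Gi_G_trace]
      simp only [Finset.mul_sum, Finset.sum_mul]
      exact Finset.sum_congr rfl fun i _ => Finset.sum_congr rfl fun m _ => by ring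
    rw [this]
    simp only [mul_assoc, mul_left_comm, mul_comm]
  rw [h, h2]
  linear_combination -(S.G j k * (S.Scal + ((n : A) - 2) *
      (∑ i, ∑ l, S.Gi i l * (S.nabla₁ f i l + f i * f l)) + n * μ)) * hc

/-! #### Change of coordinates -/

/-- The transformation law of the Levi-Civita connection. -/
theorem Γ_transform (J Ji G : Matrix (Fin n) (Fin n) A) (Γ : Fin n → Matrix (Fin n) (Fin n) A)
    (hJi : J * Ji = 1) (hG : S.G = Jᵀ * G * J)
    (hJ : ∀ i j b, S.D i (J b j) = S.D j (J b i)) (ht : ∀ i l k, Γ i l k = Γ k l i)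
    (hc : ∀ i, dMat (S.D i) G = ∑ a, J a i • ((Γ a)ᵀ * G + G * Γ a)) (i : Fin n) :
    J * S.Γ i = (∑ a, J a i • Γ a) * J + dMat (S.D i) J := by
  have hJi' : Ji * J = 1 := mul_eq_one_comm.mp hJi
  -- The transformed connection J⁻¹ (X J + dJ), with X = ∑ J_a Γ_a, is torsion-free and compatible
  -- with Jᵀ G J, so uniqueness identifies it with Γ.
  have key : S.Γ = fun i => Ji * ((∑ a, J a i • Γ a) * J + dMat (S.D i) J) := by
    apply S.Γ_unique
    · intro i l k
      rw [mul_apply, mul_apply]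
      refine Finset.sum_congr rfl fun b _ => ?_
      congr 1
      simp only [Matrix.add_apply, dMat_apply, hJ i k b]
      congr 1
      simp only [mul_apply, Matrix.sum_apply, Matrix.smul_apply, smul_eq_mul, Finset.sum_mul]
      rw [Finset.sum_comm]
      refine Finset.sum_congr rfl fun c _ => Finset.sum_congr rfl fun a _ => ?_
      rw [ht]; ring
    · intro i
      have hc' : dMat (S.D i) G = (∑ a, J a i • Γ a)ᵀ * G + G * (∑ a, J a i • Γ a) := by
        rw [hc, transpose_sum, Finset.sum_mul, Finset.mul_sum, ← Finset.sum_add_distrib]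
        refine Finset.sum_congr rfl fun a _ => ?_
        rw [transpose_smul, Matrix.smul_mul, Matrix.mul_smul, smul_add]
      generalize (∑ a, J a i • Γ a) = X at hc'
      have e1 : Jᵀ * G * J * (Ji * (X * J + dMat (S.D i) J)) = Jᵀ * G * (X * J + dMat (S.D i) J) := by
        rw [mul_assoc (Jᵀ * G), ← mul_assoc J, hJi, one_mul]
      have e2 : (Ji * (X * J + dMat (S.D i) J))ᵀ * (Jᵀ * G * J)
          = (X * J + dMat (S.D i) J)ᵀ * G * J := by
        rw [transpose_mul, mul_assoc _ Jiᵀ, ← mul_assoc Jiᵀ, ← mul_assoc Jiᵀ, ← transpose_mul,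
          hJi, transpose_one, one_mul, mul_assoc]
      rw [hG, e1, e2, dMat_mul, dMat_mul, hc', dMat_transpose, transpose_add, transpose_mul]
      noncomm_ring
  rw [key, ← mul_assoc, hJi, one_mul]

end FormalMetric

/-- The transformation law of the curvature of a connection. -/
theorem curvature_transform {n : ℕ} {A : Type*} [CommRing A] [Algebra ℝ A]
    (D : Fin n → Derivation ℝ A A) (hD : ∀ i j a, D i (D j a) = D j (D i a))
    (J : Matrix (Fin n) (Fin n) A) (Γt Γ : Fin n → Matrix (Fin n) (Fin n) A)
    (dΓ : Fin n → Fin n → Matrix (Fin n) (Fin n) A)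
    (hJ : ∀ i j b, D i (J b j) = D j (J b i))
    (hΓ : ∀ i a, dMat (D i) (Γ a) = ∑ b, J b i • dΓ b a)
    (h : ∀ i, J * Γt i = (∑ a, J a i • Γ a) * J + dMat (D i) J) (i j : Fin n) :
    J * (dMat (D i) (Γt j) - dMat (D j) (Γt i) + (Γt i * Γt j - Γt j * Γt i))
      = (∑ a, ∑ b, (J a i * J b j) • (dΓ a b - dΓ b a + (Γ a * Γ b - Γ b * Γ a))) * J := by
  -- The pulled-back connection form. Its curvature is the pullback of the target curvature, since
  -- the terms with derivatives of J are symmetric in i, j; here dΓ stands for the derivatives in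
  -- target coordinates, as the chain rule `hΓ` expresses. What remains is a gauge transformation by
  -- J.
  set X : Fin n → Matrix (Fin n) (Fin n) A := fun i => ∑ a, J a i • Γ a with hX
  have hX' : dMat (D i) (X j) - dMat (D j) (X i) + (X i * X j - X j * X i)
      = ∑ a, ∑ b, (J a i * J b j) • (dΓ a b - dΓ b a + (Γ a * Γ b - Γ b * Γ a)) := by
    have e1 : ∀ i j, dMat (D i) (X j)
        = ∑ a, D i (J a j) • Γ a + ∑ a, ∑ b, (J a j * J b i) • dΓ b a := by
      intro i j
      simp only [hX, dMat_sum, dMat_smul, hΓ, Finset.sum_add_distrib, Finset.smul_sum, smul_smul]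
    have e2 : ∀ i j, X i * X j = ∑ a, ∑ b, (J a i * J b j) • (Γ a * Γ b) := by
      intro i j
      simp only [hX, Finset.sum_mul, Finset.mul_sum, smul_mul_smul_comm]
      exact Finset.sum_comm
    have e3 : ∑ a, D j (J a i) • Γ a = ∑ a, D i (J a j) • Γ a :=
      Finset.sum_congr rfl fun a _ => by rw [hJ]
    have e4 : ∀ Y : Fin n → Fin n → Matrix (Fin n) (Fin n) A,
        ∑ a, ∑ b, (J a j * J b i) • Y a b = ∑ a, ∑ b, (J a i * J b j) • Y b a := by
      intro Y
      rw [Finset.sum_comm]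
      simp only [mul_comm]
    rw [e1, e1, e2, e2, e3, e4 (fun a b => dΓ b a), e4 (fun a b => Γ a * Γ b)]
    simp only [smul_add, smul_sub, Finset.sum_add_distrib, Finset.sum_sub_distrib]
    abel
  rw [← hX']
  -- Differentiate the transformation law once more. Antisymmetrising cancels the second derivatives
  -- of J, and `k2` eliminates the first ones.
  have k1 : ∀ i j, dMat (D i) J * Γt j + J * dMat (D i) (Γt j)
      = dMat (D i) (X j) * J + X j * dMat (D i) J + dMat (D i) (dMat (D j) J) := by
    intro i j
    have := congrArg (dMat (D i)) (h j)
    rwa [dMat_mul, dMat_add, dMat_mul] at this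
  have k2 : ∀ i, dMat (D i) J = J * Γt i - X i * J := fun i => by rw [h i]; simp [hX]
  have k3 := k1 i j
  have k4 := k1 j i
  rw [dMat_comm (hD j i)] at k4
  generalize dMat (D i) (dMat (D j) J) = Z at k3 k4
  rw [k2 i] at k3
  rw [k2 j] at k4
  have k5 := congrArg₂ (· - ·) k3 k4
  rw [add_sub_add_right_eq_sub] at k5
  rw [← sub_eq_zero] at k5 ⊢
  rw [← k5]
  noncomm_ring

end ConformalEinstein

namespace ConformalEinstein

open Matrix Filter

/-! ### Partial derivatives -/

section PartialDerivatives

variable {n : ℕ} {x : Coord n} {f g : Coord n → ℝ}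

lemma pd_congr (h : f =ᶠ[𝓝 x] g) (k : Fin n) : pd k f x = pd k g x := by
  rw [pd, pd, h.fderiv_eq]

lemma pd_eventuallyEq (h : f =ᶠ[𝓝 x] g) (k : Fin n) : pd k f =ᶠ[𝓝 x] pd k g :=
  h.eventuallyEq_nhds.mono fun _ hy => pd_congr hy k

lemma pd_add (hf : DifferentiableAt ℝ f x) (hg : DifferentiableAt ℝ g x) (k : Fin n) :
    pd k (fun y => f y + g y) x = pd k f x + pd k g x := by
  simp [pd, fderiv_fun_add hf hg]

lemma pd_mul (hf : DifferentiableAt ℝ f x) (hg : DifferentiableAt ℝ g x) (k : Fin n) :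
    pd k (fun y => f y * g y) x = f x * pd k g x + g x * pd k f x := by
  simp [pd, fderiv_fun_mul hf hg]

lemma pd_sum {ι : Type*} (s : Finset ι) {f : ι → Coord n → ℝ}
    (hf : ∀ i ∈ s, DifferentiableAt ℝ (f i) x) (k : Fin n) :
    pd k (fun y => ∑ i ∈ s, f i y) x = ∑ i ∈ s, pd k (f i) x := by
  simp [pd, fderiv_fun_sum hf]

lemma pd_const (c : ℝ) (k : Fin n) : pd k (fun _ => c) x = 0 := by
  simp [pd]

lemma fderiv_eq_sum_pd (v : Coord n) : fderiv ℝ f x v = ∑ k, v k * pd k f x := by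
  have hv : v = ∑ k, v k • EuclideanSpace.single k (1 : ℝ) := by
    ext i
    simp [Pi.single_apply]
  conv_lhs => rw [hv]
  simp [pd]

lemma ContDiffAt.pd {m k : WithTop ℕ∞} (hf : ContDiffAt ℝ m f x) (hk : k + 1 ≤ m) (i : Fin n) :
    ContDiffAt ℝ k (pd i f) x :=
  (hf.fderiv_right hk).clm_apply contDiffAt_const

lemma ContDiffAt.pd_infty (hf : ContDiffAt ℝ ∞ f x) (i : Fin n) :
    ContDiffAt ℝ ∞ (ConformalEinstein.pd i f) x :=
  ContDiffAt.pd hf (by norm_num) i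

lemma pd_comm (hf : ContDiffAt ℝ 2 f x) (i j : Fin n) : pd i (pd j f) x = pd j (pd i f) x := by
  have h : ∀ i j : Fin n, pd i (pd j f) x = fderiv ℝ (fderiv ℝ f) x
      (EuclideanSpace.single i 1) (EuclideanSpace.single j 1) := by
    intro i j
    have hd : DifferentiableAt ℝ (fderiv ℝ f) x :=
      (hf.fderiv_right (m := 1) (by norm_num)).differentiableAt (by norm_num)
    change fderiv ℝ (fun y => fderiv ℝ f y (EuclideanSpace.single j 1)) x _ = _
    rw [fderiv_clm_apply hd (differentiableAt_const _)]
    simp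
  rw [h, h]
  exact (hf.isSymmSndFDerivAt (by simp)).eq _ _

lemma eventually_differentiableAt {m : WithTop ℕ∞} (hf : ContDiffAt ℝ m f x) (hm : 1 ≤ m) :
    ∀ᶠ y in 𝓝 x, DifferentiableAt ℝ f y :=
  ((hf.of_le hm).eventually (by simp)).mono fun _ hy => hy.differentiableAt (by simp)

/-- The chain rule. -/
lemma pd_comp {φ : Coord n → Coord n} {f : Coord n → ℝ}
    (hf : DifferentiableAt ℝ f (φ x)) (hφ : DifferentiableAt ℝ φ x) (i : Fin n) :
    pd i (fun y => f (φ y)) x = ∑ b, pd i (fun y => φ y b) x * pd b f (φ x) := by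
  have h1 : fderiv ℝ (fun y => f (φ y)) x = (fderiv ℝ f (φ x)).comp (fderiv ℝ φ x) :=
    fderiv_fun_comp x hf hφ
  rw [pd, h1, ContinuousLinearMap.comp_apply, fderiv_eq_sum_pd]
  refine Finset.sum_congr rfl fun b _ => ?_
  congr 1
  have : (fun y => φ y b) = fun y => EuclideanSpace.proj (𝕜 := ℝ) b (φ y) := rfl
  rw [pd, this, fderiv_fun_comp x (ContinuousLinearMap.differentiableAt _) hφ,
    ContinuousLinearMap.fderiv]
  rfl

end PartialDerivatives

/-! ### Germs of smooth functions -/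

section Germs

variable {n : ℕ}

/-- The functions which are smooth at `x`. -/
def smoothAt (x : Coord n) : Subalgebra ℝ (Coord n → ℝ) where
  carrier := {f | ContDiffAt ℝ ∞ f x}
  mul_mem' := by
    intro f g hf hg
    exact ContDiffAt.mul (Set.mem_ofPred.mp hf) (Set.mem_ofPred.mp hg)
  add_mem' := by
    intro f g hf hg
    exact ContDiffAt.add (Set.mem_ofPred.mp hf) (Set.mem_ofPred.mp hg)
  algebraMap_mem' c := Set.mem_ofPred.mpr (contDiffAt_const (c := c))

/-- The ideal of functions vanishing near `x`. -/
def vanishing (x : Coord n) : Ideal (smoothAt x) where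
  carrier := {f | f.1 =ᶠ[𝓝 x] 0}
  add_mem' := by
    intro f g hf hg
    filter_upwards [hf, hg] with y h1 h2
    simp [h1, h2]
  zero_mem' := EventuallyEq.rfl
  smul_mem' := by
    intro c f hf
    filter_upwards [hf] with y h1
    simp [h1]

/-- The ring of germs of smooth functions at `x`. -/
def SmoothGerm (x : Coord n) : Type := smoothAt x ⧸ vanishing x

instance (x : Coord n) : CommRing (SmoothGerm x) :=
  inferInstanceAs (CommRing (smoothAt x ⧸ vanishing x))

instance (x : Coord n) : Algebra ℝ (SmoothGerm x) :=
  inferInstanceAs (Algebra ℝ (smoothAt x ⧸ vanishing x))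

/-- The germ of a smooth function. -/
def SmoothGerm.mk {x : Coord n} (f : Coord n → ℝ) (h : ContDiffAt ℝ ∞ f x) : SmoothGerm x :=
  Ideal.Quotient.mk (vanishing x) ⟨f, h⟩

/-- The smooth germ `a` is the germ of the function `f`. -/
def Rep {x : Coord n} (a : SmoothGerm x) (f : Coord n → ℝ) : Prop :=
  ∃ h : ContDiffAt ℝ ∞ f x, a = .mk f h

namespace Rep

variable {x : Coord n} {a b : SmoothGerm x} {f g : Coord n → ℝ}

lemma exists_rep (a : SmoothGerm x) : ∃ f, Rep a f := by
  obtain ⟨⟨f, hf⟩, rfl⟩ := Ideal.Quotient.mk_surjective a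
  exact ⟨f, hf, rfl⟩

/-- The bridge between algebra and analysis: an equation of germs is an identity of representing
functions near x, and evaluating at x gives a pointwise identity. -/
lemma eq_iff (ha : Rep a f) (hb : Rep b g) : a = b ↔ f =ᶠ[𝓝 x] g := by
  obtain ⟨hf, rfl⟩ := ha
  obtain ⟨hg, rfl⟩ := hb
  rw [SmoothGerm.mk, SmoothGerm.mk]
  refine Ideal.Quotient.eq.trans ?_
  change (fun y => f y - g y) =ᶠ[𝓝 x] 0 ↔ _
  constructor <;> intro h <;> filter_upwards [h] with y hy
  · simpa [sub_eq_zero] using hy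
  · simp [hy]

lemma smooth (ha : Rep a f) : ContDiffAt ℝ ∞ f x := ha.1

lemma congr (ha : Rep a f) (h : f =ᶠ[𝓝 x] g) : Rep a g := by
  have hg : ContDiffAt ℝ ∞ g x := ha.smooth.congr_of_eventuallyEq h.symm
  exact ⟨hg, (ha.eq_iff ⟨hg, rfl⟩).mpr h⟩

lemma of (hf : ContDiffAt ℝ ∞ f x) : Rep (.mk f hf : SmoothGerm x) f := ⟨hf, rfl⟩

lemma const (c : ℝ) : Rep (algebraMap ℝ (SmoothGerm x) c) (fun _ => c) := ⟨contDiffAt_const, rfl⟩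

lemma natCast (m : ℕ) : Rep (m : SmoothGerm x) (fun _ => (m : ℝ)) := by
  have h := const (x := x) (m : ℝ)
  rwa [map_natCast] at h

lemma add (ha : Rep a f) (hb : Rep b g) : Rep (a + b) fun y => f y + g y := by
  obtain ⟨hf, rfl⟩ := ha
  obtain ⟨hg, rfl⟩ := hb
  exact ⟨hf.add hg, rfl⟩

lemma mul (ha : Rep a f) (hb : Rep b g) : Rep (a * b) fun y => f y * g y := by
  obtain ⟨hf, rfl⟩ := ha
  obtain ⟨hg, rfl⟩ := hb
  exact ⟨hf.mul hg, rfl⟩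

lemma sub (ha : Rep a f) (hb : Rep b g) : Rep (a - b) fun y => f y - g y := by
  obtain ⟨hf, rfl⟩ := ha
  obtain ⟨hg, rfl⟩ := hb
  exact ⟨hf.sub hg, rfl⟩

lemma sum {ι : Type*} (s : Finset ι) {a : ι → SmoothGerm x} {f : ι → Coord n → ℝ}
    (h : ∀ i, Rep (a i) (f i)) : Rep (∑ i ∈ s, a i) fun y => ∑ i ∈ s, f i y := by
  classical
  induction s using Finset.induction_on with
  | empty =>
    have h := const (x := x) 0
    rw [map_zero] at h
    simpa only [Finset.sum_empty] using h
  | insert i s hi ih =>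
    simp only [Finset.sum_insert hi]
    exact (h i).add ih

end Rep

/-- The partial derivatives of smooth germs. -/
def germD (x : Coord n) (k : Fin n) : Derivation ℝ (SmoothGerm x) (SmoothGerm x) := by
  -- Defined through a chosen representative; `hD` shows independence of the choice, so additivity
  -- and the Leibniz rule can be checked on any representatives.
  let D : SmoothGerm x → SmoothGerm x := fun a =>
    .mk (pd k (Rep.exists_rep a).choose)
      (ContDiffAt.pd_infty (Rep.exists_rep a).choose_spec.smooth k)
  have hD : ∀ {a f}, Rep a f → Rep (D a) (pd k f) := by
    intro a f h
    have h2 : Rep (D a) (pd k (Rep.exists_rep a).choose) := Rep.of _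
    exact h2.congr (pd_eventuallyEq (((Rep.exists_rep a).choose_spec.eq_iff h).mp rfl) k)
  have hd : ∀ {a : SmoothGerm x} {f}, Rep a f → ∀ᶠ y in 𝓝 x, DifferentiableAt ℝ f y :=
    fun h => eventually_differentiableAt h.smooth (by norm_num)
  refine Derivation.mk' { toFun := D, map_add' := ?_, map_smul' := ?_ } ?_
  · intro a b
    obtain ⟨f, ha⟩ := Rep.exists_rep a
    obtain ⟨g, hb⟩ := Rep.exists_rep b
    rw [(hD (ha.add hb)).eq_iff ((hD ha).add (hD hb))]
    filter_upwards [hd ha, hd hb] with y h1 h2 using pd_add h1 h2 k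
  · intro c a
    obtain ⟨f, ha⟩ := Rep.exists_rep a
    rw [RingHom.id_apply, Algebra.smul_def, Algebra.smul_def, (hD ((Rep.const c).mul ha)).eq_iff ((Rep.const c).mul (hD ha))]
    filter_upwards [hd ha] with y h1
    rw [pd_mul (differentiableAt_const _) h1, pd_const]
    ring
  · intro a b
    obtain ⟨f, ha⟩ := Rep.exists_rep a
    obtain ⟨g, hb⟩ := Rep.exists_rep b
    simp only [smul_eq_mul]
    change D (a * b) = a * D b + b * D a
    rw [(hD (ha.mul hb)).eq_iff ((ha.mul (hD hb)).add (hb.mul (hD ha)))]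
    filter_upwards [hd ha, hd hb] with y h1 h2 using pd_mul h1 h2 k

lemma Rep.D {x : Coord n} {a : SmoothGerm x} {f : Coord n → ℝ} (h : Rep a f) (k : Fin n) :
    Rep (germD x k a) (pd k f) := by
  have h2 : Rep (germD x k a) (pd k (Rep.exists_rep a).choose) := Rep.of
    (ContDiffAt.pd_infty (Rep.exists_rep a).choose_spec.smooth k)
  exact h2.congr (pd_eventuallyEq (((Rep.exists_rep a).choose_spec.eq_iff h).mp rfl) k)

lemma germD_comm (x : Coord n) (i j : Fin n) (a : SmoothGerm x) :
    germD x i (germD x j a) = germD x j (germD x i a) := by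
  obtain ⟨f, h⟩ := Rep.exists_rep a
  rw [((h.D j).D i).eq_iff ((h.D i).D j)]
  have h2 : ContDiffAt ℝ 2 f x := h.smooth.of_le (WithTop.coe_le_coe.mpr le_top)
  filter_upwards [h2.eventually (by simp)] with y hy using pd_comm hy i j

end Germs

end ConformalEinstein

namespace ConformalEinstein

open Matrix Filter

/-! ### Riemannian metrics on open subsets of the coordinate space -/

section MetricOn

variable {n : ℕ}

lemma ContDiffAt.matrix_det {m : WithTop ℕ∞} {x : Coord n}
    {A : Coord n → Matrix (Fin n) (Fin n) ℝ} (h : ∀ i j, ContDiffAt ℝ m (fun y => A y i j) x) :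
    ContDiffAt ℝ m (fun y => (A y).det) x := by
  simp only [det_apply']
  exact ContDiffAt.sum fun σ _ => contDiffAt_const.mul (contDiffAt_prod fun i _ => h _ _)

lemma ContDiffAt.matrix_inv {m : WithTop ℕ∞} {x : Coord n}
    {A : Coord n → Matrix (Fin n) (Fin n) ℝ} (h : ∀ i j, ContDiffAt ℝ m (fun y => A y i j) x)
    (hdet : (A x).det ≠ 0) (i j : Fin n) : ContDiffAt ℝ m (fun y => (A y)⁻¹ i j) x := by
  simp only [Matrix.inv_def, Ring.inverse_eq_inv', Matrix.smul_apply, smul_eq_mul,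
    adjugate_apply]
  refine ((ContDiffAt.matrix_det h).inv hdet).mul (ContDiffAt.matrix_det fun a b => ?_)
  -- The cofactor is the determinant with row j replaced by a constant unit vector; the other rows
  -- are those of `A`.
  by_cases ha : a = j
  · subst ha; simpa using contDiffAt_const
  · simpa [updateRow_ne ha] using h a b

/-- `G` is a smooth Riemannian metric on the open set `U`. -/
structure IsMetricOn (G : Coord n → Matrix (Fin n) (Fin n) ℝ) (U : Set (Coord n)) : Prop where
  isOpen : IsOpen U
  smooth : ∀ i j, ContDiffOn ℝ ∞ (fun y => G y i j) U
  posDef : ∀ y ∈ U, (G y).PosDef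

namespace IsMetricOn

variable {G : Coord n → Matrix (Fin n) (Fin n) ℝ} {U : Set (Coord n)} (h : IsMetricOn G U)
  {x : Coord n} (hx : x ∈ U)

include h

lemma mono {U' : Set (Coord n)} (hU : IsOpen U') (hsub : U' ⊆ U) : IsMetricOn G U' :=
  ⟨hU, fun i j => (h.smooth i j).mono hsub, fun y hy => h.posDef y (hsub hy)⟩

lemma symm {y : Coord n} (hy : y ∈ U) (i j : Fin n) : G y i j = G y j i := by
  have := (h.posDef y hy).isHermitian.apply i j
  simpa using this.symm

include hx

lemma mem_nhds : ∀ᶠ y in 𝓝 x, y ∈ U := h.isOpen.mem_nhds hx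

lemma smoothAt (i j : Fin n) : ContDiffAt ℝ ∞ (fun y => G y i j) x :=
  (h.smooth i j).contDiffAt (h.isOpen.mem_nhds hx)

lemma det_ne_zero : (G x).det ≠ 0 := (h.posDef x hx).det_pos.ne'

lemma mul_ginv : G x * ginv G x = 1 :=
  Matrix.mul_nonsing_inv _ (isUnit_iff_ne_zero.mpr (h.det_ne_zero hx))

lemma ginv_mul : ginv G x * G x = 1 :=
  Matrix.nonsing_inv_mul _ (isUnit_iff_ne_zero.mpr (h.det_ne_zero hx))

lemma ginv_posDef : (ginv G x).PosDef := (h.posDef x hx).inv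

lemma ginv_symm (i j : Fin n) : ginv G x i j = ginv G x j i := by
  have := (h.ginv_posDef hx).isHermitian.apply i j
  simpa using this.symm

lemma ginv_smoothAt (i j : Fin n) : ContDiffAt ℝ ∞ (fun y => ginv G y i j) x :=
  ContDiffAt.matrix_inv (h.smoothAt hx) (h.det_ne_zero hx) i j

omit hx in
/-- The formal metric over the ring of smooth germs at `x`. -/
def formal (hx : x ∈ U) : FormalMetric n (SmoothGerm x) :=
  FormalMetric.ofMetric (germD x)
    (Matrix.of fun i j => .mk (fun y => G y i j) (h.smoothAt hx i j))
    (Matrix.of fun i j => .mk (fun y => ginv G y i j) (h.ginv_smoothAt hx i j))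
    (germD_comm x)
    (by
      ext i j
      simp only [transpose_apply, Matrix.of_apply]
      refine (Rep.eq_iff (Rep.of _) (Rep.of _)).mpr ?_
      filter_upwards [h.mem_nhds hx] with y hy using h.symm hy j i)
    (by
      ext i j
      simp only [mul_apply, Matrix.of_apply, one_apply]
      have h1 : Rep (if i = j then (1 : SmoothGerm x) else 0)
          (fun _ => if i = j then (1 : ℝ) else 0) := by
        split_ifs
        · simpa only [map_one] using Rep.const (x := x) 1
        · simpa only [map_zero] using Rep.const (x := x) 0
      refine (Rep.eq_iff (Rep.sum _ fun k => (Rep.of _).mul (Rep.of _)) h1).mpr ?_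
      filter_upwards [h.mem_nhds hx] with y hy
      have := congrFun (congrFun (h.mul_ginv hy) i) j
      rwa [mul_apply, one_apply] at this)

/-- From here on the proof term of each `rep_` lemma repeats the definition of its tensor, so every
identity of the formal metric transfers to the coordinate tensors through `Rep.eq_iff`. -/
lemma rep_G (i j : Fin n) : Rep ((h.formal hx).G i j) (fun y => G y i j) :=
  Rep.of (h.smoothAt hx i j)

lemma rep_Gi (i j : Fin n) : Rep ((h.formal hx).Gi i j) (fun y => ginv G y i j) :=
  Rep.of (h.ginv_smoothAt hx i j)

lemma rep_D {a : SmoothGerm x} {f : Coord n → ℝ} (ha : Rep a f) (k : Fin n) :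
    Rep ((h.formal hx).D k a) (pd k f) := ha.D k

lemma rep_Γ (i k j : Fin n) : Rep ((h.formal hx).Γ i k j) (fun y => christoffel G y k i j) :=
  (Rep.const (1 / 2)).mul (Rep.sum _ fun l => (h.rep_Gi hx k l).mul
    ((((h.rep_G hx j l).D i).add ((h.rep_G hx i l).D j)).sub ((h.rep_G hx i j).D l)))

lemma rep_R (i j l k : Fin n) : Rep ((h.formal hx).R i j l k) (fun y => riemannUp G y i j k l) := by
  have := (((h.rep_Γ hx j l k).D i).sub ((h.rep_Γ hx i l k).D j)).add
    (Rep.sum Finset.univ fun m => ((h.rep_Γ hx i l m).mul (h.rep_Γ hx j m k)).sub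
      ((h.rep_Γ hx j l m).mul (h.rep_Γ hx i m k)))
  convert! this using 1
  simp only [FormalMetric.R, Matrix.add_apply, Matrix.sub_apply, mul_apply,
    Finset.sum_sub_distrib]
  rfl

lemma rep_Rl (i j k l : Fin n) : Rep ((h.formal hx).Rl i j k l) (fun y => riemann G y i j k l) :=
  Rep.sum _ fun m => (h.rep_R hx i j m k).mul (h.rep_G hx m l)

lemma rep_Ric (j k : Fin n) : Rep ((h.formal hx).Ric j k) (fun y => ricci G y j k) :=
  Rep.sum _ fun i => h.rep_R hx i j i k

lemma rep_Scal : Rep (h.formal hx).Scal (fun y => scalar G y) :=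
  Rep.sum _ fun j => Rep.sum _ fun k => (h.rep_Gi hx j k).mul (h.rep_Ric hx j k)

lemma rep_P (i j : Fin n) : Rep ((h.formal hx).P i j) (fun y => schouten G y i j) :=
  (Rep.const _).mul ((h.rep_Ric hx i j).sub (((Rep.const _).mul (h.rep_Scal hx)).mul
    (h.rep_G hx i j)))

lemma rep_W (i j k l : Fin n) : Rep ((h.formal hx).W i j k l) (fun y => weyl G y i j k l) :=
  (h.rep_Rl hx i j k l).sub (((((h.rep_G hx i l).mul (h.rep_P hx j k)).add
    ((h.rep_G hx j k).mul (h.rep_P hx i l))).sub ((h.rep_G hx i k).mul (h.rep_P hx j l))).sub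
    ((h.rep_G hx j l).mul (h.rep_P hx i k)))

lemma rep_nablaWeyl (m i j k l : Fin n) :
    Rep ((h.formal hx).nabla₄ (h.formal hx).W m i j k l) (fun y => nablaWeyl G y m i j k l) :=
  (h.rep_D hx (h.rep_W hx i j k l) m).sub (Rep.sum _ fun a =>
    ((((h.rep_Γ hx m a i).mul (h.rep_W hx a j k l)).add
    ((h.rep_Γ hx m a j).mul (h.rep_W hx i a k l))).add
    ((h.rep_Γ hx m a k).mul (h.rep_W hx i j a l))).add
    ((h.rep_Γ hx m a l).mul (h.rep_W hx i j k a)))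

lemma rep_divWeyl (i j k : Fin n) :
    Rep ((h.formal hx).div₄ (h.formal hx).W i j k) (fun y => divWeyl G y i j k) :=
  Rep.sum _ fun m => Rep.sum _ fun l => (h.rep_Gi hx m l).mul (h.rep_nablaWeyl hx m i j k l)

/-! #### Symmetries of the curvature -/

lemma ricci_symm (j k : Fin n) : ricci G x j k = ricci G x k j :=
  (((h.rep_Ric hx j k).eq_iff (h.rep_Ric hx k j)).mp
    ((h.formal hx).Ric_symm j k)).self_of_nhds

lemma christoffel_symm (k i j : Fin n) : christoffel G x k i j = christoffel G x k j i :=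
  (((h.rep_Γ hx i k j).eq_iff (h.rep_Γ hx j k i)).mp
    ((h.formal hx).torsion_free i k j)).self_of_nhds

lemma pd_metric (m i j : Fin n) : pd m (fun y => G y i j) x
    = ∑ a, (christoffel G x a m i * G x a j + christoffel G x a m j * G x i a) :=
  (((h.rep_D hx (h.rep_G hx i j) m).eq_iff (Rep.sum _ fun a =>
    ((h.rep_Γ hx m a i).mul (h.rep_G hx a j)).add ((h.rep_Γ hx m a j).mul (h.rep_G hx i a)))).mp
    ((h.formal hx).D_G m i j)).self_of_nhds

lemma weyl_antisymm_right (i j k l : Fin n) : weyl G x i j l k = -weyl G x i j k l := by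
  have := (((h.rep_W hx i j l k).add (h.rep_W hx i j k l)).eq_iff (Rep.const (x := x) 0)).mp
    (by rw [map_zero, (h.formal hx).W_antisymm_right, neg_add_cancel])
  exact eq_neg_of_add_eq_zero_left this.self_of_nhds

lemma weyl_bianchi (i j k l : Fin n) :
    weyl G x i j k l + weyl G x j k i l + weyl G x k i j l = 0 :=
  ((((h.rep_W hx i j k l).add (h.rep_W hx j k i l)).add (h.rep_W hx k i j l)).eq_iff
    (Rep.const (x := x) 0)).mp (by rw [map_zero, (h.formal hx).W_bianchi]) |>.self_of_nhds

lemma weyl_pair_symm (i j k l : Fin n) : weyl G x i j k l = weyl G x k l i j :=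
  (((h.rep_W hx i j k l).eq_iff (h.rep_W hx k l i j)).mp
    ((h.formal hx).W_pair_symm i j k l)).self_of_nhds

/-! #### Contractions -/

lemma sum_ginv_G (T : Fin n → ℝ) (m : Fin n) :
    ∑ l, ginv G x m l * ∑ s, T s * G x s l = T m := by
  have e : ∀ s, ∑ l, ginv G x m l * G x l s = (1 : Matrix (Fin n) (Fin n) ℝ) m s := fun s => by
    rw [← h.ginv_mul hx, mul_apply]
  calc ∑ l, ginv G x m l * ∑ s, T s * G x s l = ∑ s, (∑ l, ginv G x m l * G x l s) * T s := by
        simp only [Finset.mul_sum, Finset.sum_mul]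
        rw [Finset.sum_comm]
        refine Finset.sum_congr rfl fun s _ => Finset.sum_congr rfl fun l _ => ?_
        rw [h.symm hx s l]; ring
    _ = T m := by simp [e, one_apply]

lemma sum_G_ginv (T : Fin n → ℝ) (m : Fin n) :
    ∑ l, (∑ s, ginv G x l s * T s) * G x l m = T m := by
  have e : ∀ s, ∑ l, G x m l * ginv G x l s = (1 : Matrix (Fin n) (Fin n) ℝ) m s := fun s => by
    rw [← h.mul_ginv hx, mul_apply]
  calc ∑ l, (∑ s, ginv G x l s * T s) * G x l m = ∑ s, (∑ l, G x m l * ginv G x l s) * T s := by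
        simp only [Finset.sum_mul]
        rw [Finset.sum_comm]
        refine Finset.sum_congr rfl fun s _ => Finset.sum_congr rfl fun l _ => ?_
        rw [h.symm hx l m]; ring
    _ = T m := by simp [e, one_apply]

/-- The covariant derivative of a vector field with lowered index. -/
lemma sum_nablaVec_mul {V : Coord n → Coord n}
    (hV : ∀ k, DifferentiableAt ℝ (fun y => V y k) x) (i j : Fin n) :
    ∑ k, nablaVec G V x i k * G x k j
      = pd i (fun y => flat G V y j) x - ∑ a, christoffel G x a i j * flat G V x a := by
  have hG : ∀ k, DifferentiableAt ℝ (fun y => G y k j) x := fun k =>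
    (h.smoothAt hx k j).differentiableAt (by simp)
  have e : pd i (fun y => flat G V y j) x
      = ∑ k, (V x k * ∑ a, (christoffel G x a i k * G x a j + christoffel G x a i j * G x k a)
        + G x k j * pd i (fun y => V y k) x) := by
    simp only [flat]
    rw [pd_sum (f := fun k y => V y k * G y k j) _ fun k _ => (hV k).fun_mul (hG k)]
    exact Finset.sum_congr rfl fun k _ => by rw [pd_mul (hV k) (hG k), h.pd_metric hx]
  rw [e]
  simp only [nablaVec, flat, add_mul, mul_add, Finset.sum_add_distrib, Finset.mul_sum,
    Finset.sum_mul]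
  have e1 : ∑ k, ∑ a, V x k * (christoffel G x a i j * G x k a)
      = ∑ a, ∑ k, christoffel G x a i j * (V x k * G x k a) := by
    rw [Finset.sum_comm]
    exact Finset.sum_congr rfl fun k _ => Finset.sum_congr rfl fun a _ => by ring
  have e2 : ∑ k, ∑ l, christoffel G x k i l * V x l * G x k j
      = ∑ k, ∑ a, V x k * (christoffel G x a i k * G x a j) := by
    rw [Finset.sum_comm]
    exact Finset.sum_congr rfl fun k _ => Finset.sum_congr rfl fun a _ => by ring
  rw [e1, e2, Finset.sum_congr rfl fun k _ => mul_comm (pd i (fun y => V y k) x) (G x k j)]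
  ring

lemma sum_ginv_nablaVec (V : Coord n → Coord n) :
    ∑ i, ∑ j, ginv G x i j * ∑ k, nablaVec G V x i k * G x k j = divVec G V x :=
  Finset.sum_congr rfl fun i _ => h.sum_ginv_G hx (fun k => nablaVec G V x i k) i

lemma sum_ginv_flat (V : Coord n → Coord n) (i : Fin n) :
    ∑ j, ginv G x i j * flat G V x j = V x i :=
  h.sum_ginv_G hx (fun k => V x k) i

lemma sum_ginv_flat_flat (V : Coord n → Coord n) :
    ∑ i, ∑ j, ginv G x i j * (flat G V x i * flat G V x j) = normSqVec G V x := by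
  have : ∀ i, ∑ j, ginv G x i j * (flat G V x i * flat G V x j) = flat G V x i * V x i := by
    intro i
    rw [← h.sum_ginv_flat hx V i, Finset.mul_sum]
    exact Finset.sum_congr rfl fun j _ => by ring
  simp only [this]
  simp only [flat, normSqVec, Finset.sum_mul]
  rw [Finset.sum_comm]
  exact Finset.sum_congr rfl fun k _ => Finset.sum_congr rfl fun a _ => by ring

/-! #### The conformal Einstein equation -/

/-- If the conformal Ricci tensor of `V` vanishes, the divergence of the Weyl tensor is `n - 3`
times the contraction of the Weyl tensor with `V`. -/
theorem divWeyl_eq (hn : 4 ≤ n) {V : Coord n → Coord n}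
    (hV : ∀ k, ContDiffAt ℝ ∞ (fun y => V y k) x)
    (hE : ∀ᶠ y in 𝓝 x, ∀ i j, localConformalRicci G V y i j = 0) (i j k : Fin n) :
    divWeyl G x i j k = ((n : ℝ) - 3) * ∑ l, weyl G x i j k l * V x l := by
  set S := h.formal hx
  have hn' : (4 : ℝ) ≤ n := by exact_mod_cast hn
  let Vh : Fin n → SmoothGerm x := fun k => .mk _ (hV k)
  have rV : ∀ k, Rep (Vh k) (fun y => V y k) := fun k => Rep.of (hV k)
  let vh : Fin n → SmoothGerm x := fun l => ∑ m, Vh m * S.G m l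
  have rv : ∀ l, Rep (vh l) (fun y => flat G V y l) := fun l =>
    Rep.sum _ fun m => (rV m).mul (h.rep_G hx m l)
  have hVd : ∀ᶠ y in 𝓝 x, ∀ k, DifferentiableAt ℝ (fun y => V y k) y :=
    eventually_all.mpr fun k => eventually_differentiableAt (hV k) (by norm_num)
  have rN : ∀ i j, Rep (S.nabla₁ vh i j) (fun y => ∑ k, nablaVec G V y i k * G y k j) := by
    intro i j
    have : Rep (S.nabla₁ vh i j) (fun y => pd i (fun z => flat G V z j) y
        - ∑ a, christoffel G y a i j * flat G V y a) :=
      (h.rep_D hx (rv j) i).sub (Rep.sum _ fun a => (h.rep_Γ hx i a j).mul (rv a))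
    refine this.congr ?_
    filter_upwards [h.mem_nhds hx, hVd] with y hy hy'
    rw [h.sum_nablaVec_mul hy hy']
  -- The factor is forced by taking the trace: (div V + |V|²)/n from the first two terms, and
  -- S/(2n(n - 1)) because tr P = S/(2(n - 1)).
  let lamh : SmoothGerm x := algebraMap ℝ _ (1 / n) *
      (∑ i, ∑ j, S.Gi i j * S.nabla₁ vh i j + ∑ i, ∑ j, S.Gi i j * (vh i * vh j))
      + algebraMap ℝ _ (1 / (2 * n * (n - 1))) * S.Scal
  have rlam : Rep lamh (fun y => 1 / n *
      (∑ i, ∑ j, ginv G y i j * (∑ k, nablaVec G V y i k * G y k j)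
        + ∑ i, ∑ j, ginv G y i j * (flat G V y i * flat G V y j))
      + 1 / (2 * n * (n - 1)) * scalar G y) :=
    ((Rep.const _).mul ((Rep.sum _ fun i => Rep.sum _ fun j => (h.rep_Gi hx i j).mul (rN i j)).add
      (Rep.sum _ fun i => Rep.sum _ fun j => (h.rep_Gi hx i j).mul ((rv i).mul (rv j))))).add
      ((Rep.const _).mul (h.rep_Scal hx))
  have key : ∀ i j, S.nabla₁ vh i j + vh i * vh j + S.P i j = lamh * S.G i j := by
    intro i j
    refine ((((rN i j).add ((rv i).mul (rv j))).add (h.rep_P hx i j)).eq_iff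
      (rlam.mul (h.rep_G hx i j))).mpr ?_
    filter_upwards [h.mem_nhds hx, hE] with y hy hEy
    have := hEy i j
    rw [localConformalRicci, tracelessRicci] at this
    rw [h.sum_ginv_nablaVec hy, h.sum_ginv_flat_flat hy, schouten]
    have h1 : (n : ℝ) - 2 ≠ 0 := by intro hh; linarith
    have h2 : (n : ℝ) - 1 ≠ 0 := by intro hh; linarith
    have h3 : (n : ℝ) ≠ 0 := by intro hh; linarith
    field_simp
    field_simp at this
    linear_combination (2 * ((n : ℝ) - 1)) * this
  have main := S.div₄_W_eq hn Vh vh (fun l => rfl) lamh key i j k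
  have r := (Rep.const (x := x) ((n : ℝ) - 3)).mul (Rep.sum Finset.univ fun l =>
    (h.rep_W hx i j k l).mul (rV l))
  refine (((h.rep_divWeyl hx i j k).eq_iff r).mp ?_).self_of_nhds
  rw [main, map_sub, map_natCast, map_ofNat]

/-- The traceless Ricci tensor of a conformal metric is the conformal Ricci tensor of the gradient
of the conformal factor. -/
theorem tracelessRicci_conformal (hn : 4 ≤ n) {G' : Coord n → Matrix (Fin n) (Fin n) ℝ}
    (h' : IsMetricOn G' U) {c : Coord n → ℝ} (hc : ContDiffAt ℝ ∞ c x) (hc0 : c x ≠ 0)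
    (hG' : ∀ᶠ y in 𝓝 x, G' y = c y • G y) {V : Coord n → Coord n}
    (hV : ∀ k, ContDiffAt ℝ ∞ (fun y => V y k) x) {f : Coord n → ℝ} (hf : ContDiffAt ℝ ∞ f x)
    (hfV : ∀ᶠ y in 𝓝 x, ∀ l, flat G V y l = pd l f y)
    (hcf : ∀ᶠ y in 𝓝 x, ∀ i, pd i c y = -2 * c y * pd i f y) (j k : Fin n) :
    tracelessRicci G' x j k = localConformalRicci G V x j k := by
  set S := h.formal hx with hS
  have hn' : (4 : ℝ) ≤ n := by exact_mod_cast hn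
  let ch : SmoothGerm x := .mk c hc
  have rc : Rep ch c := Rep.of hc
  have rci : Rep (SmoothGerm.mk _ (hc.inv hc0)) (fun y => (c y)⁻¹) := Rep.of (hc.inv hc0)
  set cih : SmoothGerm x := .mk _ (hc.inv hc0)
  have hcc : ch * cih = 1 := by
    have h1 := Rep.const (x := x) 1
    rw [map_one] at h1
    refine ((rc.mul rci).eq_iff h1).mpr ?_
    filter_upwards [hc.continuousAt.eventually_ne hc0] with y hy using mul_inv_cancel₀ hy
  let Vh : Fin n → SmoothGerm x := fun k => .mk _ (hV k)
  have rV : ∀ k, Rep (Vh k) (fun y => V y k) := fun k => Rep.of (hV k)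
  let fh : SmoothGerm x := .mk f hf
  have rf : Rep fh f := Rep.of hf
  -- Taking df itself, and not the lowered V, as the formal covector makes its closedness an
  -- instance of `D_comm`; `hfV` identifies the two.
  let vh : Fin n → SmoothGerm x := fun l => S.D l fh
  have rv : ∀ l, Rep (vh l) (fun y => flat G V y l) := fun l => by
    refine (h.rep_D hx rf l).congr ?_
    filter_upwards [hfV] with y hy using (hy l).symm
  have hv : ∀ l, vh l = ∑ m, S.G l m * Vh m := fun l => by
    refine ((rv l).eq_iff (Rep.sum _ fun m => (h.rep_G hx l m).mul (rV m))).mpr ?_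
    filter_upwards [h.mem_nhds hx] with y hy
    exact Finset.sum_congr rfl fun m _ => by rw [h.symm hy l m, mul_comm]
  have hcD : ∀ i, S.D i ch = -2 * ch * vh i := fun i => by
    have h2 := Rep.const (x := x) (-2)
    rw [map_neg, map_ofNat] at h2
    refine ((h.rep_D hx rc i).eq_iff ((h2.mul rc).mul (h.rep_D hx rf i))).mpr ?_
    filter_upwards [hcf] with y hy using hy i
  have hsymm : ∀ i j, S.D i (vh j) = S.D j (vh i) := fun i j => S.D_comm i j fh
  have main := S.conformal_traceless ch cih hcc vh Vh hv hcD hsymm j k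
  set S' := S.conformal ch cih hcc vh Vh hv hcD
  have hGG : (h'.formal hx).G = S'.G := by
    ext i j
    refine ((h'.rep_G hx i j).eq_iff (rc.mul (h.rep_G hx i j))).mpr ?_
    filter_upwards [hG'] with y hy
    rw [hy, Matrix.smul_apply, smul_eq_mul]
  -- The metric structure built from `G'` coincides with the conformally changed one, so the formal
  -- transformation law speaks about the curvature of `G'`.
  have hSS : h'.formal hx = S' := FormalMetric.ext_of_G rfl hGG
  have hVd : ∀ k, DifferentiableAt ℝ (fun y => V y k) x := fun k =>
    (hV k).differentiableAt (by simp)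
  have rN : ∀ i j, Rep (S.nabla₁ vh i j) (fun y => pd i (fun z => flat G V z j) y
        - ∑ a, christoffel G y a i j * flat G V y a) := fun i j =>
    (h.rep_D hx (rv j) i).sub (Rep.sum _ fun a => (h.rep_Γ hx i a j).mul (rv a))
  have rL : Rep ((n : SmoothGerm x) * S'.Ric j k - S'.Scal * (ch * S.G j k))
      (fun y => n * ricci G' y j k - scalar G' y * G' y j k) := by
    have e : ch * S.G j k = (h'.formal hx).G j k := by rw [hGG]; rfl
    rw [← hSS, e]
    exact ((Rep.natCast n).mul (h'.rep_Ric hx j k)).sub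
      ((h'.rep_Scal hx).mul (h'.rep_G hx j k))
  have r2 := (Rep.natCast (x := x) n).sub (Rep.const (x := x) 2)
  rw [map_ofNat] at r2
  have rR := (((Rep.natCast n).mul (h.rep_Ric hx j k)).sub
      ((h.rep_Scal hx).mul (h.rep_G hx j k))).add (r2.mul
      (((Rep.natCast n).mul ((rN j k).add ((rv j).mul (rv k)))).sub
        ((Rep.sum Finset.univ fun i => Rep.sum Finset.univ fun l => (h.rep_Gi hx i l).mul
          ((rN i l).add ((rv i).mul (rv l)))).mul (h.rep_G hx j k))))
  have ev := ((rL.eq_iff rR).mp main).self_of_nhds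
  simp only [← h.sum_nablaVec_mul hx hVd] at ev
  simp only [mul_add (ginv G x _ _), Finset.sum_add_distrib] at ev
  rw [h.sum_ginv_nablaVec hx, h.sum_ginv_flat_flat hx] at ev
  have h3 : (n : ℝ) ≠ 0 := by intro hh; linarith
  rw [localConformalRicci, tracelessRicci, tracelessRicci]
  field_simp
  linear_combination ev

end IsMetricOn

end MetricOn

end ConformalEinstein

namespace ConformalEinstein

open Matrix Filter

/-! ### Change of coordinates -/

section ChangeOfCoordinates

variable {n : ℕ}

/-- In this form coordinate invariance of S follows from cyclicity of the trace. -/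
lemma IsMetricOn.scalar_eq_trace {G : Coord n → Matrix (Fin n) (Fin n) ℝ} {U : Set (Coord n)}
    (h : IsMetricOn G U) {x : Coord n} (hx : x ∈ U) :
    scalar G x = (ginv G x * Matrix.of (ricci G x)).trace := by
  simp only [scalar, trace, diag_apply, mul_apply, Matrix.of_apply]
  exact Finset.sum_congr rfl fun i _ => Finset.sum_congr rfl fun j _ => by
    rw [h.ricci_symm hx]

/-- With `sum_mul_cross` this covers the index patterns of the Kulkarni-Nomizu product, whose
pullback therefore factors into pullbacks of (0,2) tensors. -/
lemma sum_mul_outer (u v w z : Fin n → ℝ) (A B : Fin n → Fin n → ℝ) :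
    ∑ a, ∑ b, ∑ c, ∑ d, u a * v b * w c * z d * (A a d * B b c)
      = (∑ a, ∑ d, u a * z d * A a d) * ∑ b, ∑ c, v b * w c * B b c := by
  rw [Finset.sum_mul_sum]
  refine Finset.sum_congr rfl fun a _ => Finset.sum_congr rfl fun b _ => ?_
  rw [Finset.sum_mul_sum, Finset.sum_comm]
  exact Finset.sum_congr rfl fun d _ => Finset.sum_congr rfl fun c _ => by ring

lemma sum_mul_cross (u v w z : Fin n → ℝ) (A B : Fin n → Fin n → ℝ) :
    ∑ a, ∑ b, ∑ c, ∑ d, u a * v b * w c * z d * (A a c * B b d)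
      = (∑ a, ∑ c, u a * w c * A a c) * ∑ b, ∑ d, v b * z d * B b d := by
  rw [Finset.sum_mul_sum]
  refine Finset.sum_congr rfl fun a _ => Finset.sum_congr rfl fun b _ => ?_
  rw [Finset.sum_mul_sum]
  exact Finset.sum_congr rfl fun d _ => Finset.sum_congr rfl fun c _ => by ring

/-- The Jacobian matrix of a map between coordinate spaces. -/
def jac (φ : Coord n → Coord n) (y : Coord n) : Matrix (Fin n) (Fin n) ℝ :=
  Matrix.of fun a i => pd i (fun z => φ z a) y

/-- The smooth map `φ` pulls back the metric `G` on `U` to the metric `Gt` on `Ut`. -/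
structure IsPullbackOn (φ : Coord n → Coord n) (Gt G : Coord n → Matrix (Fin n) (Fin n) ℝ)
    (Ut U : Set (Coord n)) : Prop where
  source : IsMetricOn Gt Ut
  target : IsMetricOn G U
  mapsTo : ∀ y ∈ Ut, φ y ∈ U
  smooth : ∀ a, ContDiffOn ℝ ∞ (fun y => φ y a) Ut
  metric_eq : ∀ y ∈ Ut, Gt y = (jac φ y)ᵀ * G (φ y) * jac φ y

namespace IsPullbackOn

variable {φ : Coord n → Coord n} {Gt G : Coord n → Matrix (Fin n) (Fin n) ℝ}
  {Ut U : Set (Coord n)} (h : IsPullbackOn φ Gt G Ut U) {x : Coord n} (hx : x ∈ Ut)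

include h hx

lemma smoothAt (a : Fin n) : ContDiffAt ℝ ∞ (fun y => φ y a) x :=
  (h.smooth a).contDiffAt (h.source.isOpen.mem_nhds hx)

lemma map_smoothAt : ContDiffAt ℝ ∞ φ x :=
  contDiffAt_euclidean.mpr (h.smoothAt hx)

/-- Invertibility of the Jacobian need not be assumed: the pulled-back metric is nondegenerate, and
det J divides its determinant. -/
lemma det_jac_ne_zero : (jac φ x).det ≠ 0 := by
  have h1 := h.source.det_ne_zero hx
  rw [h.metric_eq x hx, det_mul, det_mul] at h1
  exact right_ne_zero_of_mul h1

lemma jac_mul_inv : jac φ x * (jac φ x)⁻¹ = 1 :=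
  Matrix.mul_nonsing_inv _ (isUnit_iff_ne_zero.mpr (h.det_jac_ne_zero hx))

lemma jac_smoothAt (a i : Fin n) : ContDiffAt ℝ ∞ (fun y => jac φ y a i) x :=
  ContDiffAt.pd_infty (h.smoothAt hx a) i

lemma comp_smoothAt {f : Coord n → ℝ} (hf : ContDiffAt ℝ ∞ f (φ x)) :
    ContDiffAt ℝ ∞ (fun y => f (φ y)) x :=
  hf.comp x (h.map_smoothAt hx)

lemma D_comp {f : Coord n → ℝ} (hf : ContDiffAt ℝ ∞ f (φ x)) (i : Fin n) :
    germD x i (.mk _ (h.comp_smoothAt hx hf))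
      = ∑ b, .mk _ (h.jac_smoothAt hx b i) *
        .mk _ (h.comp_smoothAt hx (ContDiffAt.pd_infty hf b)) := by
  refine (((Rep.of (h.comp_smoothAt hx hf)).D i).eq_iff (Rep.sum _ fun b =>
    (Rep.of (h.jac_smoothAt hx b i)).mul
      (Rep.of (h.comp_smoothAt hx (ContDiffAt.pd_infty hf b))))).mpr ?_
  have h1 := (h.map_smoothAt hx).continuousAt.eventually
    (eventually_differentiableAt hf (by norm_num))
  filter_upwards [h1, h.source.mem_nhds hx] with y hy hyU
  exact pd_comp hy ((h.map_smoothAt hyU).differentiableAt (by simp)) i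

/-- The transformation law of the Christoffel symbols and of the curvature. -/
theorem christoffel_riemannUp :
    (∀ c i j, ∑ k, jac φ x c k * christoffel Gt x k i j
      = ∑ d, (∑ a, jac φ x a i * christoffel G (φ x) c a d) * jac φ x d j
        + pd i (fun y => jac φ y c j) x) ∧
    ∀ i j, jac φ x * (Matrix.of fun l k => riemannUp Gt x i j k l)
      = (∑ a, ∑ b, (jac φ x a i * jac φ x b j) •
          Matrix.of fun l k => riemannUp G (φ x) a b k l) * jac φ x := by
  have hy := h.mapsTo x hx
  have hφ : ∀ᶠ y in 𝓝 x, φ y ∈ U := (h.source.mem_nhds hx).mono fun y => h.mapsTo y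
  set S := h.source.formal hx with hS
  set T := h.target.formal hy with hT
  let J : Matrix (Fin n) (Fin n) (SmoothGerm x) := Matrix.of fun a i => .mk _ (h.jac_smoothAt hx a i)
  have rJ : ∀ a i, Rep (J a i) (fun y => jac φ y a i) := fun a i => Rep.of _
  let Ji : Matrix (Fin n) (Fin n) (SmoothGerm x) := Matrix.of fun a i =>
    .mk _ (ContDiffAt.matrix_inv (h.jac_smoothAt hx) (h.det_jac_ne_zero hx) a i)
  have rJi : ∀ a i, Rep (Ji a i) (fun y => (jac φ y)⁻¹ a i) := fun a i => Rep.of _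
  -- The target metric, its connection and the derivatives of the latter are composed with φ, so all
  -- of them live in the germ ring at the source point x.
  let Gh : Matrix (Fin n) (Fin n) (SmoothGerm x) := Matrix.of fun a b =>
    .mk _ (h.comp_smoothAt hx (h.target.smoothAt hy a b))
  have rG : ∀ a b, Rep (Gh a b) (fun y => G (φ y) a b) := fun a b => Rep.of _
  let Γ : Fin n → Matrix (Fin n) (Fin n) (SmoothGerm x) := fun a => Matrix.of fun c b =>
    .mk _ (h.comp_smoothAt hx (h.target.rep_Γ hy a c b).smooth)
  have rΓ : ∀ a c b, Rep (Γ a c b) (fun y => christoffel G (φ y) c a b) := fun a c b => Rep.of _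
  let dΓ : Fin n → Fin n → Matrix (Fin n) (Fin n) (SmoothGerm x) := fun d a =>
    Matrix.of fun c b =>
      .mk _ (h.comp_smoothAt hx (ContDiffAt.pd_infty (h.target.rep_Γ hy a c b).smooth d))
  have rdΓ : ∀ d a c b, Rep (dΓ d a c b)
    (fun y => pd d (fun z => christoffel G z c a b) (φ y)) := fun d a c b => Rep.of _
  have hJJi : J * Ji = 1 := by
    ext i j
    have h1 : Rep ((1 : Matrix (Fin n) (Fin n) (SmoothGerm x)) i j)
        (fun _ => (1 : Matrix (Fin n) (Fin n) ℝ) i j) := by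
      simp only [one_apply]
      split_ifs
      · simpa only [map_one] using Rep.const (x := x) 1
      · simpa only [map_zero] using Rep.const (x := x) 0
    rw [mul_apply]
    refine (Rep.eq_iff (Rep.sum _ fun k => (rJ i k).mul (rJi k j)) h1).mpr ?_
    filter_upwards [h.source.mem_nhds hx] with y hy
    rw [← h.jac_mul_inv hy, mul_apply]
  have hSG : S.G = Jᵀ * Gh * J := by
    ext i j
    have r : Rep ((Jᵀ * Gh * J) i j) (fun y => ((jac φ y)ᵀ * G (φ y) * jac φ y) i j) := by
      simp only [mul_apply, transpose_apply]
      exact Rep.sum _ fun b => (Rep.sum _ fun a => (rJ a i).mul (rG a b)).mul (rJ b j)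
    refine ((h.source.rep_G hx i j).eq_iff r).mpr ?_
    filter_upwards [h.source.mem_nhds hx] with y hy
    rw [h.metric_eq y hy]
  have hJD : ∀ b j, J b j = S.D j (.mk _ (h.smoothAt hx b)) := fun b j =>
    ((rJ b j).eq_iff ((Rep.of (h.smoothAt hx b)).D j)).mpr EventuallyEq.rfl
  have hJsymm : ∀ i j b, S.D i (J b j) = S.D j (J b i) := fun i j b => by
    rw [hJD, hJD]
    exact S.D_comm i j (.mk _ (h.smoothAt hx b))
  have ht : ∀ i l k, Γ i l k = Γ k l i := by
    intro i l k
    refine ((rΓ i l k).eq_iff (rΓ k l i)).mpr ?_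
    filter_upwards [hφ] with y hy using h.target.christoffel_symm hy l i k
  have hc : ∀ i, dMat (S.D i) Gh = ∑ a, J a i • ((Γ a)ᵀ * Gh + Gh * Γ a) := by
    intro i
    ext p q
    rw [dMat_apply]
    refine (h.D_comp hx (h.target.smoothAt hy p q) i).trans ?_
    simp only [Matrix.sum_apply, Matrix.smul_apply, Matrix.add_apply, smul_eq_mul, mul_apply,
      transpose_apply]
    refine Finset.sum_congr rfl fun a _ => ?_
    congr 1
    refine ((Rep.of _).eq_iff ((Rep.sum _ fun b => (rΓ a b p).mul (rG b q)).add
      (Rep.sum _ fun b => (rG p b).mul (rΓ a b q)))).mpr ?_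
    filter_upwards [hφ] with y hy
    rw [h.target.pd_metric hy, Finset.sum_add_distrib]
    simp only [mul_comm]
  have hΓ : ∀ i a, dMat (S.D i) (Γ a) = ∑ b, J b i • dΓ b a := by
    intro i a
    ext p q
    rw [dMat_apply]
    refine (h.D_comp hx (h.target.rep_Γ hy a p q).smooth i).trans ?_
    simp only [Matrix.sum_apply, Matrix.smul_apply, smul_eq_mul]
    rfl
  have main := S.Γ_transform J Ji Gh Γ hJJi hSG hJsymm ht hc
  have main2 := curvature_transform S.D S.D_comm J S.Γ Γ dΓ hJsymm hΓ main
  constructor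
  · intro c i j
    have e := congrFun (congrFun (main i) c) j
    rw [Matrix.add_apply, mul_apply, mul_apply, dMat_apply] at e
    simp only [Matrix.sum_apply, Matrix.smul_apply, smul_eq_mul] at e
    exact (((Rep.sum _ fun k => (rJ c k).mul (h.source.rep_Γ hx i k j)).eq_iff
      ((Rep.sum _ fun d => (Rep.sum _ fun a => (rJ a i).mul (rΓ a c d)).mul (rJ d j)).add
        (h.source.rep_D hx (rJ c j) i))).mp e).self_of_nhds
  · intro i j
    ext c k
    have e := congrFun (congrFun (main2 i j) c) k
    rw [mul_apply, mul_apply] at e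
    simp only [Matrix.sum_apply, Matrix.smul_apply, smul_eq_mul, Matrix.add_apply,
      Matrix.sub_apply (dΓ _ _), Matrix.sub_apply (_ * _), mul_apply] at e
    rw [mul_apply, mul_apply]
    simp only [Matrix.sum_apply, Matrix.smul_apply, smul_eq_mul, Matrix.of_apply]
    have r1 := Rep.sum Finset.univ fun l => (rJ c l).mul (h.source.rep_R hx i j l k)
    have r2 := Rep.sum Finset.univ fun d => (Rep.sum Finset.univ fun a => Rep.sum Finset.univ
      fun b => ((rJ a i).mul (rJ b j)).mul (((rdΓ a b c d).sub (rdΓ b a c d)).add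
        ((Rep.sum Finset.univ fun m => (rΓ a c m).mul (rΓ b m d)).sub
          (Rep.sum Finset.univ fun m => (rΓ b c m).mul (rΓ a m d))))).mul (rJ d k)
    have := ((r1.eq_iff r2).mp e).self_of_nhds
    simp only [← Finset.sum_sub_distrib] at this
    exact this

/-- The transformation law of the Ricci tensor. -/
theorem ricci_eq :
    Matrix.of (ricci Gt x) = (jac φ x)ᵀ * Matrix.of (ricci G (φ x)) * jac φ x := by
  have hJ := h.jac_mul_inv hx
  have hJ' : (jac φ x)⁻¹ * jac φ x = 1 := mul_eq_one_comm.mp hJ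
  have hR := (h.christoffel_riemannUp hx).2
  set J := jac φ x
  have hR' : ∀ i j, (Matrix.of fun l k => riemannUp Gt x i j k l)
      = J⁻¹ * ((∑ a, ∑ b, (J a i * J b j) •
          Matrix.of fun l k => riemannUp G (φ x) a b k l) * J) := fun i j => by
    rw [← hR, ← mul_assoc, hJ', one_mul]
  ext j k
  have e : ∀ i, riemannUp Gt x i j k i
      = ∑ c, J⁻¹ i c * ∑ d, (∑ a, ∑ b, J a i * J b j * riemannUp G (φ x) a b d c) * J d k := by
    intro i
    have := congrFun (congrFun (hR' i j) i) k
    simpa only [mul_apply, Matrix.of_apply, Matrix.sum_apply, Matrix.smul_apply, smul_eq_mul]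
      using this
  have hδ : ∀ a c, ∑ i, J a i * J⁻¹ i c = if a = c then 1 else 0 := fun a c => by
    rw [← one_apply, ← hJ, mul_apply]
  simp only [Matrix.of_apply, ricci, e, mul_apply, transpose_apply]
  calc ∑ i, ∑ c, J⁻¹ i c * ∑ d, (∑ a, ∑ b, J a i * J b j * riemannUp G (φ x) a b d c) * J d k
      = ∑ d, ∑ b, ∑ a, ∑ c, (∑ i, J a i * J⁻¹ i c) * (J b j * riemannUp G (φ x) a b d c * J d k) := by
        simp only [Finset.mul_sum, Finset.sum_mul]
        rw [Finset.sum_congr rfl fun i _ => Finset.sum_comm, Finset.sum_comm]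
        refine Finset.sum_congr rfl fun d _ => ?_
        rw [Finset.sum_congr rfl fun i _ => Finset.sum_congr rfl fun c _ => Finset.sum_comm]
        rw [Finset.sum_congr rfl fun i _ => Finset.sum_comm, Finset.sum_comm]
        refine Finset.sum_congr rfl fun b _ => ?_
        rw [Finset.sum_congr rfl fun i _ => Finset.sum_comm, Finset.sum_comm]
        refine Finset.sum_congr rfl fun a _ => ?_
        rw [Finset.sum_comm]
        exact Finset.sum_congr rfl fun c _ => Finset.sum_congr rfl fun i _ => by ring
    _ = _ := by
        simp only [hδ, ite_mul, one_mul, zero_mul, Finset.sum_ite_eq, Finset.mem_univ, if_true,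
          Finset.mul_sum, Finset.sum_mul]

lemma ginv_eq : ginv Gt x = (jac φ x)⁻¹ * ginv G (φ x) * ((jac φ x)⁻¹)ᵀ := by
  rw [ginv, h.metric_eq x hx, Matrix.mul_inv_rev, Matrix.mul_inv_rev, transpose_nonsing_inv,
    ← mul_assoc, ginv]

theorem scalar_eq : scalar Gt x = scalar G (φ x) := by
  have hJ := h.jac_mul_inv hx
  rw [h.source.scalar_eq_trace hx, h.target.scalar_eq_trace (h.mapsTo x hx), h.ricci_eq hx,
    h.ginv_eq hx]
  have hJ' : (jac φ x)⁻¹ᵀ * (jac φ x)ᵀ = 1 := by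
    rw [← transpose_mul, hJ, transpose_one]
  have e : (jac φ x)⁻¹ * ginv G (φ x) * (jac φ x)⁻¹ᵀ *
      ((jac φ x)ᵀ * Matrix.of (ricci G (φ x)) * jac φ x)
      = (jac φ x)⁻¹ * (ginv G (φ x) * Matrix.of (ricci G (φ x)) * jac φ x) := by
    calc _ = (jac φ x)⁻¹ * ginv G (φ x) * ((jac φ x)⁻¹ᵀ * (jac φ x)ᵀ) *
          Matrix.of (ricci G (φ x)) * jac φ x := by simp only [mul_assoc]
      _ = _ := by rw [hJ', mul_one]; simp only [mul_assoc]
  rw [e, trace_mul_comm, mul_assoc, hJ, mul_one]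

/-- The transformation law of the traceless Ricci tensor. -/
theorem tracelessRicci_eq :
    Matrix.of (tracelessRicci Gt x)
      = (jac φ x)ᵀ * Matrix.of (tracelessRicci G (φ x)) * jac φ x := by
  have e : ∀ (G : Coord n → Matrix (Fin n) (Fin n) ℝ) (x : Coord n),
      Matrix.of (tracelessRicci G x) = Matrix.of (ricci G x) - (scalar G x / n) • G x :=
    fun G x => rfl
  rw [e, e, h.ricci_eq hx, h.scalar_eq hx, h.metric_eq x hx, mul_sub, sub_mul, Matrix.mul_smul,
    Matrix.smul_mul]

theorem schouten_eq :
    Matrix.of (schouten Gt x) = (jac φ x)ᵀ * Matrix.of (schouten G (φ x)) * jac φ x := by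
  have e : ∀ (G : Coord n → Matrix (Fin n) (Fin n) ℝ) (x : Coord n), Matrix.of (schouten G x)
      = (1 / ((n : ℝ) - 2)) • (Matrix.of (ricci G x)
        - (1 / (2 * ((n : ℝ) - 1)) * scalar G x) • G x) := fun G x => rfl
  rw [e, e, h.ricci_eq hx, h.scalar_eq hx, h.metric_eq x hx, Matrix.mul_smul, Matrix.smul_mul,
    Matrix.mul_sub, Matrix.sub_mul, Matrix.mul_smul, Matrix.smul_mul]

/-- The transformation law of the Weyl tensor. -/
theorem weyl_eq (i j k l : Fin n) :
    weyl Gt x i j k l = ∑ a, ∑ b, ∑ c, ∑ d,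
      jac φ x a i * jac φ x b j * jac φ x c k * jac φ x d l * weyl G (φ x) a b c d := by
  have hR := (h.christoffel_riemannUp hx).2 i j
  have pull : ∀ (A : Matrix (Fin n) (Fin n) ℝ) k l, ((jac φ x)ᵀ * A * jac φ x) k l
      = ∑ c, ∑ d, jac φ x c k * jac φ x d l * A c d := fun A k l => by
    simp only [mul_apply, transpose_apply, Finset.sum_mul]
    rw [Finset.sum_comm]
    exact Finset.sum_congr rfl fun d _ => Finset.sum_congr rfl fun c _ => by ring
  have hP : ∀ k l, schouten Gt x k l = ∑ c, ∑ d, jac φ x c k * jac φ x d l *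
      schouten G (φ x) c d := fun k l => by
    rw [← Matrix.of_apply (f := schouten Gt x), h.schouten_eq hx, pull]
    rfl
  have hG : ∀ k l, Gt x k l = ∑ c, ∑ d, jac φ x c k * jac φ x d l *
      G (φ x) c d := fun k l => by
    rw [h.metric_eq x hx, pull]
  have hRl : riemann Gt x i j k l = ∑ a, ∑ b, ∑ c, ∑ d,
      jac φ x a i * jac φ x b j * jac φ x c k * jac φ x d l * riemann G (φ x) a b c d := by
    have e1 : ∀ (G : Coord n → Matrix (Fin n) (Fin n) ℝ) (x : Coord n) i j k l,
        riemann G x i j k l = ((Matrix.of fun l k => riemannUp G x i j k l)ᵀ * G x) k l :=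
      fun G x i j k l => by simp [riemann, mul_apply]
    rw [e1, h.metric_eq x hx]
    have e2 : (Matrix.of fun l k => riemannUp Gt x i j k l)ᵀ * ((jac φ x)ᵀ * G (φ x) * jac φ x)
        = ∑ a, ∑ b, (jac φ x a i * jac φ x b j) • ((jac φ x)ᵀ *
          ((Matrix.of fun l k => riemannUp G (φ x) a b k l)ᵀ * G (φ x)) * jac φ x) := by
      rw [← mul_assoc, ← mul_assoc, ← transpose_mul, hR, transpose_mul, transpose_sum]
      simp only [transpose_sum, transpose_smul, Finset.mul_sum, Finset.sum_mul, Matrix.mul_smul,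
        Matrix.smul_mul, mul_assoc]
    rw [e2]
    simp only [Matrix.sum_apply, Matrix.smul_apply, smul_eq_mul]
    refine Finset.sum_congr rfl fun a _ => Finset.sum_congr rfl fun b _ => ?_
    rw [mul_apply, Finset.mul_sum, Finset.sum_comm]
    refine Finset.sum_congr rfl fun d _ => ?_
    rw [mul_apply, Finset.sum_mul, Finset.mul_sum]
    refine Finset.sum_congr rfl fun c _ => ?_
    rw [← e1, transpose_apply]
    ring
  simp only [weyl, kulkarniNomizu, mul_sub, mul_add, Finset.sum_sub_distrib,
    Finset.sum_add_distrib]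
  rw [← hRl, sum_mul_outer _ _ _ _ (fun a d => G (φ x) a d),
    sum_mul_cross _ _ _ _ (fun a d => G (φ x) a d)]
  have e1 := sum_mul_outer (fun a => jac φ x a i) (fun b => jac φ x b j) (fun c => jac φ x c k)
    (fun d => jac φ x d l) (fun a d => schouten G (φ x) a d) (fun b c => G (φ x) b c)
  have e2 := sum_mul_cross (fun a => jac φ x a i) (fun b => jac φ x b j) (fun c => jac φ x c k)
    (fun d => jac φ x d l) (fun a c => schouten G (φ x) a c) (fun b d => G (φ x) b d)
  simp only [mul_comm (schouten G (φ x) _ _) (G (φ x) _ _)] at e1 e2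
  rw [e1, e2, ← hG, ← hG, ← hG, ← hG, ← hP, ← hP, ← hP, ← hP]
  ring

/-- The transformation law of the covariant derivative of a vector field. -/
theorem nablaVec_eq {Vt V : Coord n → Coord n}
    (hVt : ∀ k, DifferentiableAt ℝ (fun y => Vt y k) x)
    (hV : ∀ k, DifferentiableAt ℝ (fun y => V y k) (φ x))
    (hVV : ∀ᶠ y in 𝓝 x, ∀ c, V (φ y) c = ∑ k, jac φ y c k * Vt y k) (i c : Fin n) :
    ∑ k, jac φ x c k * nablaVec Gt Vt x i k = ∑ a, jac φ x a i * nablaVec G V (φ x) a c := by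
  have hΓ := (h.christoffel_riemannUp hx).1
  have hJ : ∀ k, DifferentiableAt ℝ (fun y => jac φ y c k) x := fun k =>
    (h.jac_smoothAt hx c k).differentiableAt (by simp)
  have e1 : pd i (fun y => V (φ y) c) x = ∑ k, (jac φ x c k * pd i (fun y => Vt y k) x
      + Vt x k * pd i (fun y => jac φ y c k) x) := by
    rw [pd_congr (g := fun y => ∑ k, jac φ y c k * Vt y k) (hVV.mono fun y hy => hy c),
      pd_sum (f := fun k y => jac φ y c k * Vt y k) _ fun k _ => (hJ k).fun_mul (hVt k)]
    exact Finset.sum_congr rfl fun k _ => pd_mul (hJ k) (hVt k) i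
  have e2 : pd i (fun y => V (φ y) c) x
      = ∑ a, jac φ x a i * pd a (fun y => V y c) (φ x) :=
    pd_comp (hV c) ((h.map_smoothAt hx).differentiableAt (by simp)) i
  -- The inhomogeneous term in the Christoffel law is exactly the derivative of the Jacobian that
  -- the product rule produces in `e1`.
  have e3 : ∑ k, jac φ x c k * ∑ l, christoffel Gt x k i l * Vt x l
      = ∑ a, jac φ x a i * ∑ d, christoffel G (φ x) c a d * V (φ x) d
        + ∑ l, Vt x l * pd i (fun y => jac φ y c l) x := by
    have : ∑ k, jac φ x c k * ∑ l, christoffel Gt x k i l * Vt x l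
        = ∑ l, (∑ k, jac φ x c k * christoffel Gt x k i l) * Vt x l := by
      simp only [Finset.mul_sum, Finset.sum_mul]
      rw [Finset.sum_comm]
      exact Finset.sum_congr rfl fun k _ => Finset.sum_congr rfl fun l _ => by ring
    rw [this]
    simp only [hΓ, add_mul, Finset.sum_add_distrib]
    congr 1
    · simp only [hVV.self_of_nhds, Finset.mul_sum, Finset.sum_mul]
      rw [Finset.sum_comm, Finset.sum_congr rfl fun d _ => Finset.sum_comm, Finset.sum_comm]
      exact Finset.sum_congr rfl fun k _ => Finset.sum_congr rfl fun l _ =>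
        Finset.sum_congr rfl fun m _ => by ring
    · exact Finset.sum_congr rfl fun k _ => mul_comm _ _
  simp only [nablaVec, mul_add, Finset.sum_add_distrib, e3]
  rw [Finset.sum_add_distrib, e2] at e1
  linear_combination -e1

end IsPullbackOn

end ChangeOfCoordinates

end ConformalEinstein

namespace ConformalEinstein

open Matrix Filter

/-! ### Covariance of the conformal Ricci tensor and of the rank of the Weyl kernel. -/

section Covariance

variable {n : ℕ}

namespace IsPullbackOn

variable {φ : Coord n → Coord n} {Gt G : Coord n → Matrix (Fin n) (Fin n) ℝ}
  {Ut U : Set (Coord n)} (h : IsPullbackOn φ Gt G Ut U) {x : Coord n} (hx : x ∈ Ut)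

include h hx

/-- The transformation law of the conformal Ricci tensor of a vector field. -/
theorem localConformalRicci_eq {Vt V : Coord n → Coord n}
    (hVt : ∀ k, DifferentiableAt ℝ (fun y => Vt y k) x)
    (hV : ∀ k, DifferentiableAt ℝ (fun y => V y k) (φ x))
    (hVV : ∀ᶠ y in 𝓝 x, ∀ c, V (φ y) c = ∑ k, jac φ y c k * Vt y k) :
    Matrix.of (localConformalRicci Gt Vt x)
      = (jac φ x)ᵀ * Matrix.of (localConformalRicci G V (φ x)) * jac φ x := by
  have e : ∀ (G : Coord n → Matrix (Fin n) (Fin n) ℝ) (V : Coord n → Coord n) (x : Coord n),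
      Matrix.of (localConformalRicci G V x) = Matrix.of (tracelessRicci G x) + ((n : ℝ) - 2) •
        (Matrix.of (nablaVec G V x) * G x + vecMulVec (flat G V x) (flat G V x)
          - (1 / (n : ℝ) * (divVec G V x + normSqVec G V x)) • G x) := fun G V x => by
    ext i j
    simp [localConformalRicci, mul_apply, vecMulVec_apply]
  have hJ := h.jac_mul_inv hx
  have hG := h.metric_eq x hx
  have hN : Matrix.of (nablaVec Gt Vt x) * (jac φ x)ᵀ
      = (jac φ x)ᵀ * Matrix.of (nablaVec G V (φ x)) := by
    ext i c
    have := h.nablaVec_eq hx hVt hV hVV i c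
    simp only [mul_apply, transpose_apply, Matrix.of_apply]
    rw [← this]
    exact Finset.sum_congr rfl fun _ _ => mul_comm _ _
  have hNG : Matrix.of (nablaVec Gt Vt x) * Gt x
      = (jac φ x)ᵀ * (Matrix.of (nablaVec G V (φ x)) * G (φ x)) * jac φ x := by
    rw [hG, ← mul_assoc, ← mul_assoc, hN]
    simp only [mul_assoc]
  have hJV : (fun c => V (φ x) c) = jac φ x *ᵥ (fun k => Vt x k) := by
    funext c
    exact hVV.self_of_nhds c
  have hfl : ∀ (G : Coord n → Matrix (Fin n) (Fin n) ℝ) (V : Coord n → Coord n) (x : Coord n),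
      flat G V x = (fun k => V x k) ᵥ* G x := fun G V x => rfl
  have hflat : flat Gt Vt x = flat G V (φ x) ᵥ* jac φ x := by
    rw [hfl, hfl, hJV, hG, ← vecMul_vecMul, ← vecMul_vecMul, vecMul_transpose]
  have hdiv : divVec Gt Vt x = divVec G V (φ x) := by
    have d : ∀ (G : Coord n → Matrix (Fin n) (Fin n) ℝ) (V : Coord n → Coord n) (x : Coord n),
        divVec G V x = (Matrix.of (nablaVec G V x)).trace := fun G V x => rfl
    have hJ' : (jac φ x)ᵀ * (jac φ x)⁻¹ᵀ = 1 := by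
      rw [← transpose_mul, mul_eq_one_comm.mp hJ, transpose_one]
    have : Matrix.of (nablaVec Gt Vt x)
        = (jac φ x)ᵀ * (Matrix.of (nablaVec G V (φ x)) * (jac φ x)⁻¹ᵀ) := by
      rw [← mul_assoc, ← hN, mul_assoc, hJ', mul_one]
    rw [d, d, this, trace_mul_comm, mul_assoc, mul_eq_one_comm.mp hJ', mul_one]
  have hns : ∀ {G : Coord n → Matrix (Fin n) (Fin n) ℝ} {V : Coord n → Coord n} {x : Coord n}
      {U : Set (Coord n)}, IsMetricOn G U → x ∈ U → normSqVec G V x = flat G V x ⬝ᵥ fun k => V x k := by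
    intro G V x U hG hx
    simp only [normSqVec, flat, dotProduct, Finset.sum_mul]
    exact Finset.sum_congr rfl fun i _ => Finset.sum_congr rfl fun j _ => by
      rw [hG.symm hx]; ring
  have hnorm : normSqVec Gt Vt x = normSqVec G V (φ x) := by
    rw [hns h.source hx, hns h.target (h.mapsTo x hx), hflat, hJV, dotProduct_mulVec]
  have hvv : vecMulVec (flat Gt Vt x) (flat Gt Vt x)
      = (jac φ x)ᵀ * vecMulVec (flat G V (φ x)) (flat G V (φ x)) * jac φ x := by
    rw [hflat, mul_vecMulVec, vecMulVec_mul, mulVec_transpose]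
  rw [e, e, h.tracelessRicci_eq hx, hNG, hvv, hdiv, hnorm, hG]
  simp only [mul_add, add_mul, Matrix.mul_sub, Matrix.sub_mul, Matrix.mul_smul, Matrix.smul_mul]

lemma eq_zero_of_sum_jac {Z : Fin n → ℝ} (hZ : ∀ j, ∑ b, jac φ x b j * Z b = 0) (b : Fin n) :
    Z b = 0 := by
  have h1 : Z ᵥ* jac φ x = 0 := by
    funext j
    rw [vecMul, dotProduct, Pi.zero_apply, ← hZ j]
    exact Finset.sum_congr rfl fun _ _ => mul_comm _ _
  have h2 : Z = 0 := by
    rw [← vecMul_one Z, ← h.jac_mul_inv hx, ← vecMul_vecMul, h1, zero_vecMul]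
  rw [h2]; rfl

/-- The dimension of the kernel of the Weyl tensor does not depend on the coordinates. -/
theorem finrank_localWeylKernel_eq :
    Module.finrank ℝ (localWeylKernel Gt x) = Module.finrank ℝ (localWeylKernel G (φ x)) := by
  set J := jac φ x with hJdef
  have hJ := h.jac_mul_inv hx
  let L : Coord n →ₗ[ℝ] Coord n := Matrix.toEuclideanLin J
  have hL : ∀ v a, L v a = ∑ i, J a i * v i := fun v a => by
    simp [L, Matrix.toLpLin_apply, mulVec, dotProduct]
  have hinj : Function.Injective L := by
    refine (injective_iff_map_eq_zero L).mpr fun v hv => ?_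
    ext a
    have h1 : J *ᵥ (fun i => v i) = 0 := by
      funext a
      have := hL v a
      rw [hv] at this
      exact this.symm
    have h2 : (fun i => v i) = 0 := by
      rw [← one_mulVec (fun i => v i), ← mul_eq_one_comm.mp hJ, ← mulVec_mulVec, h1, mulVec_zero]
    exact congrFun h2 a
  let e : Coord n ≃ₗ[ℝ] Coord n := LinearEquiv.ofInjectiveEndo L hinj
  have he : ∀ v, e v = L v := fun v => rfl
  have hmem : ∀ v, v ∈ localWeylKernel Gt x ↔ e v ∈ localWeylKernel G (φ x) := by
    intro v
    have key : ∀ j k l, ∑ i, v i * weyl Gt x i j k l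
        = ∑ b, J b j * ∑ c, J c k * ∑ d, J d l * ∑ a, e v a * weyl G (φ x) a b c d := by
      intro j k l
      calc ∑ i, v i * weyl Gt x i j k l = ∑ a, ∑ b, ∑ c, ∑ d,
            e v a * (J b j * J c k * J d l * weyl G (φ x) a b c d) := by
            simp only [h.weyl_eq hx, he, hL, Finset.mul_sum, Finset.sum_mul]
            rw [Finset.sum_comm]
            refine Finset.sum_congr rfl fun a _ => ?_
            rw [Finset.sum_comm]
            refine Finset.sum_congr rfl fun b _ => ?_
            rw [Finset.sum_comm]
            refine Finset.sum_congr rfl fun c _ => ?_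
            rw [Finset.sum_comm]
            exact Finset.sum_congr rfl fun d _ => Finset.sum_congr rfl fun i _ => by ring
        _ = _ := by
            simp only [Finset.mul_sum]
            rw [Finset.sum_comm]
            refine Finset.sum_congr rfl fun b _ => ?_
            rw [Finset.sum_comm]
            refine Finset.sum_congr rfl fun c _ => ?_
            rw [Finset.sum_comm]
            exact Finset.sum_congr rfl fun d _ => Finset.sum_congr rfl fun i _ => by ring
    constructor
    · intro hv b c d
      -- In this direction the three remaining Jacobian factors are stripped off one index at a
      -- time.
      refine h.eq_zero_of_sum_jac hx (Z := fun d => ∑ a, e v a * weyl G (φ x) a b c d) (fun l => ?_) d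
      refine h.eq_zero_of_sum_jac hx (Z := fun c => ∑ d, J d l * ∑ a, e v a * weyl G (φ x) a b c d) (fun k => ?_) c
      refine h.eq_zero_of_sum_jac hx (Z := fun b => ∑ c, J c k * ∑ d, J d l *
        ∑ a, e v a * weyl G (φ x) a b c d) (fun j => ?_) b
      rw [← hv j k l, key]
    · intro hv j k l
      have hv' : ∀ b c d, ∑ a, e v a * weyl G (φ x) a b c d = 0 := hv
      rw [key]
      simp only [hv', mul_zero, Finset.sum_const_zero]
  have : localWeylKernel Gt x = (localWeylKernel G (φ x)).comap (e : Coord n →ₗ[ℝ] Coord n) := by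
    ext v
    exact hmem v
  rw [this, Submodule.comap_equiv_eq_map_symm]
  exact LinearEquiv.finrank_map_eq _ _

end IsPullbackOn

end Covariance

/-! ### The Weyl endomorphism -/

section WeylEndomorphism

variable {n : ℕ} (G : Coord n → Matrix (Fin n) (Fin n) ℝ) {U : Set (Coord n)} {x : Coord n}

lemma weylOp_sum (c : Fin n → ℝ) (B : Fin n → Fin n → Fin n → ℝ) (k l : Fin n) :
    weylOp G x (fun p q => ∑ s, c s * B s p q) k l = ∑ s, c s * weylOp G x (B s) k l := by
  simp only [weylOp, Finset.mul_sum, Finset.sum_mul]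
  symm
  rw [Finset.sum_comm]
  refine Finset.sum_congr rfl fun i _ => ?_
  rw [Finset.sum_comm]
  refine Finset.sum_congr rfl fun j _ => ?_
  rw [Finset.sum_comm]
  refine Finset.sum_congr rfl fun a _ => ?_
  rw [Finset.sum_comm]
  exact Finset.sum_congr rfl fun d _ => Finset.sum_congr rfl fun i _ => by ring

lemma weylOp_mul (r : ℝ) (B : Fin n → Fin n → ℝ) (k l : Fin n) :
    weylOp G x (fun p q => r * B p q) k l = r * weylOp G x B k l := by
  simp only [weylOp, Finset.mul_sum, Finset.sum_mul]
  exact Finset.sum_congr rfl fun _ _ => Finset.sum_congr rfl fun _ _ => Finset.sum_congr rfl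
    fun _ _ => Finset.sum_congr rfl fun _ _ => by ring

lemma sum_rotate {ι B : Type*} [Fintype ι] [AddCommMonoid B] (f : ι → ι → ι → B) :
    ∑ a, ∑ b, ∑ c, f a b c = ∑ c, ∑ a, ∑ b, f a b c := by
  rw [Finset.sum_congr rfl fun a _ => Finset.sum_comm, Finset.sum_comm]

lemma sum_comm₃₃ {ι B : Type*} [Fintype ι] [AddCommMonoid B] (f : ι → ι → ι → ι → ι → ι → B) :
    ∑ a, ∑ b, ∑ c, ∑ p, ∑ q, ∑ r, f a b c p q r
      = ∑ p, ∑ q, ∑ r, ∑ a, ∑ b, ∑ c, f a b c p q r := by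
  have h := Finset.sum_comm (s := (Finset.univ : Finset (ι × ι × ι)))
    (t := (Finset.univ : Finset (ι × ι × ι)))
    (f := fun u v => f u.1 u.2.1 u.2.2 v.1 v.2.1 v.2.2)
  simpa only [Fintype.sum_prod_type] using h

namespace IsMetricOn

variable {G} (h : IsMetricOn G U) (hx : x ∈ U)

include h hx

/-- On dx^i ∧ v the operator 𝒲 antisymmetrises the outer slots of W, and by the first Bianchi
identity this is contraction of W in its last two slots with the raised covectors. -/
lemma sum_mul_weylOp_wedge (v : Fin n → ℝ) (i p q : Fin n) :
    ∑ l, v l * weylOp G x (wedge i l) p q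
      = ∑ s, ginv G x i s * ∑ m, weyl G x p q s m * ∑ l, ginv G x m l * v l := by
  have hw : ∀ l, weylOp G x (wedge i l) p q = ∑ i', ∑ j,
      (ginv G x i' i * ginv G x j l - ginv G x i' l * ginv G x j i) * weyl G x j p q i' := by
    intro l
    simp only [weylOp, wedge, mul_sub, Finset.sum_sub_distrib]
    simp
  have hW : ∀ s m, weyl G x p q s m = weyl G x m p q s - weyl G x s p q m := by
    intro s m
    have h1 := h.weyl_bianchi hx m p q s
    have h2 := h.weyl_pair_symm hx s p q m
    have h3 := h.weyl_antisymm_right hx q m s p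
    have h4 := h.weyl_antisymm_right hx p q s m
    linarith
  simp only [hw, hW, sub_mul, mul_sub, Finset.sum_sub_distrib, Finset.mul_sum]
  have hg := h.ginv_symm hx
  congr 1
  · rw [Finset.sum_comm]
    refine Finset.sum_congr rfl fun s _ => ?_
    rw [Finset.sum_comm]
    refine Finset.sum_congr rfl fun m _ => Finset.sum_congr rfl fun l _ => ?_
    rw [hg i s]; ring
  · rw [Finset.sum_comm, Finset.sum_congr rfl fun s _ => Finset.sum_comm, Finset.sum_comm]
    refine Finset.sum_congr rfl fun s _ => Finset.sum_congr rfl fun m _ =>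
      Finset.sum_congr rfl fun l _ => ?_
    rw [hg i s]; ring

/-- The value of the Weyl endomorphism in terms of the contraction of the Weyl tensor with a
vector. -/
lemma weylSq_mulVec (v : Fin n → ℝ) (k : Fin n) :
    (weylSq G x *ᵥ v) k = ∑ i, weylOp G x (fun p q => ∑ s, ginv G x i s *
      ∑ m, weyl G x p q s m * ∑ l, ginv G x m l * v l) i k := by
  simp only [← h.sum_mul_weylOp_wedge hx v, weylOp_sum, weylSq, mulVec, dotProduct,
    Matrix.of_apply, Finset.sum_mul]
  rw [Finset.sum_comm]
  exact Finset.sum_congr rfl fun i _ => Finset.sum_congr rfl fun l _ => mul_comm _ _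

/-- If the divergence of the Weyl tensor is a multiple of its contraction with `V` then the
contraction of the divergence is the same multiple of the Weyl endomorphism at `V`. -/
lemma weylDivCovector_eq {r : ℝ} {v V : Fin n → ℝ} (hV : ∀ m, V m = ∑ l, ginv G x m l * v l)
    (hdiv : ∀ i j k, divWeyl G x i j k = r * ∑ l, weyl G x i j k l * V l) :
    weylDivCovector G x = r • (weylSq G x *ᵥ v) := by
  funext k
  simp only [weylDivCovector, Pi.smul_apply, smul_eq_mul, h.weylSq_mulVec hx v, ← hV, ← weylOp_sum]
  rw [Finset.mul_sum]
  refine Finset.sum_congr rfl fun a _ => ?_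
  rw [← weylOp_mul]
  congr 1
  funext p q
  simp only [hdiv, Finset.mul_sum]
  exact Finset.sum_congr rfl fun _ _ => Finset.sum_congr rfl fun _ _ => by ring

/-- The threefold Kronecker product of g⁻¹ is positive definite, so it is a norm on three-index
tensors. -/
lemma quadratic_eq_zero {T : Fin n → Fin n → Fin n → ℝ}
    (hT : ∑ a, ∑ c, ∑ s, ∑ a', ∑ c', ∑ s', ginv G x a a' * ginv G x c c' * ginv G x s s' *
      (T a c s * T a' c' s') = 0) (a c s : Fin n) : T a c s = 0 := by
  have hp := (h.ginv_posDef hx).kronecker ((h.ginv_posDef hx).kronecker (h.ginv_posDef hx))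
  by_contra hne
  have hlt := hp.dotProduct_mulVec_pos (x := fun p : Fin n × Fin n × Fin n => T p.1 p.2.1 p.2.2)
    (fun h0 => hne (congrFun h0 (a, c, s)))
  refine hlt.ne' ?_
  rw [← hT]
  simp only [dotProduct, mulVec, Fintype.sum_prod_type, kroneckerMap_apply, Pi.star_apply,
    star_trivial, Finset.mul_sum]
  exact Finset.sum_congr rfl fun _ _ => Finset.sum_congr rfl fun _ _ => Finset.sum_congr rfl
    fun _ _ => Finset.sum_congr rfl fun _ _ => Finset.sum_congr rfl fun _ _ =>
    Finset.sum_congr rfl fun _ _ => by ring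

/-- The kernel of the Weyl endomorphism is dual to the kernel of the Weyl tensor. -/
theorem mem_localWeylKernel_of_weylSq_mulVec {v : Fin n → ℝ} (hv : weylSq G x *ᵥ v = 0) :
    (WithLp.toLp 2 fun k => ∑ l, ginv G x k l * v l : Coord n) ∈ localWeylKernel G x := by
  have hg := h.ginv_symm hx
  set V : Fin n → ℝ := fun k => ∑ l, ginv G x k l * v l with hV
  set T : Fin n → Fin n → Fin n → ℝ := fun a c s => ∑ m, weyl G x a c s m * V m with hT
  -- T is W(·,·,·,V). The first Bianchi identity makes its three cyclic rotations sum to zero, so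
  -- |T|² is minus the sum of the pairings of T with its two rotations. It remains to see that these
  -- pairings vanish.
  have hcyc : ∀ a c s, T a c s + T c s a + T s a c = 0 := by
    intro a c s
    simp only [hT, ← Finset.sum_add_distrib, ← add_mul, h.weyl_bianchi hx, zero_mul,
      Finset.sum_const_zero]
  -- Pairing 𝔴(v) = 0 with V gives, up to sign, the inner product of T with one of its rotations.
  have h0 : ∑ a, ∑ c, ∑ s, ∑ a', ∑ c', ∑ s', ginv G x a a' * ginv G x c c' * ginv G x s s' *
      (T a c s * T c' s' a') = 0 := by
    have hTn : ∀ j i i', T j i i' = -∑ k, V k * weyl G x j i k i' := fun j i i' => by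
      simp only [hT, ← Finset.sum_neg_distrib]
      exact Finset.sum_congr rfl fun m _ => by rw [h.weyl_antisymm_right hx]; ring
    have h1 : ∑ k, V k * (weylSq G x *ᵥ v) k = 0 := by simp [hv]
    have h2 : ∑ k, V k * (weylSq G x *ᵥ v) k = -∑ i, ∑ i', ∑ j,
        (∑ a, ∑ c, ∑ s, ginv G x i' a * ginv G x j c * (ginv G x i s * T a c s)) * T j i i' := by
      simp only [h.weylSq_mulVec hx v, weylOp]
      rw [Finset.sum_congr rfl fun i _ => Finset.sum_congr rfl fun i' _ => Finset.sum_congr rfl fun j _ => congrArg _ (hTn j i i')]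
      rw [← Finset.sum_neg_distrib, Finset.sum_congr rfl fun k _ => Finset.mul_sum _ _ _,
        Finset.sum_comm]
      refine Finset.sum_congr rfl fun i _ => ?_
      rw [← Finset.sum_neg_distrib, Finset.sum_congr rfl fun k _ => Finset.mul_sum _ _ _,
        Finset.sum_comm]
      refine Finset.sum_congr rfl fun i' _ => ?_
      rw [← Finset.sum_neg_distrib, Finset.sum_congr rfl fun k _ => Finset.mul_sum _ _ _,
        Finset.sum_comm]
      refine Finset.sum_congr rfl fun j _ => ?_
      rw [mul_neg, neg_neg, Finset.mul_sum]
      refine Finset.sum_congr rfl fun k _ => ?_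
      have hfold : (∑ a, ∑ c, ginv G x i' a * ginv G x j c * ∑ s, ginv G x i s * T a c s) =
          ∑ a, ∑ c, ∑ s, ginv G x i' a * ginv G x j c * (ginv G x i s * T a c s) := by
        simp only [Finset.mul_sum]
      rw [← hfold]
      ring
    rw [h2, neg_eq_zero] at h1
    rw [← h1, sum_comm₃₃, sum_rotate]
    refine Finset.sum_congr rfl fun i' _ => Finset.sum_congr rfl fun j _ =>
      Finset.sum_congr rfl fun i _ => ?_
    simp only [Finset.sum_mul]
    refine Finset.sum_congr rfl fun a _ => Finset.sum_congr rfl fun c _ =>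
      Finset.sum_congr rfl fun s _ => ?_
    rw [hg a j, hg c i, hg s i']
    ring
  -- The other rotation gives the same number, by exchanging the two factors and renaming indices.
  have h0' : ∑ a, ∑ c, ∑ s, ∑ a', ∑ c', ∑ s', ginv G x a a' * ginv G x c c' * ginv G x s s' *
      (T a c s * T s' a' c') = 0 := by
    rw [← h0, sum_comm₃₃, sum_rotate]
    refine Finset.sum_congr rfl fun a _ => Finset.sum_congr rfl fun c _ =>
      Finset.sum_congr rfl fun s _ => ?_
    rw [sum_rotate]
    refine Finset.sum_congr rfl fun a' _ => Finset.sum_congr rfl fun c' _ =>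
      Finset.sum_congr rfl fun s' _ => ?_
    rw [hg a a', hg c c', hg s s']
    ring
  have hzero : ∀ a c s, T a c s = 0 := by
    apply h.quadratic_eq_zero hx
    have e : ∀ a c s, T a c s = -T c s a - T s a c := fun a c s => by linarith [hcyc a c s]
    rw [← neg_zero, ← h0, ← sub_zero (-_), ← h0']
    simp only [← Finset.sum_neg_distrib, ← Finset.sum_sub_distrib]
    refine Finset.sum_congr rfl fun _ _ => Finset.sum_congr rfl fun _ _ => Finset.sum_congr rfl
      fun _ _ => Finset.sum_congr rfl fun a' _ => Finset.sum_congr rfl fun c' _ =>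
      Finset.sum_congr rfl fun s' _ => ?_
    rw [e a' c' s']
    ring
  intro j k l
  have := hzero k l j
  rw [← neg_eq_zero, ← this, hT]
  simp only [← Finset.sum_neg_distrib]
  refine Finset.sum_congr rfl fun m _ => ?_
  rw [h.weyl_pair_symm hx m j k l, h.weyl_antisymm_right hx k l j m]
  simp only [hV]
  ring

/-- If the kernel of the Weyl tensor is trivial and the divergence of the Weyl tensor is `n - 3`
times its contraction with `V` then `V` is the canonical vector field. -/
theorem canonicalCovector_eq (hn : 4 ≤ n) (hker : Module.finrank ℝ (localWeylKernel G x) = 0)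
    {v V : Fin n → ℝ} (hV : ∀ m, V m = ∑ l, ginv G x m l * v l)
    (hdiv : ∀ i j k, divWeyl G x i j k = ((n : ℝ) - 3) * ∑ l, weyl G x i j k l * V l) :
    canonicalCovector G x = v := by
  have hn' : (4 : ℝ) ≤ n := by exact_mod_cast hn
  have hbot : localWeylKernel G x = ⊥ := Submodule.finrank_eq_zero.mp hker
  have hinj : Function.Injective (weylSq G x).mulVec := by
    refine (injective_iff_map_eq_zero (Matrix.mulVecLin (weylSq G x))).mpr fun w hw => ?_
    have h1 := h.mem_localWeylKernel_of_weylSq_mulVec hx (v := w) hw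
    rw [hbot, Submodule.mem_bot] at h1
    have h2 : ginv G x *ᵥ w = 0 := by
      funext k
      exact congrArg (fun z : Coord n => z k) h1
    rw [← one_mulVec w, ← h.mul_ginv hx, ← mulVec_mulVec, h2, mulVec_zero]
  have hunit : IsUnit (weylSq G x) := Matrix.mulVec_injective_iff_isUnit.mp hinj
  have hmul : weylSq G x * (weylSq G x)⁻¹ = 1 :=
    Matrix.mul_nonsing_inv _ ((Matrix.isUnit_iff_isUnit_det _).mp hunit)
  have hmul' := mul_eq_one_comm.mp hmul
  have hgs : (ginv G x).IsSymm := by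
    ext i j; exact h.ginv_symm hx j i
  -- The inner product on covectors has Gram matrix g⁻¹. For an invertible endomorphism both
  -- products are the identity, so the symmetry conditions reduce to symmetry of g⁻¹.
  have hMP : IsMoorePenrose (ginv G x) (weylSq G x) (weylSq G x)⁻¹ :=
    ⟨by rw [hmul, one_mul], by rw [hmul', one_mul], by rw [hmul, mul_one]; exact hgs,
      by rw [hmul', mul_one]; exact hgs⟩
  have hex : ∃ B, IsMoorePenrose (ginv G x) (weylSq G x) B := ⟨_, hMP⟩
  -- Whichever Moore-Penrose inverse is chosen, A B A = A alone forces B = A⁻¹ when A is invertible.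
  have hB : moorePenrose (ginv G x) (weylSq G x) = (weylSq G x)⁻¹ := by
    rw [moorePenrose, dif_pos hex]
    have hc := hex.choose_spec.mul_mul_left
    calc hex.choose = (weylSq G x)⁻¹ * (weylSq G x * hex.choose * weylSq G x) * (weylSq G x)⁻¹ := by
          rw [mul_assoc, mul_assoc, mul_assoc, hmul, mul_one, ← mul_assoc, hmul', one_mul]
      _ = _ := by rw [hc, hmul', one_mul]
  funext k
  rw [canonicalCovector, hB, h.weylDivCovector_eq hx hV hdiv, mulVec_smul, mulVec_mulVec, hmul',
    one_mulVec, Pi.smul_apply, smul_eq_mul]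
  have : (n : ℝ) - 3 ≠ 0 := by intro hh; linarith
  field_simp

end IsMetricOn

end WeylEndomorphism

end ConformalEinstein

namespace ConformalEinstein
open Matrix Filter

/-! ### Smoothness of C² solutions of E_V = 0. -/

section Regularity

variable {n : ℕ} {U : Set (Coord n)}

lemma contDiffOn_pd {f : Coord n → ℝ} {m k : WithTop ℕ∞} (hU : IsOpen U) (hf : ContDiffOn ℝ m f U)
    (hk : k + 1 ≤ m) (i : Fin n) : ContDiffOn ℝ k (pd i f) U := fun _ hy =>
  (ContDiffAt.pd (hf.contDiffAt (hU.mem_nhds hy)) hk i).contDiffWithinAt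

/-- A differentiable function with `C^m` partial derivatives is `C^{m+1}`. -/
lemma contDiffOn_succ_of_pd {f : Coord n → ℝ} {m : ℕ} (hU : IsOpen U)
    (hf : DifferentiableOn ℝ f U) (h : ∀ i, ContDiffOn ℝ m (pd i f) U) :
    ContDiffOn ℝ (m + 1 : ℕ) f U := by
  push_cast
  rw [contDiffOn_succ_iff_fderiv_of_isOpen hU]
  refine ⟨hf, by simp, ?_⟩
  have e : fderiv ℝ f = fun y => ∑ k, pd k f y • (EuclideanSpace.proj k : Coord n →L[ℝ] ℝ) := by
    funext y
    ext v
    rw [fderiv_eq_sum_pd]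
    simp [mul_comm]
  rw [e]
  exact ContDiffOn.sum fun k _ => (h k).smul contDiffOn_const

/-- Regularity for the overdetermined system `∂_i v_j = Γ^a_{ij} v_a - v_i v_j + ρ_{ij} +
μ g_{ij}`: all solutions are smooth. -/
theorem contDiffOn_infty_of_overdetermined {G : Coord n → Matrix (Fin n) (Fin n) ℝ}
    (hG : IsMetricOn G U) (hn : 2 ≤ n) {Γ : Fin n → Fin n → Fin n → Coord n → ℝ}
    {ρ : Fin n → Fin n → Coord n → ℝ} {v : Fin n → Coord n → ℝ} {μ : Coord n → ℝ}
    (hΓ : ∀ a i j, ContDiffOn ℝ ∞ (Γ a i j) U) (hρ : ∀ i j, ContDiffOn ℝ ∞ (ρ i j) U)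
    (hv : ∀ i, ContDiffOn ℝ 2 (v i) U) (hμ : ContDiffOn ℝ 1 μ U)
    (heq : ∀ y ∈ U, ∀ i j, pd i (v j) y =
      (∑ a, Γ a i j y * v a y) - v i y * v j y + ρ i j y + μ y * G y i j) (i : Fin n) :
    ContDiffOn ℝ ∞ (v i) U := by
  have hU := hG.isOpen
  have hn' : (n : ℝ) - 1 ≠ 0 := by
    have : (2 : ℝ) ≤ n := by exact_mod_cast hn
    intro h; linarith
  have hginv : ∀ i j, ContDiffOn ℝ ∞ (fun y => ginv G y i j) U := fun i j y hy =>
    (hG.ginv_smoothAt hy i j).contDiffWithinAt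
  set Q : Fin n → Fin n → Coord n → ℝ := fun i j y =>
    (∑ a, Γ a i j y * v a y) - v i y * v j y + ρ i j y with hQ
  have hQs : ∀ {k : ℕ}, (∀ i, ContDiffOn ℝ k (v i) U) → ∀ i j, ContDiffOn ℝ k (Q i j) U := by
    intro k hk i j
    have hle : (k : WithTop ℕ∞) ≤ ∞ := by exact_mod_cast le_top
    exact (((ContDiffOn.sum fun a _ => ((hΓ a i j).of_le hle).mul (hk a)).sub
      ((hk i).mul (hk j)))).add ((hρ i j).of_le hle)
  have hQ1 := hQs (k := 2) (by exact_mod_cast hv)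
  -- Equality of ∂_k ∂_i v_j and ∂_i ∂_k v_j gives ∂_kμ g_ij - ∂_iμ g_kj in terms of first
  -- derivatives of Q and g and of μ itself. Contracting with g^{ij} gives (n - 1) ∂_kμ, so dμ
  -- involves no derivative of μ. This is where v must be C² and n ≥ 2.
  have hdμ : ∀ y ∈ U, ∀ k, pd k μ y = ((n : ℝ) - 1)⁻¹ * ∑ i, ∑ j, ginv G y i j *
      (pd i (Q k j) y - pd k (Q i j) y +
        μ y * (pd i (fun z => G z k j) y - pd k (fun z => G z i j) y)) := by
    intro y hy k
    have hev := hG.mem_nhds hy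
    have hdiff : ∀ {f : Coord n → ℝ} {m : WithTop ℕ∞}, ContDiffOn ℝ m f U → 1 ≤ m →
        DifferentiableAt ℝ f y := fun hf hm =>
      (hf.contDiffAt (hU.mem_nhds hy)).differentiableAt (by
        intro h0; rw [h0] at hm; simp at hm)
    have hpd : ∀ a b c, pd a (pd b (v c)) y = pd a (Q b c) y + (μ y * pd a (fun z => G z b c) y
        + G y b c * pd a μ y) := by
      intro a b c
      have h1 : pd b (v c) =ᶠ[𝓝 y] fun z => Q b c z + μ z * G z b c := by
        filter_upwards [hev] with z hz using heq z hz b c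
      have dG := (hG.smoothAt hy b c).differentiableAt (by simp)
      have dμ := hdiff hμ le_rfl
      rw [pd_congr h1, pd_add (hdiff (hQ1 b c) (by norm_num)) (dμ.fun_mul dG),
        pd_mul dμ dG]
    have hΨ : ∀ i j, pd i (Q k j) y - pd k (Q i j) y +
        μ y * (pd i (fun z => G z k j) y - pd k (fun z => G z i j) y) =
        pd k μ y * G y i j - pd i μ y * G y k j := by
      intro i j
      have := pd_comm ((hv j).contDiffAt (hU.mem_nhds hy)) k i
      rw [hpd, hpd] at this
      linarith
    have s1 : ∑ i, ∑ j, ginv G y i j * (pd k μ y * G y i j) = n * pd k μ y := by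
      have : ∀ i, ∑ j, ginv G y i j * (pd k μ y * G y i j) = pd k μ y := by
        intro i
        have := hG.sum_ginv_G hy (fun s => if s = i then pd k μ y else 0) i
        simpa using this
      simp [this]
    have s2 : ∑ i, ∑ j, ginv G y i j * (pd i μ y * G y k j) = pd k μ y := by
      have := hG.sum_G_ginv hy (fun s => pd s μ y) k
      rw [← this, Finset.sum_comm]
      simp only [Finset.sum_mul]
      refine Finset.sum_congr rfl fun j _ => Finset.sum_congr rfl fun i _ => ?_
      rw [hG.ginv_symm hy i j, hG.symm hy k j]
      ring
    simp only [hΨ]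
    simp only [mul_sub, Finset.sum_sub_distrib]
    rw [s1, s2]
    field_simp
  -- Bootstrap: v in C^{m+2} and μ in C^{m+1} make dμ of class C^{m+1}, so μ is C^{m+2}; then dv is
  -- C^{m+2} and v is C^{m+3}.
  have key : ∀ m : ℕ, (∀ i, ContDiffOn ℝ (m + 2 : ℕ) (v i) U) ∧ ContDiffOn ℝ (m + 1 : ℕ) μ U := by
    intro m
    induction m with
    | zero => exact ⟨by exact_mod_cast hv, by exact_mod_cast hμ⟩
    | succ m ih =>
      obtain ⟨hvm, hμm⟩ := ih
      have hle : ∀ k : ℕ, (k : WithTop ℕ∞) ≤ ∞ := fun k => by exact_mod_cast le_top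
      have hQm := hQs hvm
      have hpQ : ∀ a b c, ContDiffOn ℝ (m + 1 : ℕ) (pd a (Q b c)) U := fun a b c =>
        contDiffOn_pd hU (hQm b c) (by exact_mod_cast le_rfl) a
      have hpG : ∀ a b c, ContDiffOn ℝ (m + 1 : ℕ) (pd a fun z => G z b c) U := fun a b c =>
        (contDiffOn_pd hU (hG.smooth b c) (k := ∞) (by norm_num) a).of_le (hle _)
      have hμ' : ContDiffOn ℝ (m + 1 + 1 : ℕ) μ U := by
        refine contDiffOn_succ_of_pd hU (hμ.differentiableOn (by norm_num)) fun k => ?_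
        refine ContDiffOn.congr ?_ fun y hy => hdμ y hy k
        exact contDiffOn_const.mul (ContDiffOn.sum fun i _ => ContDiffOn.sum fun j _ =>
          ((hginv i j).of_le (hle _)).mul (((hpQ i k j).sub (hpQ k i j)).add
            (hμm.mul ((hpG i k j).sub (hpG k i j)))))
      refine ⟨fun j => ?_, hμ'⟩
      refine contDiffOn_succ_of_pd hU ((hv j).differentiableOn (by norm_num)) fun i => ?_
      refine ContDiffOn.congr ?_ fun y hy => heq y hy i j
      exact (hQm i j).add (hμ'.mul ((hG.smooth i j).of_le (hle _)))
  exact contDiffOn_infty.mpr fun m => ((key m).1 i).of_le (by exact_mod_cast Nat.le_add_right m 2)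

lemma two_le_infty : (2 : WithTop ℕ∞) ≤ ∞ := WithTop.coe_le_coe.mpr le_top

namespace IsMetricOn

variable {G : Coord n → Matrix (Fin n) (Fin n) ℝ} (h : IsMetricOn G U)
include h

lemma tracelessRicci_smoothAt {x : Coord n} (hx : x ∈ U) (i j : Fin n) :
    ContDiffAt ℝ ∞ (fun y => tracelessRicci G y i j) x :=
  (h.rep_Ric hx i j).smooth.sub
    (((h.rep_Scal hx).smooth.div_const _).mul (h.smoothAt hx i j))

lemma tracelessRicci_symm {x : Coord n} (hx : x ∈ U) (i j : Fin n) :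
    tracelessRicci G x i j = tracelessRicci G x j i := by
  rw [tracelessRicci, tracelessRicci, h.ricci_symm hx, h.symm hx]

lemma christoffel_smoothAt {x : Coord n} (hx : x ∈ U) (k i j : Fin n) :
    ContDiffAt ℝ ∞ (fun y => christoffel G y k i j) x :=
  (h.rep_Γ hx i k j).smooth

/-- The equation `E_V = 0` as a first order system for the components of `V*`. -/
lemma pd_flat_eq (hn : 4 ≤ n) {V : Coord n → Coord n} {x : Coord n} (hx : x ∈ U)
    (hV : ∀ k, DifferentiableAt ℝ (fun y => V y k) x)
    (hE : ∀ i j, localConformalRicci G V x i j = 0) (i j : Fin n) :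
    pd i (fun y => flat G V y j) x = (∑ a, christoffel G x a i j * flat G V x a)
      - flat G V x i * flat G V x j + -tracelessRicci G x i j / ((n : ℝ) - 2)
      + 1 / (n : ℝ) * (divVec G V x + normSqVec G V x) * G x i j := by
  have hn' : (n : ℝ) - 2 ≠ 0 := by
    have : (4 : ℝ) ≤ n := by exact_mod_cast hn
    intro h; linarith
  have := hE i j
  rw [localConformalRicci, h.sum_nablaVec_mul hx hV] at this
  rw [← sub_eq_zero, ← mul_right_inj' hn', mul_zero, ← this]
  field_simp
  ring

/-- The one-form dual to a solution `V` of `E_V = 0` is closed. -/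
lemma pd_flat_symm (hn : 4 ≤ n) {V : Coord n → Coord n} {x : Coord n} (hx : x ∈ U)
    (hV : ∀ k, DifferentiableAt ℝ (fun y => V y k) x)
    (hE : ∀ i j, localConformalRicci G V x i j = 0) (i j : Fin n) :
    pd i (fun y => flat G V y j) x = pd j (fun y => flat G V y i) x := by
  rw [h.pd_flat_eq hn hx hV hE, h.pd_flat_eq hn hx hV hE, h.tracelessRicci_symm hx i j,
    h.symm hx i j]
  simp only [h.christoffel_symm hx _ i j]
  ring

lemma flat_contDiffOn {V : Coord n → Coord n} {m : WithTop ℕ∞} (hm : m ≤ ∞)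
    (hV : ∀ k, ContDiffOn ℝ m (fun y => V y k) U) (j : Fin n) :
    ContDiffOn ℝ m (fun y => flat G V y j) U :=
  ContDiffOn.sum fun k _ => (hV k).mul ((h.smooth k j).of_le hm)

lemma nablaVec_contDiffOn {V : Coord n → Coord n}
    (hV : ∀ k, ContDiffOn ℝ 2 (fun y => V y k) U) (i k : Fin n) :
    ContDiffOn ℝ 1 (fun y => nablaVec G V y i k) U := by
  have h12 : (1 : WithTop ℕ∞) ≤ 2 := by norm_num
  exact (contDiffOn_pd h.isOpen (hV k) (by norm_num) i).add (ContDiffOn.sum fun l _ =>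
    ContDiffOn.mul (fun y hy => ((h.christoffel_smoothAt hy k i l).of_le
      (by exact_mod_cast le_top)).contDiffWithinAt) ((hV l).of_le h12))

lemma divVec_add_normSqVec_contDiffOn {V : Coord n → Coord n}
    (hV : ∀ k, ContDiffOn ℝ 2 (fun y => V y k) U) :
    ContDiffOn ℝ 1 (fun y => divVec G V y + normSqVec G V y) U := by
  have h12 : (1 : WithTop ℕ∞) ≤ 2 := by norm_num
  exact (ContDiffOn.sum fun i _ => h.nablaVec_contDiffOn hV i i).add
    (ContDiffOn.sum fun i _ => ContDiffOn.sum fun j _ =>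
      (((h.smooth i j).of_le (by exact_mod_cast le_top)).mul ((hV i).of_le h12)).mul
        ((hV j).of_le h12))

/-- Serves to extend E_V = 0 from the dense set M_ℰ to all of M. -/
lemma localConformalRicci_continuousOn {V : Coord n → Coord n}
    (hV : ∀ k, ContDiffOn ℝ 2 (fun y => V y k) U) (i j : Fin n) :
    ContinuousOn (fun y => localConformalRicci G V y i j) U := by
  have hf := fun j => (h.flat_contDiffOn two_le_infty hV j).continuousOn
  have hG := fun i j => (h.smooth i j).continuousOn
  refine ContinuousOn.add (fun y hy => (h.tracelessRicci_smoothAt hy i j).continuousAt.continuousWithinAt)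
    (continuousOn_const.mul (((continuousOn_finsetSum _ fun k _ =>
      (h.nablaVec_contDiffOn hV i k).continuousOn.mul (hG k j)).add ((hf i).mul (hf j))).sub
      ((continuousOn_const.mul (h.divVec_add_normSqVec_contDiffOn hV).continuousOn).mul (hG i j))))

/-- Solutions of class `C²` of the equation `E_V = 0` are smooth. -/
theorem contDiffOn_infty_of_localConformalRicci (hn : 4 ≤ n) {V : Coord n → Coord n}
    (hV : ∀ k, ContDiffOn ℝ 2 (fun y => V y k) U)
    (hE : ∀ y ∈ U, ∀ i j, localConformalRicci G V y i j = 0) (k : Fin n) :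
    ContDiffOn ℝ ∞ (fun y => V y k) U := by
  have hfl := contDiffOn_infty_of_overdetermined h (by omega)
    (Γ := fun a i j y => christoffel G y a i j)
    (ρ := fun i j y => -tracelessRicci G y i j / ((n : ℝ) - 2))
    (v := fun j y => flat G V y j)
    (μ := fun y => 1 / (n : ℝ) * (divVec G V y + normSqVec G V y))
    (fun a i j y hy => (h.christoffel_smoothAt hy a i j).contDiffWithinAt)
    (fun i j y hy => ((h.tracelessRicci_smoothAt hy i j).neg.div_const _).contDiffWithinAt)
    (h.flat_contDiffOn two_le_infty hV)
    (contDiffOn_const.mul (h.divVec_add_normSqVec_contDiffOn hV))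
    (fun y hy i j => h.pd_flat_eq hn hy (fun k => ((hV k).contDiffAt
      (h.isOpen.mem_nhds hy)).differentiableAt (by norm_num)) (hE y hy) i j)
  -- The regularity theorem concerns V*; V is recovered by raising the index with the smooth inverse
  -- metric.
  refine ContDiffOn.congr (ContDiffOn.sum (s := Finset.univ) fun j _ =>
    ContDiffOn.mul (fun y hy => (h.ginv_smoothAt hy k j).contDiffWithinAt) (hfl j))
    fun y hy => (h.sum_ginv_flat hy V k).symm

end IsMetricOn

end Regularity

end ConformalEinstein

namespace ConformalEinstein
open Matrix Filter

/-! ### The metric and vector fields in the preferred charts. -/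

section Charts

variable {n : ℕ} {M : Type*} [TopologicalSpace M] [ChartedSpace (EuclideanSpace ℝ (Fin n)) M]

lemma isOpen_chart_target (p : M) : IsOpen (extChartAt (𝓡 n) p).target := isOpen_extChartAt_target p

lemma center_mem_target (p : M) : center (n := n) p ∈ (extChartAt (𝓡 n) p).target :=
  mem_extChartAt_target p

lemma chart_symm_center (p : M) : (extChartAt (𝓡 n) p).symm (center p) = p :=
  extChartAt_to_inv p

lemma symm_mem_source {p : M} {y : Coord n} (hy : y ∈ (extChartAt (𝓡 n) p).target) :
    (extChartAt (𝓡 n) p).symm y ∈ (chartAt (EuclideanSpace ℝ (Fin n)) p).source := by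
  rw [← extChartAt_source (𝓡 n) p]
  exact (extChartAt (𝓡 n) p).map_target hy

variable [IsManifold (𝓡 n) ∞ M]

/-- Identifies the coordinate fields with the frame of the tangent bundle trivialization, whose
smoothness theory then applies. -/
lemma coordVec_eq_symmL {p : M} {y : Coord n} (hy : y ∈ (extChartAt (𝓡 n) p).target) (i : Fin n) :
    coordVec p y i = (trivializationAt (EuclideanSpace ℝ (Fin n)) (TangentSpace (𝓡 n) (M := M))
      p).symmL ℝ ((extChartAt (𝓡 n) p).symm y) (EuclideanSpace.single i (1 : ℝ)) := by
  rw [TangentBundle.symmL_trivializationAt (symm_mem_source hy)]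
  rw [coordVec, (extChartAt (𝓡 n) p).right_inv hy, ModelWithCorners.range_eq_univ,
    mfderivWithin_univ]
  rfl

lemma coordVec_eq {p : M} {y : Coord n} (hy : y ∈ (extChartAt (𝓡 n) p).target) (i : Fin n) :
    coordVec p y i = tangentCoordChange (𝓡 n) p ((extChartAt (𝓡 n) p).symm y)
      ((extChartAt (𝓡 n) p).symm y) (EuclideanSpace.single i (1 : ℝ)) := by
  rw [coordVec_eq_symmL hy, TangentBundle.symmL_trivializationAt_eq_core (symm_mem_source hy)]
  rfl

lemma vecInChart_eq_trivialization (V : (q : M) → TangentSpace (𝓡 n) q) {p : M} {y : Coord n}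
    (hy : y ∈ (extChartAt (𝓡 n) p).target) :
    vecInChart V p y = (trivializationAt (EuclideanSpace ℝ (Fin n)) (TangentSpace (𝓡 n) (M := M)) p
      ⟨(extChartAt (𝓡 n) p).symm y, V ((extChartAt (𝓡 n) p).symm y)⟩).2 := by
  have hb : (extChartAt (𝓡 n) p).symm y ∈ (trivializationAt (EuclideanSpace ℝ (Fin n))
      (TangentSpace (𝓡 n) (M := M)) p).baseSet := symm_mem_source hy
  rw [vecInChart, ← TangentBundle.continuousLinearMapAt_trivializationAt (symm_mem_source hy)]
  exact congrFun (Bundle.Trivialization.coe_linearMapAt_of_mem (R := ℝ)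
    (trivializationAt (EuclideanSpace ℝ (Fin n)) (TangentSpace (𝓡 n) (M := M)) p) hb) _

lemma vecInChart_eq (V : (q : M) → TangentSpace (𝓡 n) q) {p : M} {y : Coord n}
    (hy : y ∈ (extChartAt (𝓡 n) p).target) :
    vecInChart V p y = tangentCoordChange (𝓡 n) ((extChartAt (𝓡 n) p).symm y) p
      ((extChartAt (𝓡 n) p).symm y) (V ((extChartAt (𝓡 n) p).symm y)) := by
  rw [vecInChart, ← TangentBundle.continuousLinearMapAt_trivializationAt (symm_mem_source hy),
    TangentBundle.continuousLinearMapAt_trivializationAt_eq_core (symm_mem_source hy)]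
  rfl

/-- In the preferred chart at `p` the components of `V` at `p` are `V p`. -/
lemma vecInChart_center (V : (q : M) → TangentSpace (𝓡 n) q) (p : M) :
    vecInChart V p (center p) = V p := by
  rw [vecInChart_eq V (center_mem_target p)]
  have : ∀ q : M, q = p → tangentCoordChange (𝓡 n) q p q (V q) = V p := by
    rintro q rfl
    exact tangentCoordChange_self (mem_extChartAt_source q)
  exact this _ (chart_symm_center p)

/-! #### The metric in a chart -/

/-- In the trivialization that defines it this section is constant. -/
lemma contMDiffOn_frame (p : M) (i : Fin n) :
    ContMDiffOn (𝓡 n) (𝓡 n).tangent ∞ (fun q => (⟨q, (trivializationAt (EuclideanSpace ℝ (Fin n))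
      (TangentSpace (𝓡 n) (M := M)) p).symmL ℝ q (EuclideanSpace.single i (1 : ℝ))⟩ :
        TangentBundle (𝓡 n) M)) (chartAt (EuclideanSpace ℝ (Fin n)) p).source := by
  have := (trivializationAt (EuclideanSpace ℝ (Fin n))
      (TangentSpace (𝓡 n) (M := M)) p).contMDiffOn_section_baseSet_iff (IB := 𝓡 n) (n := ∞)
      (s := fun q => (trivializationAt (EuclideanSpace ℝ (Fin n))
      (TangentSpace (𝓡 n) (M := M)) p).symmL ℝ q (EuclideanSpace.single i (1 : ℝ)))
  refine this.mpr ?_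
  refine (contMDiffOn_const (c := (EuclideanSpace.single i (1 : ℝ)))).congr fun q hq => ?_
  rw [Bundle.Trivialization.symmL_apply, Bundle.Trivialization.apply_mk_symm]
  all_goals exact hq

lemma contDiffOn_symm {f : M → ℝ} {m : WithTop ℕ∞} (hm : m ≤ ∞) {p : M}
    (hf : ContMDiffOn (𝓡 n) 𝓘(ℝ, ℝ) m f (chartAt (EuclideanSpace ℝ (Fin n)) p).source) :
    ContDiffOn ℝ m (fun y => f ((extChartAt (𝓡 n) p).symm y)) (extChartAt (𝓡 n) p).target := by
  rw [← contMDiffOn_iff_contDiffOn]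
  exact hf.comp ((contMDiffOn_extChartAt_symm (n := ∞) p).of_le hm) fun y hy => symm_mem_source hy

lemma metricInChart_apply (g : Metric n M) (p : M) {y : Coord n}
    (hy : y ∈ (extChartAt (𝓡 n) p).target) (i j : Fin n) :
    metricInChart g p y i j = g.inner ((extChartAt (𝓡 n) p).symm y)
      ((trivializationAt (EuclideanSpace ℝ (Fin n)) (TangentSpace (𝓡 n) (M := M)) p).symmL ℝ
        ((extChartAt (𝓡 n) p).symm y) (EuclideanSpace.single i (1 : ℝ)))
      ((trivializationAt (EuclideanSpace ℝ (Fin n)) (TangentSpace (𝓡 n) (M := M)) p).symmL ℝ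
        ((extChartAt (𝓡 n) p).symm y) (EuclideanSpace.single j (1 : ℝ))) := by
  rw [metricInChart, Matrix.of_apply, coordVec_eq_symmL hy, coordVec_eq_symmL hy]

lemma inner_sum_coordVec (g : Metric n M) (p : M) (y : Coord n) (v w : Fin n → ℝ) :
    g.inner ((extChartAt (𝓡 n) p).symm y) (∑ i, v i • coordVec p y i) (∑ j, w j • coordVec p y j)
      = ∑ i, ∑ j, v i * w j * metricInChart g p y i j := by
  simp only [map_sum, map_smul, FunLike.coe_sum, Finset.sum_apply, FunLike.coe_smul, Pi.smul_apply, smul_eq_mul, metricInChart,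
    Matrix.of_apply]
  rw [Finset.sum_comm]
  exact Finset.sum_congr rfl fun i _ => by
    rw [Finset.mul_sum]
    exact Finset.sum_congr rfl fun j _ => by ring

theorem isMetricOn_metricInChart (g : Metric n M) (p : M) :
    IsMetricOn (metricInChart g p) (extChartAt (𝓡 n) p).target := by
  refine ⟨isOpen_chart_target p, fun i j => ?_, fun y hy => ?_⟩
  · have h1 : ContMDiffOn (𝓡 n) 𝓘(ℝ, ℝ) ∞ (fun q => g.inner q
        ((trivializationAt (EuclideanSpace ℝ (Fin n)) (TangentSpace (𝓡 n) (M := M)) p).symmL ℝ q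
          (EuclideanSpace.single i (1 : ℝ)))
        ((trivializationAt (EuclideanSpace ℝ (Fin n)) (TangentSpace (𝓡 n) (M := M)) p).symmL ℝ q
          (EuclideanSpace.single j (1 : ℝ)))) (chartAt (EuclideanSpace ℝ (Fin n)) p).source := by
      intro q hq
      have := ContMDiffWithinAt.clm_bundle_apply₂ (n := ∞) (F₁ := EuclideanSpace ℝ (Fin n))
        (F₂ := EuclideanSpace ℝ (Fin n)) (g.contMDiff.contMDiffAt.contMDiffWithinAt
          (s := (chartAt (EuclideanSpace ℝ (Fin n)) p).source)) (contMDiffOn_frame p i q hq)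
          (contMDiffOn_frame p j q hq)
      simp only [Bundle.contMDiffWithinAt_totalSpace] at this
      exact this.2
    exact (contDiffOn_symm le_rfl h1).congr fun y hy => metricInChart_apply g p hy i j
  · refine Matrix.PosDef.of_dotProduct_mulVec_pos (Matrix.IsHermitian.ext fun i j => ?_)
      fun v hv => ?_
    · simp only [metricInChart, Matrix.of_apply, star_trivial]
      exact g.symm _ _ _
    · have e := inner_sum_coordVec g p y v v
      have e2 : star v ⬝ᵥ metricInChart g p y *ᵥ v
          = ∑ i, ∑ j, v i * v j * metricInChart g p y i j := by
        simp only [dotProduct, mulVec, star_trivial, Finset.mul_sum]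
        exact Finset.sum_congr rfl fun i _ => Finset.sum_congr rfl fun j _ => by ring
      rw [e2, ← e]
      -- It remains to see that the coordinate fields are linearly independent: ∑ v_i ∂_i is the
      -- image of v under a tangent coordinate change, which is undone by the reverse change.
      refine g.pos _ _ fun h0 => hv ?_
      let q := (extChartAt (𝓡 n) p).symm y
      have hs : q ∈ (extChartAt (𝓡 n) p).source := (extChartAt (𝓡 n) p).map_target hy
      have h1 : tangentCoordChange (𝓡 n) p q q (WithLp.toLp 2 v) = 0 := by
        have h2 : (WithLp.toLp 2 v : Coord n) = ∑ k, v k • EuclideanSpace.single k (1 : ℝ) := by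
          ext i
          simp [Pi.single_apply]
        rw [h2, map_sum]
        refine Eq.trans (Finset.sum_congr rfl fun i _ => ?_) h0
        rw [map_smul, coordVec_eq hy]
        rfl
      have h3 := tangentCoordChange_comp (I := 𝓡 n) (v := (WithLp.toLp 2 v : Coord n))
        ⟨⟨hs, mem_extChartAt_source q⟩, hs⟩
      rw [h1, map_zero, tangentCoordChange_self hs] at h3
      funext i
      exact (congrArg (fun z : Coord n => z i) h3).symm

end Charts

end ConformalEinstein

namespace ConformalEinstein
open Matrix Filter

/-! ### Transition maps between preferred charts. -/

section Transition

variable {n : ℕ} {M : Type*} [TopologicalSpace M] [ChartedSpace (EuclideanSpace ℝ (Fin n)) M]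

/-- The change of coordinates from the preferred chart at `p` to the preferred chart at `q`. -/
def transition (p q : M) (y : Coord n) : Coord n :=
  extChartAt (𝓡 n) q ((extChartAt (𝓡 n) p).symm y)

/-- The domain of `transition p q`. -/
def overlap (p q : M) : Set (Coord n) :=
  (extChartAt (𝓡 n) p).target ∩ (extChartAt (𝓡 n) p).symm ⁻¹' (extChartAt (𝓡 n) q).source

lemma isOpen_overlap (p q : M) : IsOpen (overlap (n := n) p q) :=
  (continuousOn_extChartAt_symm p).isOpen_inter_preimage (isOpen_chart_target p)
    (isOpen_extChartAt_source q)

lemma mem_overlap_symm {p : M} {y : Coord n} (hy : y ∈ (extChartAt (𝓡 n) p).target) :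
    y ∈ overlap p ((extChartAt (𝓡 n) p).symm y) :=
  ⟨hy, mem_extChartAt_source _⟩

lemma center_mem_overlap {p q : M} (hq : q ∈ (extChartAt (𝓡 n) p).source) :
    center q ∈ overlap (n := n) q p :=
  ⟨center_mem_target q, by rwa [Set.mem_preimage, chart_symm_center]⟩

lemma transition_center (p q : M) : transition (n := n) q p (center q) = extChartAt (𝓡 n) p q := by
  rw [transition, chart_symm_center]

/-- Changing from the chart at p to the preferred chart of the point under consideration lands at
that chart's centre. Hypotheses stated only at centres reach every point of a chart in this way. -/
lemma transition_symm (p : M) (y : Coord n) :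
    transition p ((extChartAt (𝓡 n) p).symm y) y = center ((extChartAt (𝓡 n) p).symm y) := rfl

lemma transition_mem_target {p q : M} {y : Coord n} (hy : y ∈ overlap p q) :
    transition p q y ∈ (extChartAt (𝓡 n) q).target :=
  (extChartAt (𝓡 n) q).map_source hy.2

lemma symm_transition {p q : M} {y : Coord n} (hy : y ∈ overlap p q) :
    (extChartAt (𝓡 n) q).symm (transition p q y) = (extChartAt (𝓡 n) p).symm y :=
  (extChartAt (𝓡 n) q).left_inv hy.2

variable [IsManifold (𝓡 n) ∞ M]

lemma contDiffAt_transition {p q : M} {y : Coord n} (hy : y ∈ overlap p q) :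
    ContDiffAt ℝ ∞ (transition p q) y := by
  have h := contDiffWithinAt_ext_coord_change (I := 𝓡 n) (n := ∞) q p (y := y)
    (by rwa [PartialEquiv.trans_source, PartialEquiv.symm_source])
  rwa [ModelWithCorners.range_eq_univ, contDiffWithinAt_univ] at h

lemma jac_transition {p q : M} {y : Coord n} (hy : y ∈ overlap p q) (a i : Fin n) :
    jac (transition p q) y a i = tangentCoordChange (𝓡 n) p q ((extChartAt (𝓡 n) p).symm y)
      (EuclideanSpace.single i (1 : ℝ)) a := by
  have h := hasFDerivWithinAt_tangentCoordChange (I := 𝓡 n) (x := p) (y := q)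
    (z := (extChartAt (𝓡 n) p).symm y) ⟨(extChartAt (𝓡 n) p).map_target hy.1, hy.2⟩
  rw [ModelWithCorners.range_eq_univ, hasFDerivWithinAt_univ,
    (extChartAt (𝓡 n) p).right_inv hy.1] at h
  have h2 := ((EuclideanSpace.proj a : Coord n →L[ℝ] ℝ).hasFDerivAt).comp y h
  rw [jac, Matrix.of_apply, pd]
  change fderiv ℝ ((EuclideanSpace.proj a : Coord n →L[ℝ] ℝ) ∘
    (extChartAt (𝓡 n) q ∘ (extChartAt (𝓡 n) p).symm)) y _ = _
  rw [h2.fderiv]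
  rfl

lemma tangentCoordChange_apply_eq_sum {p q : M} {y : Coord n} (hy : y ∈ overlap p q) (v : Coord n)
    (a : Fin n) : tangentCoordChange (𝓡 n) p q ((extChartAt (𝓡 n) p).symm y) v a
      = ∑ i, jac (transition p q) y a i * v i := by
  have h2 : v = ∑ k, v k • EuclideanSpace.single k (1 : ℝ) := by
    ext i
    simp [Pi.single_apply]
  conv_lhs => rw [h2, map_sum]
  simp only [map_smul, jac_transition hy]
  simp [mul_comm]

lemma vecInChart_transition (V : (q : M) → TangentSpace (𝓡 n) q) {p q : M} {y : Coord n}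
    (hy : y ∈ overlap p q) (c : Fin n) :
    vecInChart V q (transition p q y) c
      = ∑ k, jac (transition p q) y c k * vecInChart V p y k := by
  rw [← tangentCoordChange_apply_eq_sum hy, vecInChart_eq V hy.1,
    vecInChart_eq V (transition_mem_target hy)]
  have hs := (extChartAt (𝓡 n) p).map_target hy.1
  have h := tangentCoordChange_comp (E := Coord n) (I := 𝓡 n)
    (v := V ((extChartAt (𝓡 n) p).symm y)) ⟨⟨mem_extChartAt_source
      ((extChartAt (𝓡 n) p).symm y), hs⟩, hy.2⟩
  refine congrArg (fun z : Coord n => z c) (Eq.trans ?_ h.symm)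
  -- The two base points are only propositionally equal and V takes values in a dependent type, so
  -- the equality is generalised before substitution.
  have : ∀ z : M, z = (extChartAt (𝓡 n) p).symm y → tangentCoordChange (𝓡 n) z q z (V z) =
      tangentCoordChange (𝓡 n) ((extChartAt (𝓡 n) p).symm y) q ((extChartAt (𝓡 n) p).symm y)
        (V ((extChartAt (𝓡 n) p).symm y)) := by
    rintro z rfl; rfl
  exact this _ (symm_transition hy)

/-- `∂_i = ∑ (∂φ^a / ∂y^i) ∂_a`. -/
lemma frame_transition {p q : M} {y : Coord n} (hy : y ∈ overlap p q) (i : Fin n) :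
    (trivializationAt (EuclideanSpace ℝ (Fin n)) (TangentSpace (𝓡 n) (M := M)) p).symmL ℝ
        ((extChartAt (𝓡 n) p).symm y) (EuclideanSpace.single i (1 : ℝ))
      = ∑ a, jac (transition p q) y a i •
      (trivializationAt (EuclideanSpace ℝ (Fin n)) (TangentSpace (𝓡 n) (M := M)) q).symmL ℝ
        ((extChartAt (𝓡 n) p).symm y) (EuclideanSpace.single a (1 : ℝ)) := by
  set z := (extChartAt (𝓡 n) p).symm y with hz
  have hs := (extChartAt (𝓡 n) p).map_target hy.1
  have hq : z ∈ (chartAt (EuclideanSpace ℝ (Fin n)) q).source := by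
    rw [← extChartAt_source (𝓡 n) q]; exact hy.2
  rw [TangentBundle.symmL_trivializationAt_eq_core (symm_mem_source hy.1),
    TangentBundle.symmL_trivializationAt_eq_core hq]
  have h := tangentCoordChange_comp (I := 𝓡 n) (v := EuclideanSpace.single i (1 : ℝ))
    ⟨⟨hs, hy.2⟩, mem_extChartAt_source z⟩
  have h2 : tangentCoordChange (𝓡 n) p q z (EuclideanSpace.single i (1 : ℝ))
      = ∑ a, jac (transition p q) y a i • EuclideanSpace.single a (1 : ℝ) := by
    ext b
    simp only [jac_transition hy]
    simp [Pi.single_apply, hz]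
  rw [h2, map_sum] at h
  refine h.symm.trans (Finset.sum_congr rfl fun a _ => ?_)
  rw [map_smul]
  rfl

/-- Changes of coordinates preserve the metric. -/
theorem isPullbackOn_transition (g : Metric n M) (p q : M) :
    IsPullbackOn (transition p q) (metricInChart g p) (metricInChart g q) (overlap p q)
      (extChartAt (𝓡 n) q).target where
  source := (isMetricOn_metricInChart g p).mono (isOpen_overlap p q) Set.inter_subset_left
  target := isMetricOn_metricInChart g q
  mapsTo _ hy := transition_mem_target hy
  smooth a _ hy := (contDiffAt_euclidean.mp (contDiffAt_transition hy) a).contDiffWithinAt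
  metric_eq y hy := by
    ext i j
    rw [metricInChart_apply g p hy.1, frame_transition hy, frame_transition hy]
    have e : ∀ a b, metricInChart g q (transition p q y) a b = g.inner ((extChartAt (𝓡 n) p).symm y)
        ((trivializationAt (EuclideanSpace ℝ (Fin n)) (TangentSpace (𝓡 n) (M := M)) q).symmL ℝ
          ((extChartAt (𝓡 n) p).symm y) (EuclideanSpace.single a (1 : ℝ)))
        ((trivializationAt (EuclideanSpace ℝ (Fin n)) (TangentSpace (𝓡 n) (M := M)) q).symmL ℝ
          ((extChartAt (𝓡 n) p).symm y) (EuclideanSpace.single b (1 : ℝ))) := fun a b => by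
      rw [metricInChart_apply g q (transition_mem_target hy), symm_transition hy]
    simp only [mul_apply, transpose_apply, e, map_sum, map_smul, FunLike.coe_sum, Finset.sum_apply,
      FunLike.coe_smul, Pi.smul_apply, smul_eq_mul, Finset.sum_mul]
    refine Finset.sum_congr rfl fun b _ => ?_
    rw [Finset.mul_sum]
    exact Finset.sum_congr rfl fun a _ => mul_comm _ _

end Transition

/-! ### Smoothness of sections, gradients and conformal metrics. -/

section Sections

variable {n : ℕ} {M : Type*} [TopologicalSpace M] [ChartedSpace (EuclideanSpace ℝ (Fin n)) M]
  [IsManifold (𝓡 n) ∞ M]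

lemma contDiffOn_vecInChart {V : (q : M) → TangentSpace (𝓡 n) q} {m : WithTop ℕ∞} (hm : m ≤ ∞)
    (hV : ContMDiff (𝓡 n) (𝓡 n).tangent m (fun q => (⟨q, V q⟩ : TangentBundle (𝓡 n) M)))
    (p : M) (k : Fin n) :
    ContDiffOn ℝ m (fun y => vecInChart V p y k) (extChartAt (𝓡 n) p).target := by
  have h : ContMDiffOn (𝓡 n) 𝓘(ℝ, EuclideanSpace ℝ (Fin n)) m (fun q =>
      (trivializationAt (EuclideanSpace ℝ (Fin n)) (TangentSpace (𝓡 n) (M := M)) p ⟨q, V q⟩).2)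
      (chartAt (EuclideanSpace ℝ (Fin n)) p).source := by
    -- C^m smoothness of the tangent bundle uses a C^{m+1} manifold; this is available up to m = ∞
    -- because ∞ + 1 = ∞.
    have hm' : m + 1 ≤ ∞ := by
      calc m + 1 ≤ ∞ + 1 := by gcongr
        _ = ∞ := by norm_num
    have : IsManifold (𝓡 n) (m + 1) M := IsManifold.of_le hm'
    have := TangentBundle.contMDiffVectorBundle (I := 𝓡 n) (M := M) (n := m)
    exact ((trivializationAt (EuclideanSpace ℝ (Fin n)) (TangentSpace (𝓡 n) (M := M))
      p).contMDiffOn_section_baseSet_iff (IB := 𝓡 n) (n := m) (s := V)).mp hV.contMDiffOn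
  have h2 : ContDiffOn ℝ m (fun y => vecInChart V p y) (extChartAt (𝓡 n) p).target := by
    rw [← contMDiffOn_iff_contDiffOn]
    exact (h.comp ((contMDiffOn_extChartAt_symm (n := ∞) p).of_le hm)
      fun y hy => symm_mem_source hy).congr fun y hy => vecInChart_eq_trivialization V hy
  exact contDiffOn_euclidean.mp h2 k

lemma contMDiff_of_vecInChart {V : (q : M) → TangentSpace (𝓡 n) q} {m : WithTop ℕ∞} (hm : m ≤ ∞)
    (hV : ∀ p : M, ∀ k, ContDiffAt ℝ m (fun y => vecInChart V p y k) (center p)) :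
    ContMDiff (𝓡 n) (𝓡 n).tangent m (fun q => (⟨q, V q⟩ : TangentBundle (𝓡 n) M)) := by
  intro p
  rw [Bundle.contMDiffAt_section]
  have h1 : ContMDiffAt 𝓘(ℝ, Coord n) 𝓘(ℝ, Coord n) m (vecInChart V p)
      (extChartAt (𝓡 n) p p) :=
    (contDiffAt_euclidean.mpr (hV p)).contMDiffAt
  refine (h1.comp p ((contMDiffAt_extChartAt (n := ∞)).of_le hm)).congr_of_eventuallyEq ?_
  filter_upwards [extChartAt_source_mem_nhds (I := 𝓡 n) p] with q hq
  have := vecInChart_eq_trivialization V ((extChartAt (𝓡 n) p).map_source hq)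
  rw [(extChartAt (𝓡 n) p).left_inv hq] at this
  exact this.symm

lemma flat_transition (g : Metric n M) (V : (q : M) → TangentSpace (𝓡 n) q) {p q : M} {y : Coord n}
    (hy : y ∈ overlap p q) (l : Fin n) : flat (metricInChart g p) (vecInChart V p) y l
      = ∑ a, jac (transition p q) y a l *
        flat (metricInChart g q) (vecInChart V q) (transition p q y) a := by
  have hV : (fun c => vecInChart V q (transition p q y) c)
      = jac (transition p q) y *ᵥ fun k => vecInChart V p y k :=
    funext (vecInChart_transition V hy)
  change ((fun k => vecInChart V p y k) ᵥ* metricInChart g p y) l = ∑ a, jac (transition p q) y a l *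
    ((fun c => vecInChart V q (transition p q y) c) ᵥ* metricInChart g q (transition p q y)) a
  rw [(isPullbackOn_transition g p q).metric_eq y hy, hV, ← vecMul_vecMul, ← vecMul_vecMul,
    vecMul_transpose]
  exact (Finset.sum_congr rfl fun a _ => mul_comm _ _ : ∑ a, _ * jac (transition p q) y a l = _)

lemma pd_symm_transition {f : M → ℝ} (hf : ContMDiff (𝓡 n) 𝓘(ℝ, ℝ) 1 f) {p q : M} {y : Coord n}
    (hy : y ∈ overlap p q) (l : Fin n) :
    pd l (fun z => f ((extChartAt (𝓡 n) p).symm z)) y = ∑ a, jac (transition p q) y a l *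
      pd a (fun z => f ((extChartAt (𝓡 n) q).symm z)) (transition p q y) := by
  have h1 : (fun z => f ((extChartAt (𝓡 n) p).symm z)) =ᶠ[𝓝 y]
      fun z => (fun w => f ((extChartAt (𝓡 n) q).symm w)) (transition p q z) := by
    filter_upwards [(isOpen_overlap p q).mem_nhds hy] with z hz
    rw [symm_transition hz]
  have h2 := ((contDiffOn_symm (p := q) (by norm_num) hf.contMDiffOn).contDiffAt
    ((isOpen_chart_target q).mem_nhds (transition_mem_target hy))).differentiableAt (by norm_num)
  exact (pd_congr h1 l).trans
    (pd_comp h2 ((contDiffAt_transition hy).differentiableAt (by simp)) l)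

/-- The gradient of a smooth function. -/
theorem exists_gradient (g : Metric n M) {f : M → ℝ} (hf : ContMDiff (𝓡 n) 𝓘(ℝ, ℝ) ∞ f) :
    ∃ V : (q : M) → TangentSpace (𝓡 n) q,
      ContMDiff (𝓡 n) (𝓡 n).tangent ∞ (fun q => (⟨q, V q⟩ : TangentBundle (𝓡 n) M)) ∧
      ∀ p : M, ∀ y ∈ (extChartAt (𝓡 n) p).target, ∀ l,
        flat (metricInChart g p) (vecInChart V p) y l
          = pd l (fun z => f ((extChartAt (𝓡 n) p).symm z)) y := by
  -- The gradient is defined at each point in that point's own chart. In `h1`, V* and df transform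
  -- by the same Jacobian, which gives the identity throughout any chart and thereby smoothness.
  let V : (q : M) → TangentSpace (𝓡 n) q := fun q => (WithLp.toLp 2 fun k => ∑ j,
    ginv (metricInChart g q) (center q) k j *
      pd j (fun z => f ((extChartAt (𝓡 n) q).symm z)) (center q) : Coord n)
  have h0 : ∀ q l, flat (metricInChart g q) (vecInChart V q) (center q) l
      = pd l (fun z => f ((extChartAt (𝓡 n) q).symm z)) (center q) := by
    intro q l
    rw [flat, vecInChart_center]
    exact (isMetricOn_metricInChart g q).sum_G_ginv (center_mem_target q) (fun j =>
      pd j (fun z => f ((extChartAt (𝓡 n) q).symm z)) (center q)) l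
  have h1 : ∀ p : M, ∀ y ∈ (extChartAt (𝓡 n) p).target, ∀ l,
        flat (metricInChart g p) (vecInChart V p) y l
          = pd l (fun z => f ((extChartAt (𝓡 n) p).symm z)) y := by
    intro p y hy l
    have hyq := mem_overlap_symm hy
    rw [flat_transition g V hyq, pd_symm_transition (hf.of_le (by norm_num)) hyq]
    simp only [transition_symm, h0]
  refine ⟨V, contMDiff_of_vecInChart le_rfl fun p k => ?_, h1⟩
  have hm := isMetricOn_metricInChart g p
  have hc := center_mem_target (n := n) p
  have hfs : ContDiffAt ℝ ∞ (fun z => f ((extChartAt (𝓡 n) p).symm z)) (center p) :=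
    (contDiffOn_symm le_rfl hf.contMDiffOn).contDiffAt ((isOpen_chart_target p).mem_nhds hc)
  have hs : ContDiffAt ℝ ∞ (fun y => ∑ j, ginv (metricInChart g p) y k j *
      pd j (fun z => f ((extChartAt (𝓡 n) p).symm z)) y) (center p) :=
    ContDiffAt.sum fun j _ => (hm.ginv_smoothAt hc k j).mul (ContDiffAt.pd_infty hfs j)
  refine hs.congr_of_eventuallyEq ?_
  filter_upwards [(isOpen_chart_target p).mem_nhds hc] with y hy
  simp only [← h1 p y hy]
  exact (hm.sum_ginv_flat hy (vecInChart V p) k).symm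

/-- The metric `c g` for a positive function `c`. -/
def conformalMetric (g : Metric n M) (c : M → ℝ) (hc : ContMDiff (𝓡 n) 𝓘(ℝ, ℝ) ∞ c)
    (hpos : ∀ p, 0 < c p) : Metric n M where
  inner p := c p • g.inner p
  symm p v w := by simp [g.symm p v w]
  pos p v hv := mul_pos (hpos p) (g.pos p v hv)
  isVonNBounded p := by
    -- The unit ball of c g lies in the image of the unit ball of g under scaling by c^{-1/2}, so it
    -- is bounded.
    have hs : 0 < √(c p) := Real.sqrt_pos.mpr (hpos p)
    refine Bornology.IsVonNBounded.subset ?_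
      ((g.isVonNBounded p).image ((√(c p))⁻¹ • ContinuousLinearMap.id ℝ _))
    intro v hv
    refine ⟨√(c p) • v, ?_, ?_⟩
    · have h2 : c p * g.inner p v v < 1 := hv
      change g.inner p (√(c p) • v) (√(c p) • v) < 1
      rw [map_smul, map_smul, FunLike.coe_smul, Pi.smul_apply, smul_eq_mul, smul_eq_mul,
        ← mul_assoc, Real.mul_self_sqrt (hpos p).le]
      exact h2
    · change (√(c p))⁻¹ • √(c p) • v = v
      rw [inv_smul_smul₀ hs.ne']
  contMDiff := hc.smul_section g.contMDiff

end Sections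

end ConformalEinstein

namespace ConformalEinstein
open Matrix Filter

/-! ### Density of M_ℰ and passage between charts. -/

section RegularSet

variable {n : ℕ}

/-- The rank of the kernel of the Weyl tensor is upper semicontinuous. -/
theorem IsMetricOn.eventually_finrank_localWeylKernel_le
    {G : Coord n → Matrix (Fin n) (Fin n) ℝ} {U : Set (Coord n)} (h : IsMetricOn G U)
    {x : Coord n} (hx : x ∈ U) : ∀ᶠ y in 𝓝 x,
      Module.finrank ℝ (localWeylKernel G y) ≤ Module.finrank ℝ (localWeylKernel G x) := by
  -- T y sends v to W(v,·,·,·), so its kernel is ℰ. It depends continuously on y, and having rank at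
  -- least r is an open condition on linear maps; rank-nullity converts this into the bound on
  -- kernels.
  let T : Coord n → Coord n →L[ℝ] (Fin n → Fin n → Fin n → ℝ) := fun y =>
    ∑ i, (EuclideanSpace.proj i : Coord n →L[ℝ] ℝ).smulRight (weyl G y i)
  have hT : ∀ y v j k l, T y v j k l = ∑ i, v i * weyl G y i j k l := fun y v j k l => by
    simp [T, Finset.sum_apply]
  have hker : ∀ y, LinearMap.ker (T y : Coord n →ₗ[ℝ] (Fin n → Fin n → Fin n → ℝ)) = localWeylKernel G y := by
    intro y
    ext v
    constructor
    · intro hv j k l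
      rw [← hT]
      exact congrFun (congrFun (congrFun hv j) k) l
    · intro hv
      funext j k l
      exact (hT y v j k l).trans (hv j k l)
  have hcont : ContinuousAt T x := by
    refine tendsto_finsetSum _ fun i _ => ?_
    have : ContinuousAt (fun y => weyl G y i) x :=
      continuousAt_pi.mpr fun j => continuousAt_pi.mpr fun k => continuousAt_pi.mpr fun l =>
        (h.rep_W hx i j k l).smooth.continuousAt
    exact ((ContinuousLinearMap.smulRightL ℝ (Coord n) (Fin n → Fin n → Fin n → ℝ)
      (EuclideanSpace.proj i)).continuous.continuousAt).comp this
  have hopen := isOpen_setOfPred_nat_le_rank (𝕜 := ℝ) (E := Coord n)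
    (F := Fin n → Fin n → Fin n → ℝ) (Module.finrank ℝ (T x : Coord n →ₗ[ℝ] (Fin n → Fin n → Fin n → ℝ)).range)
  have hmem : T x ∈ {f : Coord n →L[ℝ] (Fin n → Fin n → Fin n → ℝ) |
      (Module.finrank ℝ (T x : Coord n →ₗ[ℝ] (Fin n → Fin n → Fin n → ℝ)).range : Cardinal) ≤ (f : Coord n →ₗ[ℝ] (Fin n → Fin n → Fin n → ℝ)).rank} := by
    rw [Set.mem_ofPred, LinearMap.rank, Module.finrank_eq_rank]
  filter_upwards [hcont.eventually (hopen.mem_nhds hmem)] with y hy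
  rw [LinearMap.rank, ← Module.finrank_eq_rank, Nat.cast_le] at hy
  have h1 := LinearMap.finrank_range_add_finrank_ker (T x : Coord n →ₗ[ℝ] (Fin n → Fin n → Fin n → ℝ))
  have h2 := LinearMap.finrank_range_add_finrank_ker (T y : Coord n →ₗ[ℝ] (Fin n → Fin n → Fin n → ℝ))
  rw [hker] at h1 h2
  omega

variable {M : Type*} [TopologicalSpace M] [ChartedSpace (EuclideanSpace ℝ (Fin n)) M]
  [IsManifold (𝓡 n) ∞ M]

/-- The kernel at q is defined in the chart at q; semicontinuity has to be read in one fixed chart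
at p. -/
lemma finrank_weylKernel_eq (g : Metric n M) {p q : M} (hq : q ∈ (extChartAt (𝓡 n) p).source) :
    Module.finrank ℝ (weylKernel g q)
      = Module.finrank ℝ (localWeylKernel (metricInChart g p) (extChartAt (𝓡 n) p q)) := by
  rw [← transition_center]
  exact (isPullbackOn_transition g q p).finrank_localWeylKernel_eq (center_mem_overlap hq)

lemma isOpen_regularSet (g : Metric n M) : IsOpen (regularSet g) := by
  refine isOpen_iff_mem_nhds.mpr fun p hp => ?_
  filter_upwards [eventually_eventually_nhds.mpr hp] with q hq
  have h1 := hq.self_of_nhds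
  filter_upwards [hq] with r hr
  rw [hr, h1]

lemma eventually_finrank_weylKernel_le (g : Metric n M) (p : M) : ∀ᶠ q in 𝓝 p,
    Module.finrank ℝ (weylKernel g q) ≤ Module.finrank ℝ (weylKernel g p) := by
  have h1 := (isMetricOn_metricInChart g p).eventually_finrank_localWeylKernel_le
    (center_mem_target p)
  filter_upwards [(continuousAt_extChartAt (I := 𝓡 n) p).eventually h1,
    extChartAt_source_mem_nhds (I := 𝓡 n) p] with q hq hs
  rw [finrank_weylKernel_eq g hs]
  exact hq

/-- In any open set choose a point where the rank is minimal. Upper semicontinuity bounds nearby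
ranks above by this minimum, so the rank is constant near that point. -/
lemma dense_regularSet (g : Metric n M) : Dense (regularSet g) := by
  intro p
  rw [mem_closure_iff]
  intro O hO hp
  classical
  let S : Set ℕ := (fun q => Module.finrank ℝ (weylKernel g q)) '' O
  have hS : S.Nonempty := ⟨_, p, hp, rfl⟩
  obtain ⟨q, hqO, hq⟩ := Nat.sInf_mem hS
  refine ⟨q, hqO, ?_⟩
  filter_upwards [eventually_finrank_weylKernel_le g q, hO.mem_nhds hqO] with r hr hrO
  exact le_antisymm hr (hq.le.trans (Nat.sInf_le ⟨r, hrO, rfl⟩))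

/-- An Einstein metric has vanishing traceless Ricci tensor in every chart. -/
lemma IsEinstein.tracelessRicci_eq_zero {g : Metric n M} (hg : IsEinstein g) {p : M} {y : Coord n}
    (hy : y ∈ (extChartAt (𝓡 n) p).target) (i j : Fin n) :
    tracelessRicci (metricInChart g p) y i j = 0 := by
  have hyq := mem_overlap_symm hy
  have h := (isPullbackOn_transition g p _).tracelessRicci_eq hyq
  have h0 : Matrix.of (tracelessRicci (metricInChart g ((extChartAt (𝓡 n) p).symm y))
      (transition p ((extChartAt (𝓡 n) p).symm y) y)) = 0 := by
    ext a b
    exact hg _ a b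
  rw [h0, Matrix.mul_zero, Matrix.zero_mul] at h
  exact congrFun (congrFun h i) j

/-- The vanishing of the conformal Ricci tensor can be checked in the preferred charts. -/
lemma localConformalRicci_eq_zero (g : Metric n M) {V : (q : M) → TangentSpace (𝓡 n) q}
    (hV : ContMDiff (𝓡 n) (𝓡 n).tangent 2 (fun q => (⟨q, V q⟩ : TangentBundle (𝓡 n) M)))
    {p : M} {y : Coord n} (hy : y ∈ (extChartAt (𝓡 n) p).target)
    (h0 : ∀ i j, conformalRicci g V ((extChartAt (𝓡 n) p).symm y) i j = 0) (i j : Fin n) :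
    localConformalRicci (metricInChart g p) (vecInChart V p) y i j = 0 := by
  have hyq := mem_overlap_symm hy
  have hd : ∀ (p : M) (y : Coord n), y ∈ (extChartAt (𝓡 n) p).target → ∀ k,
      DifferentiableAt ℝ (fun y => vecInChart V p y k) y := fun p y hy k =>
    ((contDiffOn_vecInChart two_le_infty hV p k).contDiffAt
      ((isOpen_chart_target p).mem_nhds hy)).differentiableAt (by norm_num)
  have h := (isPullbackOn_transition g p _).localConformalRicci_eq hyq (hd _ _ hy)
    (hd _ _ (transition_mem_target hyq))
    (by
      filter_upwards [(isOpen_overlap _ _).mem_nhds hyq] with z hz c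
      exact vecInChart_transition V hz c)
  have h0' : Matrix.of (localConformalRicci (metricInChart g ((extChartAt (𝓡 n) p).symm y))
      (vecInChart V ((extChartAt (𝓡 n) p).symm y))
      (transition p ((extChartAt (𝓡 n) p).symm y) y)) = 0 := by
    ext a b
    exact h0 a b
  rw [h0', Matrix.mul_zero, Matrix.zero_mul] at h
  exact congrFun (congrFun h i) j

/-- E_V involves a derivative of V, so agreement near p is required; openness of M_ℰ supplies it for
V and 𝕋. -/
lemma conformalRicci_congr (g : Metric n M) {V V' : (q : M) → TangentSpace (𝓡 n) q} {p : M}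
    (h : ∀ᶠ q in 𝓝 p, V q = V' q) (i j : Fin n) :
    conformalRicci g V p i j = conformalRicci g V' p i j := by
  have h1 : vecInChart V p =ᶠ[𝓝 (center p)] vecInChart V' p := by
    have hc : ContinuousAt (extChartAt (𝓡 n) p).symm (center (n := n) p) :=
      continuousAt_extChartAt_symm p
    have h' : ∀ᶠ q in 𝓝 ((extChartAt (𝓡 n) p).symm (center (n := n) p)), V q = V' q := by
      rwa [chart_symm_center]
    filter_upwards [hc.eventually h'] with y hy
    rw [vecInChart, vecInChart, hy]
  have hx := h1.self_of_nhds
  have hn : ∀ i k, nablaVec (metricInChart g p) (vecInChart V p) (center p) i k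
      = nablaVec (metricInChart g p) (vecInChart V' p) (center p) i k := by
    intro i k
    rw [nablaVec, nablaVec, hx, pd_congr (h1.mono fun y hy => by rw [hy])]
  simp only [conformalRicci, localConformalRicci, flat, divVec, normSqVec, hn, hx]

end RegularSet

end ConformalEinstein

namespace ConformalEinstein
open Filter

/-! ### Gluing local primitives on a simply connected space. -/

section Primitives

/-- The real numbers with the discrete topology. -/
structure DiscreteReal : Type where
  val : ℝ

instance : TopologicalSpace DiscreteReal := ⊥

instance : DiscreteTopology DiscreteReal := ⟨rfl⟩

variable {X : Type*} [TopologicalSpace X]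

/-- The affine local system of all functions which differ from the functions `F i` by locally
constant functions. -/
def primitiveBundle (B : X → Set X) (hB : ∀ i, IsOpen (B i)) (hmem : ∀ i, i ∈ B i)
    (F : X → X → ℝ) (hF : ∀ i j, ∀ x ∈ B i ∩ B j, ∀ᶠ y in 𝓝 x, F i y - F j y = F i x - F j x) :
    FiberBundleCore X X DiscreteReal where
  baseSet := B
  isOpen_baseSet := hB
  indexAt := id
  mem_baseSet_at := hmem
  coordChange i j x v := ⟨v.val + (F i x - F j x)⟩
  coordChange_self i x _ v := by
    rw [sub_self, add_zero]
  continuousOn_coordChange i j := by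
    rintro ⟨x, v⟩ ⟨hx, -⟩
    refine ContinuousAt.continuousWithinAt ?_
    refine (continuousAt_const (y := (⟨v.val + (F i x - F j x)⟩ : DiscreteReal))).congr ?_
    have h1 : ∀ᶠ z : X × DiscreteReal in 𝓝 (x, v), F i z.1 - F j z.1 = F i x - F j x :=
      (continuousAt_fst (p := (x, v))).eventually (hF i j x hx)
    have h2 : ∀ᶠ z : X × DiscreteReal in 𝓝 (x, v), z.2 = v :=
      (continuousAt_snd (p := (x, v))).eventually (by
        change ∀ᶠ w in 𝓝 v, w = v
        rw [nhds_discrete]; exact rfl)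
    filter_upwards [h1, h2] with z hz hz2
    rw [hz, hz2]
  coordChange_comp i j k x _ v := by
    change DiscreteReal.mk (v.val + (F i x - F j x) + (F j x - F k x)) = _
    congr 1
    ring

/-- On a simply connected space local primitives that differ by locally constant functions can be
glued, up to constants. -/
theorem exists_global_primitive [SimplyConnectedSpace X] [LocallyPathConnectedSpace X]
    (B : X → Set X) (hB : ∀ i, IsOpen (B i)) (hmem : ∀ i, i ∈ B i)
    (F : X → X → ℝ) (hF : ∀ i j, ∀ x ∈ B i ∩ B j, ∀ᶠ y in 𝓝 x, F i y - F j y = F i x - F j x) :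
    ∃ f : X → ℝ, ∀ i, ∀ x ∈ B i, ∀ᶠ y in 𝓝 x, f y - F i y = f x - F i x := by
  let Z := primitiveBundle B hB hmem F hF
  -- A fibre bundle with discrete fibre is a covering.
  have hcov : IsCoveringMap Z.proj := IsFiberBundle.isCoveringMap fun x =>
    ⟨Z.localTrivAt x, Z.mem_localTrivAt_baseSet x⟩
  obtain ⟨a⟩ : Nonempty X := inferInstance
  -- Simple connectedness lifts the identity map to the covering, which gives a global section.
  obtain ⟨s, ⟨-, hs⟩, -⟩ := hcov.existsUnique_continuousMap_lifts (ContinuousMap.id X) a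
    ⟨a, (⟨0⟩ : DiscreteReal)⟩ rfl
  have hp : ∀ x, (s x).proj = x := fun x => congrFun hs x
  let f : X → ℝ := fun x => DiscreteReal.val (s x).2 + F (s x).proj x
  refine ⟨f, fun i x hx => ?_⟩
  -- Read in trivialization i, the section is f - F i. Over B i it is continuous with discrete
  -- values, hence locally constant.
  have htriv : ∀ y, (Z.localTriv i (s y)).2.val = f y - F i y := by
    intro y
    rw [Z.localTriv_apply]
    change DiscreteReal.val (s y).2 + (F (s y).proj (s y).proj - F i (s y).proj)
      = DiscreteReal.val (s y).2 + F (s y).proj y - F i y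
    rw [hp y]
    ring
  have hsrc : s x ∈ (Z.localTriv i).source := by
    rw [Z.mem_localTriv_source, hp x]
    exact hx
  have hc : ContinuousAt (fun y => (Z.localTriv i (s y)).2) x :=
    continuousAt_snd.comp (((Z.localTriv i).continuousAt hsrc).comp s.continuous.continuousAt)
  have h1 : ∀ᶠ y in 𝓝 x, (Z.localTriv i (s y)).2 = (Z.localTriv i (s x)).2 := by
    have := hc.eventually (p := fun w => w = (Z.localTriv i (s x)).2)
      (by rw [nhds_discrete]; exact rfl)
    exact this
  filter_upwards [h1] with y hy
  rw [← htriv, ← htriv, hy]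

end Primitives

/-! ### Exactness of closed one-forms. -/

section Potential

variable {n : ℕ} {M : Type*} [TopologicalSpace M] [ChartedSpace (EuclideanSpace ℝ (Fin n)) M]
  [IsManifold (𝓡 n) ∞ M]

lemma hasFDerivAt_transition {p q : M} {y : Coord n} (hy : y ∈ overlap p q) :
    HasFDerivAt (transition p q)
      (tangentCoordChange (𝓡 n) p q ((extChartAt (𝓡 n) p).symm y)) y := by
  have h := hasFDerivWithinAt_tangentCoordChange (I := 𝓡 n) (x := p) (y := q)
    (z := (extChartAt (𝓡 n) p).symm y) ⟨(extChartAt (𝓡 n) p).map_target hy.1, hy.2⟩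
  rw [ModelWithCorners.range_eq_univ, hasFDerivWithinAt_univ,
    (extChartAt (𝓡 n) p).right_inv hy.1] at h
  exact h

/-- The one-form `g(V, ·)` in the preferred chart at `p`. -/
def dualForm (g : Metric n M) (V : (q : M) → TangentSpace (𝓡 n) q) (p : M) (y : Coord n) :
    Coord n →L[ℝ] ℝ :=
  ∑ k, flat (metricInChart g p) (vecInChart V p) y k • (EuclideanSpace.proj k : Coord n →L[ℝ] ℝ)

lemma dualForm_apply (g : Metric n M) (V : (q : M) → TangentSpace (𝓡 n) q) (p : M)
    (y v : Coord n) : dualForm g V p y v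
      = ∑ k, flat (metricInChart g p) (vecInChart V p) y k * v k := by
  simp [dualForm]

variable {g : Metric n M} {V : (q : M) → TangentSpace (𝓡 n) q}

/-- The chain rule together with the transformation law of covectors: being a primitive of V* does
not depend on the chart. -/
lemma hasFDerivAt_chart_change {u : M → ℝ} {p q : M} {y : Coord n} (hy : y ∈ overlap p q)
    (h : HasFDerivAt (fun z => u ((extChartAt (𝓡 n) q).symm z))
      (dualForm g V q (transition p q y)) (transition p q y)) :
    HasFDerivAt (fun z => u ((extChartAt (𝓡 n) p).symm z)) (dualForm g V p y) y := by
  have h1 := h.comp y (hasFDerivAt_transition hy)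
  have e : (dualForm g V q (transition p q y)).comp
      (tangentCoordChange (𝓡 n) p q ((extChartAt (𝓡 n) p).symm y)) = dualForm g V p y := by
    ext v
    rw [ContinuousLinearMap.comp_apply, dualForm_apply, dualForm_apply]
    simp only [tangentCoordChange_apply_eq_sum hy, flat_transition g V hy, Finset.mul_sum,
      Finset.sum_mul]
    rw [Finset.sum_comm]
    exact Finset.sum_congr rfl fun _ _ => Finset.sum_congr rfl fun _ _ => by ring
  rw [e] at h1
  refine h1.congr_of_eventuallyEq ?_
  filter_upwards [(isOpen_overlap p q).mem_nhds hy] with z hz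
  rw [Function.comp_apply, symm_transition hz]

-- In the chart at p the difference has zero derivative on a small ball, which is connected.
omit [IsManifold (𝓡 n) ∞ M] in
lemma eventually_sub_eq_of_hasFDerivAt {u w : M → ℝ} {p x : M}
    (hx : x ∈ (extChartAt (𝓡 n) p).source) {η : Coord n → Coord n →L[ℝ] ℝ}
    (hu : ∀ᶠ y in 𝓝 (extChartAt (𝓡 n) p x),
      HasFDerivAt (fun z => u ((extChartAt (𝓡 n) p).symm z)) (η y) y)
    (hw : ∀ᶠ y in 𝓝 (extChartAt (𝓡 n) p x),
      HasFDerivAt (fun z => w ((extChartAt (𝓡 n) p).symm z)) (η y) y) :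
    ∀ᶠ y in 𝓝 x, u y - w y = u x - w x := by
  obtain ⟨r, hr, hball⟩ := Metric.eventually_nhds_iff_ball.mp (hu.and hw)
  have hd : ∀ y ∈ Metric.ball (extChartAt (𝓡 n) p x) r,
      HasFDerivAt (fun z => u ((extChartAt (𝓡 n) p).symm z) - w ((extChartAt (𝓡 n) p).symm z))
        0 y := fun y hy => by
    have := (hball y hy).1.sub (hball y hy).2
    rwa [sub_self] at this
  filter_upwards [(continuousAt_extChartAt' hx).eventually (Metric.ball_mem_nhds _ hr),
    extChartAt_source_mem_nhds' hx] with y hy hys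
  have := Metric.isOpen_ball.is_const_of_fderiv_eq_zero
    (convex_ball (extChartAt (𝓡 n) p x) r).isPreconnected
    (fun z hz => (hd z hz).differentiableAt.differentiableWithinAt)
    (fun z hz => (hd z hz).fderiv) hy (Metric.mem_ball_self hr)
  rwa [(extChartAt (𝓡 n) p).left_inv hys, (extChartAt (𝓡 n) p).left_inv hx] at this

/-- On a simply connected manifold closed one-forms are exact. -/
theorem exists_potential [SimplyConnectedSpace M]
    (hV : ContMDiff (𝓡 n) (𝓡 n).tangent 2 (fun q => (⟨q, V q⟩ : TangentBundle (𝓡 n) M)))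
    (hclosed : ∀ p : M, ∀ y ∈ (extChartAt (𝓡 n) p).target, ∀ i j,
      pd i (fun z => flat (metricInChart g p) (vecInChart V p) z j) y
        = pd j (fun z => flat (metricInChart g p) (vecInChart V p) z i) y) :
    ∃ f : M → ℝ, ∀ p : M, ∀ y ∈ (extChartAt (𝓡 n) p).target,
      HasFDerivAt (fun z => f ((extChartAt (𝓡 n) p).symm z)) (dualForm g V p y) y := by
  have hflat : ∀ p k, ContDiffOn ℝ 2 (fun z => flat (metricInChart g p) (vecInChart V p) z k)
      (extChartAt (𝓡 n) p).target := fun p k =>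
    (isMetricOn_metricInChart g p).flat_contDiffOn two_le_infty
      (contDiffOn_vecInChart two_le_infty hV p) k
  have hloc : ∀ p : M, ∃ r > 0, ∃ φ : Coord n → ℝ,
      Metric.ball (center (n := n) p) r ⊆ (extChartAt (𝓡 n) p).target ∧
      ∀ y ∈ Metric.ball (center (n := n) p) r, HasFDerivAt φ (dualForm g V p y) y := by
    intro p
    obtain ⟨r, hr, hball⟩ := Metric.isOpen_iff.mp (isOpen_chart_target (n := n) p) _
      (center_mem_target (n := n) p)
    have hd : ∀ y ∈ Metric.ball (center (n := n) p) r, ∀ k, DifferentiableAt ℝ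
        (fun z => flat (metricInChart g p) (vecInChart V p) z k) y := fun y hy k =>
      ((hflat p k).contDiffAt ((isOpen_chart_target p).mem_nhds (hball hy))).differentiableAt
        (by norm_num)
    have hdual : ∀ y ∈ Metric.ball (center (n := n) p) r, HasFDerivAt (dualForm g V p)
        (∑ k, (fderiv ℝ (fun z => flat (metricInChart g p) (vecInChart V p) z k) y).smulRight
          (EuclideanSpace.proj k : Coord n →L[ℝ] ℝ)) y := fun y hy =>
      HasFDerivAt.fun_sum fun k _ => (hd y hy k).hasFDerivAt.smul_const
        (EuclideanSpace.proj k : Coord n →L[ℝ] ℝ)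
    -- The Poincaré lemma on a ball: closedness of V* is symmetry of the derivative of its dual
    -- form.
    obtain ⟨φ, hφ⟩ := (convex_ball (center (n := n) p) r).exists_forall_hasFDerivAt_of_fderiv_symmetric
      Metric.isOpen_ball (show DifferentiableOn ℝ (dualForm g V p) _ from fun y hy =>
        (hdual y hy).differentiableAt.differentiableWithinAt) (fun y hy v w => by
        rw [(hdual y hy).fderiv]
        simp only [FunLike.coe_sum, Finset.sum_apply, ContinuousLinearMap.smulRight_apply,
          FunLike.coe_smul, Pi.smul_apply, smul_eq_mul, fderiv_eq_sum_pd, Finset.sum_mul,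
          EuclideanSpace.coe_proj]
        rw [Finset.sum_comm]
        refine Finset.sum_congr rfl fun j _ => Finset.sum_congr rfl fun k _ => ?_
        rw [hclosed p y (hball hy) j k]
        ring)
    exact ⟨r, hr, φ, hball, hφ⟩
  choose r hr φ hball hφ using hloc
  let B : M → Set M := fun p => (extChartAt (𝓡 n) p).source ∩
    extChartAt (𝓡 n) p ⁻¹' Metric.ball (center (n := n) p) (r p)
  have hB : ∀ p, IsOpen (B p) := fun p =>
    (continuousOn_extChartAt p).isOpen_inter_preimage (isOpen_extChartAt_source p) Metric.isOpen_ball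
  have hmem : ∀ p, p ∈ B p := fun p => ⟨mem_extChartAt_source p, Metric.mem_ball_self (hr p)⟩
  let F : M → M → ℝ := fun p q => φ p (extChartAt (𝓡 n) p q)
  have hFself : ∀ p, ∀ y ∈ Metric.ball (center (n := n) p) (r p),
      HasFDerivAt (fun z => F p ((extChartAt (𝓡 n) p).symm z)) (dualForm g V p y) y := by
    intro p y hy
    refine (hφ p y hy).congr_of_eventuallyEq ?_
    filter_upwards [(isOpen_chart_target p).mem_nhds (hball p hy)] with z hz
    change φ p (extChartAt (𝓡 n) p ((extChartAt (𝓡 n) p).symm z)) = φ p z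
    rw [(extChartAt (𝓡 n) p).right_inv hz]
  have hFd : ∀ p q x, x ∈ (extChartAt (𝓡 n) p).source → x ∈ B q →
      ∀ᶠ y in 𝓝 (extChartAt (𝓡 n) p x),
        HasFDerivAt (fun z => F q ((extChartAt (𝓡 n) p).symm z)) (dualForm g V p y) y := by
    intro p q x hxp hxq
    have h1 : ∀ᶠ y in 𝓝 (extChartAt (𝓡 n) p x), (extChartAt (𝓡 n) p).symm y ∈ B q := by
      refine (continuousAt_extChartAt_symm' hxp).eventually ?_
      rw [(extChartAt (𝓡 n) p).left_inv hxp]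
      exact (hB q).mem_nhds hxq
    filter_upwards [h1, (isOpen_chart_target p).mem_nhds ((extChartAt (𝓡 n) p).map_source hxp)]
      with y hy hyt
    exact hasFDerivAt_chart_change ⟨hyt, hy.1⟩ (hFself q _ hy.2)
  have := ChartedSpace.locallyPathConnectedSpace (EuclideanSpace ℝ (Fin n)) M
  -- On overlaps two local primitives have the same differential in the chart at p, so they differ
  -- by a locally constant function.
  obtain ⟨f, hf⟩ := exists_global_primitive B hB hmem F fun p q x hx =>
    eventually_sub_eq_of_hasFDerivAt hx.1.1 (hFd p p x hx.1.1 hx.1) (hFd p q x hx.1.1 hx.2)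
  refine ⟨f, fun p y hy => ?_⟩
  set x := (extChartAt (𝓡 n) p).symm y with hxdef
  have hxp : x ∈ (extChartAt (𝓡 n) p).source := (extChartAt (𝓡 n) p).map_target hy
  have h1 := (hFd p x x hxp (hmem x)).self_of_nhds
  rw [hxdef, (extChartAt (𝓡 n) p).right_inv hy, ← hxdef] at h1
  refine (h1.add_const (f x - F x x)).congr_of_eventuallyEq ?_
  have h2 : ContinuousAt (extChartAt (𝓡 n) p).symm y := by
    have := continuousAt_extChartAt_symm' (I := 𝓡 n) hxp
    rwa [hxdef, (extChartAt (𝓡 n) p).right_inv hy] at this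
  filter_upwards [h2.eventually (hf x x (hmem x))] with z hz
  linarith

end Potential

end ConformalEinstein

namespace ConformalEinstein
open Matrix Filter

/-! ### The correspondence between Einstein metrics and solutions of E_V = 0. -/

section Main

variable {n : ℕ} {M : Type*} [TopologicalSpace M] [ChartedSpace (EuclideanSpace ℝ (Fin n)) M]
  [IsManifold (𝓡 n) ∞ M]

omit [IsManifold (𝓡 n) ∞ M] in
lemma contMDiff_of_symm {f : M → ℝ}
    (hf : ∀ p : M, ContDiffAt ℝ ∞ (fun y => f ((extChartAt (𝓡 n) p).symm y)) (center p)) :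
    ContMDiff (𝓡 n) 𝓘(ℝ, ℝ) ∞ f := by
  intro p
  have h1 : ContMDiffAt 𝓘(ℝ, Coord n) 𝓘(ℝ, ℝ) ∞ (fun y => f ((extChartAt (𝓡 n) p).symm y))
      (extChartAt (𝓡 n) p p) := (hf p).contMDiffAt
  refine (h1.comp p contMDiffAt_extChartAt).congr_of_eventuallyEq ?_
  filter_upwards [extChartAt_source_mem_nhds (I := 𝓡 n) p] with q hq
  rw [Function.comp_apply, (extChartAt (𝓡 n) p).left_inv hq]

/-- The traceless Ricci tensor of `e^{-2f} g` is the conformal Ricci tensor of `g` with respect to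
the gradient of `f`. -/
theorem tracelessRicci_eq_localConformalRicci (hn : 4 ≤ n) {g h : Metric n M} {f : M → ℝ}
    (hf : ContMDiff (𝓡 n) 𝓘(ℝ, ℝ) ∞ f)
    (hh : ∀ (p : M) (v w : TangentSpace (𝓡 n) p),
      h.inner p v w = Real.exp (-2 * f p) * g.inner p v w)
    {V : (q : M) → TangentSpace (𝓡 n) q} {p : M}
    (hV : ∀ k, ContDiffOn ℝ ∞ (fun y => vecInChart V p y k) (extChartAt (𝓡 n) p).target)
    (hfV : ∀ y ∈ (extChartAt (𝓡 n) p).target, ∀ l,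
      flat (metricInChart g p) (vecInChart V p) y l
        = pd l (fun z => f ((extChartAt (𝓡 n) p).symm z)) y)
    {y : Coord n} (hy : y ∈ (extChartAt (𝓡 n) p).target) (j k : Fin n) :
    tracelessRicci (metricInChart h p) y j k
      = localConformalRicci (metricInChart g p) (vecInChart V p) y j k := by
  have hnhds := (isOpen_chart_target p).mem_nhds hy
  have hfs := contDiffOn_symm (p := p) le_rfl hf.contMDiffOn
  refine (isMetricOn_metricInChart g p).tracelessRicci_conformal hy hn
    (isMetricOn_metricInChart h p)
    (c := fun z => Real.exp (-2 * f ((extChartAt (𝓡 n) p).symm z)))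
    (contDiffAt_const.mul (hfs.contDiffAt hnhds)).exp (Real.exp_pos _).ne' ?_
    (fun k => (hV k).contDiffAt hnhds) (hfs.contDiffAt hnhds) ?_ ?_ j k
  · refine Eventually.of_forall fun z => ?_
    ext a b
    exact hh _ _ _
  · filter_upwards [hnhds] with z hz using hfV z hz
  · filter_upwards [hnhds] with z hz i
    have hd : DifferentiableAt ℝ (fun z => f ((extChartAt (𝓡 n) p).symm z)) z :=
      (hfs.contDiffAt ((isOpen_chart_target p).mem_nhds hz)).differentiableAt (by simp)
    have h1 := ((hd.hasFDerivAt.const_mul (-2)).exp).fderiv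
    rw [pd, h1]
    simp only [FunLike.coe_smul, Pi.smul_apply, smul_eq_mul, pd]
    ring

variable {g : Metric n M}

/-- A vector field with vanishing conformal Ricci tensor is the canonical vector field wherever the
kernel of the Weyl tensor is trivial. -/
theorem eq_canonicalField (hn : 4 ≤ n) {V : (q : M) → TangentSpace (𝓡 n) q} {p : M}
    (hV : ∀ k, ContDiffOn ℝ ∞ (fun y => vecInChart V p y k) (extChartAt (𝓡 n) p).target)
    (hE : ∀ y ∈ (extChartAt (𝓡 n) p).target, ∀ i j,
      localConformalRicci (metricInChart g p) (vecInChart V p) y i j = 0)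
    (hker : Module.finrank ℝ (weylKernel g p) = 0) : V p = canonicalField g p := by
  have hm := isMetricOn_metricInChart g p
  have hx := center_mem_target (n := n) p
  have hnhds := (isOpen_chart_target p).mem_nhds hx
  have hsharp := hm.sum_ginv_flat hx (vecInChart V p)
  have h1 := hm.canonicalCovector_eq hx hn hker (fun m => (hsharp m).symm)
    (hm.divWeyl_eq hx hn (fun k => (hV k).contDiffAt hnhds)
      (by filter_upwards [hnhds] with y hy using hE y hy))
  have h2 : (WithLp.toLp 2 fun k => ∑ j, ginv (metricInChart g p) (center p) k j *
      canonicalCovector (metricInChart g p) (center p) j : Coord n)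
      = vecInChart V p (center p) := by
    ext k
    rw [h1]
    exact hsharp k
  exact ((vecInChart_center V p).symm.trans h2.symm)

/-- A `C²` vector field with vanishing conformal Ricci tensor on a dense set has vanishing conformal
Ricci tensor. -/
theorem localConformalRicci_eq_zero_of_dense {S : Set M} (hS : Dense S)
    {V : (q : M) → TangentSpace (𝓡 n) q}
    (hV : ContMDiff (𝓡 n) (𝓡 n).tangent 2 (fun q => (⟨q, V q⟩ : TangentBundle (𝓡 n) M)))
    (hE : ∀ p ∈ S, ∀ i j, conformalRicci g V p i j = 0) {p : M} {y : Coord n}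
    (hy : y ∈ (extChartAt (𝓡 n) p).target) (i j : Fin n) :
    localConformalRicci (metricInChart g p) (vecInChart V p) y i j = 0 := by
  by_contra hne
  have hnhds := (isOpen_chart_target p).mem_nhds hy
  have hc := ((isMetricOn_metricInChart g p).localConformalRicci_continuousOn
    (contDiffOn_vecInChart two_le_infty hV p) i j).continuousAt hnhds
  have hq : (extChartAt (𝓡 n) p).symm y ∈ (extChartAt (𝓡 n) p).source :=
    (extChartAt (𝓡 n) p).map_target hy
  have h1 := continuousAt_extChartAt' (I := 𝓡 n) hq
  rw [ContinuousAt, (extChartAt (𝓡 n) p).right_inv hy] at h1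
  -- If E_V were nonzero at y it would be nonzero nearby, hence at some point of the dense set S.
  obtain ⟨q, hqS, hqs, hq0⟩ := ((mem_closure_iff_frequently.mp (hS _)).and_eventually
    ((eventually_mem_set.mpr (extChartAt_source_mem_nhds' (I := 𝓡 n) hq)).and
      (h1.eventually (hc.eventually_ne hne)))).exists
  refine hq0 (localConformalRicci_eq_zero g hV ((extChartAt (𝓡 n) p).map_source hqs) ?_ i j)
  rw [(extChartAt (𝓡 n) p).left_inv hqs]
  exact hE q hqS

/-- A metric which is conformal to an Einstein metric admits a smooth vector field with vanishing
conformal Ricci tensor. -/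
theorem exists_conformalRicci_eq_zero (hn : 4 ≤ n) {h : Metric n M}
    (hconf : IsGloballyConformal g h) (hE : IsEinstein h) :
    ∃ V : (q : M) → TangentSpace (𝓡 n) q,
      ContMDiff (𝓡 n) (𝓡 n).tangent ∞ (fun q => (⟨q, V q⟩ : TangentBundle (𝓡 n) M)) ∧
      ∀ p : M, ∀ y ∈ (extChartAt (𝓡 n) p).target, ∀ i j,
        localConformalRicci (metricInChart g p) (vecInChart V p) y i j = 0 := by
  obtain ⟨ψ, hψ, hpos, hh⟩ := hconf
  -- With f = log ψ the factor ψ⁻² becomes e^{-2f}, whose logarithmic differential is -2 df.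
  have hf : ContMDiff (𝓡 n) 𝓘(ℝ, ℝ) ∞ fun p => Real.log (ψ p) := fun p =>
    (Real.contDiffAt_log.mpr (hpos p).ne').contMDiffAt.comp p (hψ p)
  obtain ⟨V, hV, hfV⟩ := exists_gradient g hf
  refine ⟨V, hV, fun p y hy i j => ?_⟩
  rw [← tracelessRicci_eq_localConformalRicci hn hf (h := h) (fun q v w => ?_)
    (contDiffOn_vecInChart le_rfl hV p) (hfV p) hy, hE.tracelessRicci_eq_zero hy]
  rw [hh, neg_mul, Real.exp_neg, two_mul, Real.exp_add, Real.exp_log (hpos q), pow_two]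

/-- A vector field of class `C²` with vanishing conformal Ricci tensor on a simply connected manifold
is the gradient of a function `f` such that `e^{-2f} g` is an Einstein metric. -/
theorem exists_einstein_of_conformalRicci_eq_zero [SimplyConnectedSpace M] (hn : 4 ≤ n)
    {V : (q : M) → TangentSpace (𝓡 n) q}
    (hV : ContMDiff (𝓡 n) (𝓡 n).tangent 2 (fun q => (⟨q, V q⟩ : TangentBundle (𝓡 n) M)))
    (hE : ∀ p : M, ∀ y ∈ (extChartAt (𝓡 n) p).target, ∀ i j,
        localConformalRicci (metricInChart g p) (vecInChart V p) y i j = 0) :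
    ∃ h : Metric n M, IsGloballyConformal g h ∧ IsEinstein h := by
  have hV2 := contDiffOn_vecInChart two_le_infty hV
  have hVs : ∀ p k, ContDiffOn ℝ ∞ (fun y => vecInChart V p y k) (extChartAt (𝓡 n) p).target :=
    fun p => (isMetricOn_metricInChart g p).contDiffOn_infty_of_localConformalRicci hn (hV2 p)
      (hE p)
  obtain ⟨f, hf⟩ := exists_potential (g := g) hV fun p y hy =>
    (isMetricOn_metricInChart g p).pd_flat_symm hn hy (fun k => ((hV2 p k).contDiffAt
      ((isOpen_chart_target p).mem_nhds hy)).differentiableAt (by norm_num)) (hE p y hy)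
  have hpd : ∀ p : M, ∀ y ∈ (extChartAt (𝓡 n) p).target, ∀ l,
      flat (metricInChart g p) (vecInChart V p) y l
        = pd l (fun z => f ((extChartAt (𝓡 n) p).symm z)) y := by
    intro p y hy l
    rw [pd, (hf p y hy).fderiv, dualForm_apply]
    simp
  -- The partial derivatives of f are the components of V*, already known to be smooth.
  have hfs : ContMDiff (𝓡 n) 𝓘(ℝ, ℝ) ∞ f := contMDiff_of_symm fun p => by
    refine ContDiffOn.contDiffAt (contDiffOn_infty.mpr fun m => ?_)
      ((isOpen_chart_target p).mem_nhds (center_mem_target p))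
    refine (contDiffOn_succ_of_pd (m := m) (isOpen_chart_target p)
      (fun y hy => (hf p y hy).differentiableAt.differentiableWithinAt) fun l => ?_).of_le
      (by exact_mod_cast Nat.le_succ m)
    exact (((isMetricOn_metricInChart g p).flat_contDiffOn le_rfl (hVs p) l).of_le
      (by exact_mod_cast le_top)).congr fun y hy => (hpd p y hy l).symm
  have hexp : ∀ a : ℝ, ContMDiff (𝓡 n) 𝓘(ℝ, ℝ) ∞ fun p => Real.exp (a * f p) := fun a =>
    (Real.contDiff_exp.comp (contDiff_const.mul contDiff_id)).contMDiff.comp hfs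
  -- The conformal function is ψ = e^f, written with exponent 1 * f so that `hexp` supplies both its
  -- smoothness and that of e^{-2f}.
  refine ⟨conformalMetric g (fun p => Real.exp (-2 * f p)) (hexp _) fun p => Real.exp_pos _,
    ⟨fun p => Real.exp (1 * f p), hexp 1, fun p => Real.exp_pos _, fun p v w => ?_⟩,
    fun p i j => ?_⟩
  · change Real.exp (-2 * f p) * g.inner p v w = _
    rw [← Real.exp_nat_mul, ← Real.exp_neg]
    congr 2
    push_cast
    ring
  · rw [tracelessRicci_eq_localConformalRicci hn hfs (g := g) (fun q v w => rfl) (hVs p) (hpd p)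
      (center_mem_target p), hE p _ (center_mem_target p)]

end Main

end ConformalEinstein

end

theorem mainTheorem1 (n : ℕ) (hn : 4 ≤ n) {M : Type*} [TopologicalSpace M] [T2Space M]
    [SecondCountableTopology M] [ChartedSpace (EuclideanSpace ℝ (Fin n)) M]
    [IsManifold (𝓡 n) ∞ M] [SimplyConnectedSpace M]
    (g : ConformalEinstein.Metric n M)
    (hrank : ∀ p ∈ ConformalEinstein.regularSet g,
      Module.finrank ℝ (ConformalEinstein.weylKernel g p) = 0) :
    (∃ h : ConformalEinstein.Metric n M,
        ConformalEinstein.IsGloballyConformal g h ∧ ConformalEinstein.IsEinstein h) ↔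
      (∀ p ∈ ConformalEinstein.regularSet g, ∀ i j : Fin n,
          ConformalEinstein.conformalRicci g (ConformalEinstein.canonicalField g) p i j = 0) ∧
        ∃ V : (p : M) → TangentSpace (𝓡 n) p,
          ContMDiff (𝓡 n) (𝓡 n).tangent 2 (fun p => (⟨p, V p⟩ : TangentBundle (𝓡 n) M)) ∧
            ∀ p ∈ ConformalEinstein.regularSet g, V p = ConformalEinstein.canonicalField g p := by
  constructor
  · rintro ⟨h, hconf, hE⟩
    obtain ⟨V, hV, hVE⟩ := ConformalEinstein.exists_conformalRicci_eq_zero hn hconf hE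
    -- The gradient of log ψ is thus the required global extension of 𝕋, even a smooth one.
    have hVT : ∀ p ∈ ConformalEinstein.regularSet g,
        V p = ConformalEinstein.canonicalField g p := fun p hp =>
      ConformalEinstein.eq_canonicalField hn (ConformalEinstein.contDiffOn_vecInChart le_rfl hV p)
        (hVE p) (hrank p hp)
    refine ⟨fun p hp i j => ?_, V, hV.of_le ConformalEinstein.two_le_infty, hVT⟩
    rw [← ConformalEinstein.conformalRicci_congr g (V := V)]
    · exact hVE p _ (ConformalEinstein.center_mem_target p) i j
    · filter_upwards [(ConformalEinstein.isOpen_regularSet g).mem_nhds hp] with q hq using hVT q hq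
  · rintro ⟨hE, V, hV, hVT⟩
    refine ConformalEinstein.exists_einstein_of_conformalRicci_eq_zero hn hV fun p y hy =>
      -- V agrees with 𝕋 on the open set M_ℰ, so E_V vanishes there, and then on M by density.
      ConformalEinstein.localConformalRicci_eq_zero_of_dense
        (ConformalEinstein.dense_regularSet g) hV (fun q hq i j => ?_) hy
    rw [ConformalEinstein.conformalRicci_congr g (V' := ConformalEinstein.canonicalField g)]
    · exact hE q hq i j
    · filter_upwards [(ConformalEinstein.isOpen_regularSet g).mem_nhds hq] with r hr using hVT r hr
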